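/- Let $(M,d)$ be a complete metric space with a $\sigma$-finite Radon measure $\mathbf m$ (a locally finite Borel measure, inner regular with respect to compact sets), and let $1<p<\infty$. Convergence in $L^0(\mathbf m)$ means convergence in measure on sets of finite measure. **Modules of functionals.** Let $V$ be a real vector space with a linear map $V\to L^0(\mathbf m)$ (so that elements of $V$ may be regarded as functions) and let $f\mapsto g_f$, $V\to L^p_+(\mathbf m)$, be subadditive and absolutely homogeneous. The module generated by this functional is the completion of the space of countable families $(f_i,A_i)$, where $(A_i)$ is a Borel partition of $M$, $f_i\in V$ and $\sum_i\int_{A_i}g_{f_i}^p\,d\mathbf m<\infty$, two families $(f_i,A_i)$, $(h_j,B_j)$ being identified if $g_{f_i-h_j}=0$ a.e. on $A_i\cap B_j$ for all $i,j$, with respect to the norm $\|\,|v|\,\|_{L^p(\mathbf m)}$, where $|(f_i,A_i)|=g_{f_i}$ on $A_i$. The pointwise norm $|\cdot|$ extends to the completion with values in $L^p(\mathbf m)$, and so does the multiplication by $L^\infty(\mathbf m)$ that is given for countably valued $a=\sum_j a_j\chi_{B_j}$ by $a\cdot(f_i,A_i)=(a_jf_i,A_i\cap B_j)$. The differential of $f\in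 V$ is $df=(f,M)$. The module is *weakly reflexive* if every bounded sequence $df_n$ with $f_n\in V$ convergent in $L^0(\mathbf m)$ has a weakly convergent subsequence. **The Lipschitz module and the cotangent module.** Let $D_{\rm lip}$ be the space of Lipschitz functions $f:M\to\mathbb R$ with $\operatorname{lip}f\in L^p(\mathbf m)$, where $\operatorname{lip}f(x)=\limsup_{y\to x}|f(y)-f(x)|/d(y,x)$ (and $0$ at isolated points). The functional $f\mapsto\operatorname{lip}f$ on $D_{\rm lip}$ generates the $L^p$-Lipschitz module $L^p_{\rm lip}(T^*M)$ with differential $d_{\rm lip}$. Let $D_p\subset L^0(\mathbf m)$ be the set of all $f$ with $\inf\{\liminf_n\int(\operatorname{lip}f_n)^p\,d\mathbf m : D_{\rm lip}\ni f_n\to f\text{ in }L^0(\mathbf m)\}<\infty$. For $f\in D_p$ the relaxed slope $|Df|_{*,p}$ is the greatest $G\in L^p(\mathbf m)$ such that $G\le\tilde G$ a.e. whenever $D_{\rm lip}\ni f_n\to f$ in $L^0(\mathbf m)$ and $\operatorname{lip}f_n\rightharpoonup\tilde G$ weakly in $L^p(\mathbf m)$. The functional $f\mapsto|Df|_{*,p}$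 on $D_p$ generates the $L^p$-cotangent module $L^p(T^*M)$ with differential $d_p$. **The $\text{Lipschitz}_0$ module.** Let $L^p_{\rm lip_0}(T^*M)$ be the closed $L^\infty(\mathbf m)$-submodule of $L^p_{\rm lip}(T^*M)$ generated by all $\omega$ for which there are $f_n\in D_{\rm lip}$ with $f_n\to0$ in $L^0(\mathbf m)$ and $d_{\rm lip}f_n\to\omega$ strongly in $L^p_{\rm lip}(T^*M)$. **Theorem.** Assume that $L^p_{\rm lip}(T^*M)$ is weakly reflexive. Then: 1. $L^p_{\rm lip_0}(T^*M)$ is an $L^p(\mathbf m)$-normed submodule of $L^p_{\rm lip}(T^*M)$: it is a closed subspace, stable under multiplication by $L^\infty(\mathbf m)$, with the following two properties. Locality: if $\chi_{A_n}\cdot v=0$ for all $n$, then $\chi_{\bigcup_nA_n}\cdot v=0$. Glueing: if $\chi_{A_i\cap A_j}\cdot v_i=\chi_{A_i\cap A_j}\cdot v_j$ for all $i,j$ and the norms $\|\sum_{i<n}\chi_{A_i}\cdot v_i\|$ are bounded, then there is $w$ in the submodule with $\chi_{A_i}\cdot w=\chi_{A_i}\cdot v_i$ for all $i$ and $\|w\|\le\liminf_n\|\sum_{i<n}\chi_{A_i}\cdot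 v_i\|$. 2. There is a surjective linear isometry $$\Phi:\ L^p_{\rm lip}(T^*M)\big/L^p_{\rm lip_0}(T^*M)\ \longrightarrow\ L^p(T^*M)$$ (the quotient carrying the quotient norm) that is $L^\infty(\mathbf m)$-linear, satisfies $\Phi([d_{\rm lip}f])=d_pf$ for all $f\in D_{\rm lip}$, and preserves pointwise norms: $|\Phi([v])|$ is the greatest lower bound in $L^p(\mathbf m)$ of $\{|v+w| : w\in L^p_{\rm lip_0}(T^*M)\}$. 3. $d_{\rm lip}$ is closable as an operator from $L^0(\mathbf m)$ to $L^p_{\rm lip}(T^*M)$ (if $f_n\to g$ and $h_n\to g$ in $L^0(\mathbf m)$ with $f_n,h_n\in D_{\rm lip}$, $d_{\rm lip}f_n\to\omega$ and $d_{\rm lip}h_n\to\eta$, then $\omega=\eta$) if and only if $L^p_{\rm lip_0}(T^*M)=\{0\}$. 4. In that case there is a surjective linear isometry $L^p_{\rm lip}(T^*M)\to L^p(T^*M)$ that is $L^\infty(\mathbf m)$-linear, preserves pointwise norms and sends $d_{\rm lip}f$ to $d_pf$ for all $f\in D_{\rm lip}$; and $|Df|_{*,p}=\operatorname{lip}f$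 $\mathbf m$-a.e. for every Lipschitz function $f$ whose class belongs to $D_p$. -/

import Mathlib

open MeasureTheory Filter Topology Set
open scoped NNReal ENNReal

/-- The standing integrability exponent `p` is a real number in `(1, ∞)`. -/
instance one_le_exponent (p : ℝ≥0) [hp : Fact (1 < p)] : Fact (1 ≤ (p : ℝ≥0∞)) :=
  ⟨by exact_mod_cast hp.out.le⟩

noncomputable section

namespace NormedModules

section General

variable {M : Type*} [MeasurableSpace M]

/-- Convergence in `L⁰(μ)`: convergence in measure on every set of finite measure. -/
def TendstoL0 {μ : Measure M} (f : ℕ → M →ₘ[μ] ℝ) (g : M →ₘ[μ] ℝ) : Prop :=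
  ∀ E : Set M, MeasurableSet E → μ E < ∞ →
    TendstoInMeasure (μ.restrict E) (fun n => (f n : M → ℝ)) atTop (g : M → ℝ)

/-- Weak convergence of a sequence in a normed space. -/
def TendstoWeakly {E : Type*} [NormedAddCommGroup E] [NormedSpace ℝ E] (u : ℕ → E) (a : E) :
    Prop :=
  ∀ φ : StrongDual ℝ E, Tendsto (fun n => φ (u n)) atTop (𝓝 (φ a))

/-- `s` takes countably many values, each on a measurable set; equivalently, `s` is given by a
countable measurable partition and one value on each piece. -/
def IsPiecewiseConst {X : Type*} (s : M → X) : Prop :=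
  (range s).Countable ∧ ∀ v, MeasurableSet (s ⁻¹' {v})

theorem IsPiecewiseConst.const {X : Type*} (v : X) : IsPiecewiseConst (fun _ : M => v) := by
  refine ⟨(countable_singleton v).mono ?_, fun w => ?_⟩
  · rintro _ ⟨x, rfl⟩; rfl
  · by_cases h : v = w <;> simp [h]

theorem IsPiecewiseConst.map₂ {X Y Z : Type*} (op : X → Y → Z) {s : M → X} {t : M → Y}
    (hs : IsPiecewiseConst s) (ht : IsPiecewiseConst t) :
    IsPiecewiseConst (fun x => op (s x) (t x)) := by
  refine ⟨(hs.1.image2 ht.1 op).mono ?_, fun z => ?_⟩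
  · rintro _ ⟨x, rfl⟩
    exact ⟨s x, mem_range_self x, t x, mem_range_self x, rfl⟩
  · have : (fun x => op (s x) (t x)) ⁻¹' {z} =
        ⋃ v ∈ range s, ⋃ w ∈ range t, ⋃ (_ : op v w = z), (s ⁻¹' {v} ∩ t ⁻¹' {w}) := by
      ext x
      simp only [mem_preimage, mem_singleton_iff, mem_iUnion, mem_inter_iff, exists_prop]
      constructor
      · intro h
        exact ⟨s x, mem_range_self x, t x, mem_range_self x, h, rfl, rfl⟩
      · rintro ⟨v, -, w, -, h, rfl, rfl⟩
        exact h
    rw [this]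
    refine MeasurableSet.biUnion hs.1 fun v _ => MeasurableSet.biUnion ht.1 fun w _ =>
      MeasurableSet.iUnion fun _ => (hs.2 v).inter (ht.2 w)

theorem IsPiecewiseConst.of_countable {X : Type*} [MeasurableSpace X] [MeasurableSingletonClass X]
    {s : M → X} (h : (range s).Countable) (hs : Measurable s) : IsPiecewiseConst s :=
  ⟨h, fun v => hs (measurableSet_singleton v)⟩

theorem IsPiecewiseConst.measurable_eval {X : Type*} {s : M → X} (hs : IsPiecewiseConst s)
    {g : X → M → ℝ} (hg : ∀ v, Measurable (g v)) : Measurable (fun x => g (s x) x) := by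
  intro B hB
  have : (fun x => g (s x) x) ⁻¹' B = ⋃ v ∈ range s, (s ⁻¹' {v} ∩ g v ⁻¹' B) := by
    ext x
    simp only [mem_preimage, mem_iUnion, mem_inter_iff, mem_singleton_iff, exists_prop]
    constructor
    · intro h
      exact ⟨s x, mem_range_self x, rfl, h⟩
    · rintro ⟨v, -, rfl, h⟩
      exact h
  rw [this]
  exact MeasurableSet.biUnion hs.1 fun v _ => (hs.2 v).inter (hg v hB)

/-- An `L^p`-valued functional on a real vector space `V` of functions (`toL0` sends an element
of `V` to its class in `L⁰(μ)`): `val f = g_f` is non-negative, subadditive and absolutely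
homogeneous. -/
structure LpFunctional (μ : Measure M) (p : ℝ≥0) [Fact (1 < p)] (V : Type*) [AddCommGroup V]
    [Module ℝ V] where
  toL0 : V →ₗ[ℝ] (M →ₘ[μ] ℝ)
  val : V → Lp ℝ p μ
  nonneg' : ∀ f, 0 ≤ val f
  add_le' : ∀ f h, val (f + h) ≤ val f + val h
  smul' : ∀ (c : ℝ) (f : V), val (c • f) = |c| • val f

namespace LpFunctional

variable {μ : Measure M} {p : ℝ≥0} [Fact (1 < p)] {V : Type*} [AddCommGroup V] [Module ℝ V]
  (F : LpFunctional μ p V)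

theorem val_zero : F.val 0 = 0 := by
  have := F.smul' 0 0
  simpa using this

/-- The function `x ↦ g_{s(x)}(x)` attached to `s : M → V`. -/
def eval (s : M → V) (x : M) : ℝ := F.val (s x) x

theorem measurable_eval {s : M → V} (hs : IsPiecewiseConst s) : Measurable (F.eval s) :=
  hs.measurable_eval fun v => (Lp.stronglyMeasurable (F.val v)).measurable

theorem ae_eval {s : M → V} (hs : IsPiecewiseConst s) {P : V → M → Prop}
    (h : ∀ v, ∀ᵐ x ∂μ, P v x) : ∀ᵐ x ∂μ, P (s x) x := by
  have := (ae_ball_iff hs.1).2 fun v _ => h v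
  filter_upwards [this] with x hx using hx (s x) (mem_range_self x)

theorem ae_nonneg (v : V) : ∀ᵐ x ∂μ, 0 ≤ F.val v x := by
  have := (Lp.coeFn_nonneg (F.val v)).2 (F.nonneg' v)
  exact this

theorem ae_eval_nonneg {s : M → V} (hs : IsPiecewiseConst s) : ∀ᵐ x ∂μ, 0 ≤ F.eval s x :=
  ae_eval hs F.ae_nonneg

theorem ae_add_le (v w : V) : ∀ᵐ x ∂μ, F.val (v + w) x ≤ F.val v x + F.val w x := by
  have h := (Lp.coeFn_le _ _).2 (F.add_le' v w)
  filter_upwards [h, Lp.coeFn_add (F.val v) (F.val w)] with x hx h2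
  rw [h2] at hx
  exact hx

theorem ae_smul (c : ℝ) (v : V) : ∀ᵐ x ∂μ, F.val (c • v) x = |c| * F.val v x := by
  rw [F.smul' c v]
  filter_upwards [Lp.coeFn_smul (|c|) (F.val v)] with x hx
  simpa using hx

theorem ae_eval_add_le {s t : M → V} (hs : IsPiecewiseConst s) (ht : IsPiecewiseConst t) :
    ∀ᵐ x ∂μ, F.eval (s + t) x ≤ F.eval s x + F.eval t x :=
  ae_eval (s := fun x => (s x, t x)) (hs.map₂ Prod.mk ht)
    (P := fun q x => F.val (q.1 + q.2) x ≤ F.val q.1 x + F.val q.2 x)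
    fun q => F.ae_add_le q.1 q.2

theorem ae_eval_smul {c : M → ℝ} {s : M → V} (hc : IsPiecewiseConst c) (hs : IsPiecewiseConst s) :
    ∀ᵐ x ∂μ, F.eval (fun x => c x • s x) x = |c x| * F.eval s x :=
  ae_eval (s := fun x => (c x, s x)) (hc.map₂ Prod.mk hs)
    (P := fun q x => F.val (q.1 • q.2) x = |q.1| * F.val q.2 x)
    fun q => F.ae_smul q.1 q.2

/-- Pre-forms: families `(f_i, A_i)` with `(A_i)` a countable measurable partition of `M`,
`f_i ∈ V` and `∑ i, ∫_{A_i} g_{f_i}^p dμ < ∞`, written as maps `s : M → V` with `s = f_i` on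
`A_i`. -/
def pfmSubmodule : Submodule ℝ (M → V) where
  carrier := {s | IsPiecewiseConst s ∧ MemLp (F.eval s) p μ}
  zero_mem' := by
    refine ⟨IsPiecewiseConst.const 0, ?_⟩
    exact Lp.memLp (F.val 0)
  add_mem' := by
    rintro s t ⟨hs, hs'⟩ ⟨ht, ht'⟩
    have hst : IsPiecewiseConst (s + t) := hs.map₂ (· + ·) ht
    refine ⟨hst, (hs'.add ht').mono (F.measurable_eval hst).aestronglyMeasurable ?_⟩
    filter_upwards [F.ae_eval_add_le hs ht, F.ae_eval_nonneg hst] with x hx h0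
    rw [Real.norm_of_nonneg h0]
    exact hx.trans (le_abs_self _)
  smul_mem' := by
    rintro c s ⟨hs, hs'⟩
    have hc : IsPiecewiseConst (fun x => c • s x) := (IsPiecewiseConst.const c).map₂ (· • ·) hs
    refine ⟨hc, (hs'.const_mul |c|).ae_eq ?_⟩
    filter_upwards [F.ae_eval_smul (IsPiecewiseConst.const c) hs] with x hx
    exact hx.symm

/-- The vector space of pre-forms generated by the functional. -/
def Pfm : Type _ := F.pfmSubmodule

instance : AddCommGroup F.Pfm := inferInstanceAs (AddCommGroup F.pfmSubmodule)

instance : Module ℝ F.Pfm := inferInstanceAs (Module ℝ F.pfmSubmodule)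

variable {F}

/-- The map `M → V` underlying a pre-form. -/
def Pfm.fn (s : F.Pfm) : M → V := Subtype.val (p := fun s => s ∈ F.pfmSubmodule) s

theorem Pfm.isPiecewiseConst (s : F.Pfm) : IsPiecewiseConst s.fn :=
  (Subtype.property (p := fun s => s ∈ F.pfmSubmodule) s).1

theorem Pfm.memLp (s : F.Pfm) : MemLp (F.eval s.fn) p μ :=
  (Subtype.property (p := fun s => s ∈ F.pfmSubmodule) s).2

variable (F)

/-- Constructor for pre-forms. -/
def mkPfm (s : M → V) (hs : IsPiecewiseConst s) (h : MemLp (F.eval s) p μ) : F.Pfm :=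
  (⟨s, hs, h⟩ : F.pfmSubmodule)

variable {F}

/-- The pointwise norm `|s| = g_{f_i}` on `A_i` of a pre-form, as an element of `L^p(μ)`. -/
def Pfm.pnorm (s : F.Pfm) : Lp ℝ p μ := s.memLp.toLp (F.eval s.fn)

theorem Pfm.coeFn_pnorm (s : F.Pfm) : s.pnorm =ᵐ[μ] F.eval s.fn := s.memLp.coeFn_toLp

theorem Pfm.pnorm_nonneg (s : F.Pfm) : 0 ≤ s.pnorm := by
  rw [← Lp.coeFn_nonneg]
  filter_upwards [s.coeFn_pnorm, F.ae_eval_nonneg s.isPiecewiseConst] with x h1 h2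
  rw [h1]; exact h2

theorem Pfm.pnorm_add_le (s t : F.Pfm) : (s + t).pnorm ≤ s.pnorm + t.pnorm := by
  rw [← Lp.coeFn_le]
  filter_upwards [(s + t).coeFn_pnorm, s.coeFn_pnorm, t.coeFn_pnorm,
    Lp.coeFn_add s.pnorm t.pnorm,
    F.ae_eval_add_le s.isPiecewiseConst t.isPiecewiseConst] with x h1 h2 h3 h4 h5
  rw [h1, h4, Pi.add_apply, h2, h3]
  exact h5

theorem Pfm.pnorm_smul (c : ℝ) (s : F.Pfm) : (c • s).pnorm = |c| • s.pnorm := by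
  refine Lp.ext ?_
  filter_upwards [(c • s).coeFn_pnorm, s.coeFn_pnorm, Lp.coeFn_smul (|c|) s.pnorm,
    F.ae_eval_smul (IsPiecewiseConst.const c) s.isPiecewiseConst] with x h1 h2 h3 h4
  rw [h1, h3, Pi.smul_apply, h2, smul_eq_mul]
  exact h4

theorem norm_mono {u v : Lp ℝ p μ} (hu : 0 ≤ u) (h : u ≤ v) : ‖u‖ ≤ ‖v‖ :=
  norm_le_norm_of_abs_le_abs (by rwa [abs_of_nonneg hu, abs_of_nonneg (hu.trans h)])

variable (F)

/-- The seminorm `‖s‖ = ‖ |s| ‖_{L^p}` on pre-forms. -/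
def pfmSeminorm : Seminorm ℝ F.Pfm :=
  Seminorm.of (fun s => ‖s.pnorm‖)
    (fun s t => (norm_mono (s + t).pnorm_nonneg (s.pnorm_add_le t)).trans (norm_add_le _ _))
    (fun c s => by rw [Pfm.pnorm_smul, norm_smul, Real.norm_eq_abs, abs_abs, Real.norm_eq_abs])

instance : SeminormedAddCommGroup F.Pfm :=
  F.pfmSeminorm.toAddGroupSeminorm.toSeminormedAddCommGroup

theorem norm_pfm (s : F.Pfm) : ‖s‖ = ‖s.pnorm‖ := rfl

instance : NormedSpace ℝ F.Pfm where
  norm_smul_le c s := (F.pfmSeminorm.smul' c s).le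

/-- The module generated by the functional: the completion of the pre-forms modulo
`s ∼ t ↔ |s - t| = 0` a.e. (the separated completion performs the quotient). -/
abbrev Mod : Type _ := UniformSpace.Completion F.Pfm

/-- The differential `d f = [f, M]`. -/
def d : V →ₗ[ℝ] F.Mod where
  toFun f := ((F.mkPfm (fun _ => f) (IsPiecewiseConst.const f) (Lp.memLp (F.val f)) : F.Pfm) :
    F.Mod)
  map_add' f h := by
    rw [← UniformSpace.Completion.coe_add]; rfl
  map_smul' c f := by
    rw [RingHom.id_apply, ← UniformSpace.Completion.coe_smul]; rfl

/-- The pointwise norm `|·| : Mod → L^p(μ)`: the continuous extension of the pointwise norm of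
pre-forms. -/
def pnorm : F.Mod → Lp ℝ p μ :=
  UniformSpace.Completion.extension Pfm.pnorm

theorem uniformContinuous_pnorm : UniformContinuous (Pfm.pnorm : F.Pfm → Lp ℝ p μ) := by
  refine LipschitzWith.uniformContinuous (K := 1) (LipschitzWith.of_dist_le_mul fun s t => ?_)
  rw [NNReal.coe_one, one_mul, dist_eq_norm, dist_eq_norm]
  have key : ∀ s t : F.Pfm, s.pnorm - t.pnorm ≤ (s - t).pnorm := fun s t => by
    have := (s - t).pnorm_add_le t
    rw [sub_add_cancel] at this
    exact sub_le_iff_le_add.2 this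
  have hsymm : (t - s).pnorm = (s - t).pnorm := by
    have := Pfm.pnorm_smul (-1) (s - t)
    simpa using this
  refine norm_le_norm_of_abs_le_abs ?_
  rw [abs_of_nonneg (s - t).pnorm_nonneg]
  refine abs_le'.2 ⟨key s t, ?_⟩
  rw [neg_sub, ← hsymm]
  exact key t s

theorem pnorm_coe (s : F.Pfm) : F.pnorm (s : F.Mod) = s.pnorm :=
  UniformSpace.Completion.extension_coe F.uniformContinuous_pnorm s

theorem pnorm_d (f : V) : F.pnorm (F.d f) = F.val f := by
  refine (F.pnorm_coe _).trans ?_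
  exact Lp.toLp_coeFn (F.val f) _


/-- Multiplication of a pre-form by a bounded function `c` with countably many values:
`c · (f_i, A_i) = (c_j f_i, A_i ∩ B_j)` if `c = c_j` on `B_j`. -/
def mulPfmFun (c : M → ℝ) (hc : IsPiecewiseConst c) (K : ℝ) (hK : ∀ᵐ x ∂μ, |c x| ≤ K)
    (s : F.Pfm) : F.Pfm :=
  F.mkPfm (fun x => c x • s.fn x) (hc.map₂ (· • ·) s.isPiecewiseConst) (by
    refine (s.memLp.const_mul K).mono
      (F.measurable_eval (hc.map₂ (· • ·) s.isPiecewiseConst)).aestronglyMeasurable ?_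
    filter_upwards [hK, F.ae_eval_smul hc s.isPiecewiseConst] with x h1 h2
    rw [h2, norm_mul, norm_mul, Real.norm_eq_abs, abs_abs]
    exact mul_le_mul_of_nonneg_right (h1.trans (le_abs_self K)) (norm_nonneg _))

theorem pnorm_mulPfmFun (c : M → ℝ) (hc : IsPiecewiseConst c) (K : ℝ) (hK : ∀ᵐ x ∂μ, |c x| ≤ K)
    (s : F.Pfm) : ∀ᵐ x ∂μ, (F.mulPfmFun c hc K hK s).pnorm x = |c x| * s.pnorm x := by
  filter_upwards [F.ae_eval_smul hc s.isPiecewiseConst, (F.mulPfmFun c hc K hK s).coeFn_pnorm,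
    s.coeFn_pnorm] with x h2 h3 h4
  rw [h3, h4]
  exact h2

theorem norm_mulPfmFun_le (c : M → ℝ) (hc : IsPiecewiseConst c) (K : ℝ)
    (hK : ∀ᵐ x ∂μ, |c x| ≤ K) (s : F.Pfm) : ‖F.mulPfmFun c hc K hK s‖ ≤ K * ‖s‖ := by
  rw [norm_pfm, norm_pfm]
  refine Lp.norm_le_mul_norm_of_ae_le_mul ?_
  filter_upwards [hK, F.pnorm_mulPfmFun c hc K hK s] with x h1 h2
  rw [h2, norm_mul, Real.norm_eq_abs, abs_abs]
  exact mul_le_mul_of_nonneg_right h1 (norm_nonneg _)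

/-- `mulPfmFun` as a continuous linear map. -/
def mulPfm (c : M → ℝ) (hc : IsPiecewiseConst c) (K : ℝ) (hK : ∀ᵐ x ∂μ, |c x| ≤ K) :
    F.Pfm →L[ℝ] F.Pfm :=
  LinearMap.mkContinuous
    { toFun := F.mulPfmFun c hc K hK
      map_add' := fun s t => Subtype.ext (funext fun x => smul_add (c x) (s.fn x) (t.fn x))
      map_smul' := fun r s => Subtype.ext (funext fun x => smul_comm (c x) r (s.fn x)) }
    K (F.norm_mulPfmFun_le c hc K hK)

theorem mulPfm_apply (c : M → ℝ) (hc : IsPiecewiseConst c) (K : ℝ) (hK : ∀ᵐ x ∂μ, |c x| ≤ K)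
    (s : F.Pfm) : F.mulPfm c hc K hK s = F.mulPfmFun c hc K hK s := rfl

/-- The approximation `⌊(n+1) a⌋ / (n+1)` of `a` by functions with countably many values. -/
def quant (n : ℕ) (a : M → ℝ) (x : M) : ℝ := (⌊((n : ℝ) + 1) * a x⌋ : ℝ) / ((n : ℝ) + 1)

theorem abs_quant_sub_le (n : ℕ) (a : M → ℝ) (x : M) :
    |quant n a x - a x| ≤ 1 / ((n : ℝ) + 1) := by
  have hn : (0 : ℝ) < (n : ℝ) + 1 := by positivity
  have h1 := Int.floor_le (((n : ℝ) + 1) * a x)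
  have h2 := (Int.lt_floor_add_one (((n : ℝ) + 1) * a x)).le
  have : quant n a x - a x = ((⌊((n : ℝ) + 1) * a x⌋ : ℝ) - ((n : ℝ) + 1) * a x) / ((n : ℝ) + 1) := by
    unfold quant; field_simp
  rw [this, abs_div, abs_of_pos hn]
  refine div_le_div_of_nonneg_right ?_ hn.le
  rw [abs_le]; constructor <;> linarith

theorem isPiecewiseConst_quant (n : ℕ) {a : M → ℝ} (ha : Measurable a) :
    IsPiecewiseConst (quant n a) := by
  refine IsPiecewiseConst.of_countable
    ((countable_range fun k : ℤ => (k : ℝ) / ((n : ℝ) + 1)).mono ?_) ?_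
  · rintro _ ⟨x, rfl⟩
    exact ⟨⌊((n : ℝ) + 1) * a x⌋, rfl⟩
  · unfold quant
    fun_prop

theorem ae_quant_le (n : ℕ) (a : Lp ℝ ∞ μ) : ∀ᵐ x ∂μ, |quant n a x| ≤ ‖a‖ + 1 := by
  have h0 : ∀ᵐ x ∂μ, ‖a x‖ₑ ≤ eLpNorm a ∞ μ := by
    rw [eLpNorm_exponent_top]
    exact enorm_ae_le_eLpNormEssSup a μ
  filter_upwards [h0] with x hx
  have hx : ‖a x‖ ≤ ‖a‖ := by
    rw [Lp.norm_def, ← toReal_enorm]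
    exact ENNReal.toReal_mono (Lp.eLpNorm_ne_top a) hx
  have h1 := abs_quant_sub_le n a x
  have h2 : 1 / ((n : ℝ) + 1) ≤ 1 := by
    rw [div_le_one (by positivity)]; linarith [Nat.cast_nonneg (α := ℝ) n]
  have h3 : |quant n a x| ≤ |quant n a x - a x| + |a x| := by
    simpa using abs_add_le (quant n a x - a x) (a x)
  rw [Real.norm_eq_abs] at hx
  linarith

/-- Multiplication by the approximation `quant n a` of `a ∈ L^∞(μ)`, extended to the module. -/
def mulApprox (a : Lp ℝ ∞ μ) (n : ℕ) : F.Mod →L[ℝ] F.Mod :=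
  (F.mulPfm (quant n a) (isPiecewiseConst_quant n (Lp.stronglyMeasurable a).measurable) (‖a‖ + 1)
    (ae_quant_le n a)).completion

theorem norm_mulApprox_sub_le (a : Lp ℝ ∞ μ) (n m : ℕ) :
    ‖F.mulApprox a n - F.mulApprox a m‖ ≤ 1 / ((n : ℝ) + 1) + 1 / ((m : ℝ) + 1) := by
  refine ContinuousLinearMap.opNorm_le_bound _ (by positivity) fun v => ?_
  induction v using UniformSpace.Completion.induction_on with
  | hp => exact isClosed_le (by fun_prop) (by fun_prop)
  | ih s =>
    rw [sub_apply, mulApprox, mulApprox,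
      ContinuousLinearMap.completion_apply_coe, ContinuousLinearMap.completion_apply_coe,
      ← UniformSpace.Completion.coe_sub, UniformSpace.Completion.norm_coe,
      UniformSpace.Completion.norm_coe]
    have hs := s.isPiecewiseConst
    have h1 := isPiecewiseConst_quant n (Lp.stronglyMeasurable a).measurable
    have h2 := isPiecewiseConst_quant m (Lp.stronglyMeasurable a).measurable
    have h3 : IsPiecewiseConst (fun x => quant n a x - quant m a x) := h1.map₂ (· - ·) h2
    have hb : ∀ x, |quant n a x - quant m a x| ≤ 1 / ((n : ℝ) + 1) + 1 / ((m : ℝ) + 1) := by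
      intro x
      have e1 := abs_quant_sub_le n a x
      have e2 := abs_quant_sub_le m a x
      have : quant n a x - quant m a x = (quant n a x - a x) - (quant m a x - a x) := by ring
      rw [this]
      exact (abs_sub _ _).trans (add_le_add e1 e2)
    have key : F.mulPfm (quant n a) h1 (‖a‖ + 1) (ae_quant_le n a) s -
        F.mulPfm (quant m a) h2 (‖a‖ + 1) (ae_quant_le m a) s =
        F.mulPfmFun _ h3 (1 / ((n : ℝ) + 1) + 1 / ((m : ℝ) + 1)) (ae_of_all _ hb) s := by
      rw [mulPfm_apply, mulPfm_apply]
      exact Subtype.ext (funext fun x => (sub_smul (quant n a x) (quant m a x) (s.fn x)).symm)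
    rw [key]
    exact F.norm_mulPfmFun_le _ _ _ _ s

theorem cauchySeq_mulApprox (a : Lp ℝ ∞ μ) : CauchySeq (F.mulApprox a) := by
  refine cauchySeq_of_le_tendsto_0 (fun N : ℕ => 2 * (1 / ((N : ℝ) + 1))) (fun n m N hn hm => ?_) ?_
  · rw [dist_eq_norm]
    refine (F.norm_mulApprox_sub_le a n m).trans ?_
    have e1 := one_div_le_one_div_of_le (by positivity : (0 : ℝ) < (N : ℝ) + 1)
      (by exact_mod_cast Nat.succ_le_succ hn : (N : ℝ) + 1 ≤ (n : ℝ) + 1)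
    have e2 := one_div_le_one_div_of_le (by positivity : (0 : ℝ) < (N : ℝ) + 1)
      (by exact_mod_cast Nat.succ_le_succ hm : (N : ℝ) + 1 ≤ (m : ℝ) + 1)
    linarith
  · simpa using tendsto_one_div_add_atTop_nhds_zero_nat.const_mul (2 : ℝ)

/-- The multiplication `v ↦ a · v` by `a ∈ L^∞(μ)` on the module: the limit in operator norm of
the multiplications by functions `a_n → a` with countably many values. -/
def mul (a : Lp ℝ ∞ μ) : F.Mod →L[ℝ] F.Mod := limUnder atTop (F.mulApprox a)

theorem tendsto_mulApprox (a : Lp ℝ ∞ μ) : Tendsto (F.mulApprox a) atTop (𝓝 (F.mul a)) :=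
  (F.cauchySeq_mulApprox a).tendsto_limUnder

/-- The indicator function `χ_A` as an element of `L^∞(μ)`. -/
def chi (μ : Measure M) (A : Set M) (hA : MeasurableSet A) : Lp ℝ ∞ μ :=
  ((memLp_top_const (1 : ℝ)).indicator hA : MemLp (A.indicator fun _ => (1 : ℝ)) ∞ μ).toLp _

/-- `N` is an `L^p(μ)`-normed submodule: a closed subspace, stable under multiplication by
`L^∞(μ)`, with the locality and the glueing property. -/
structure IsLpNormedSubmodule (N : Submodule ℝ F.Mod) : Prop where
  isClosed : IsClosed (N : Set F.Mod)
  mul_mem : ∀ (a : Lp ℝ ∞ μ), ∀ v ∈ N, F.mul a v ∈ N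
  locality : ∀ v ∈ N, ∀ (A : ℕ → Set M) (hA : ∀ n, MeasurableSet (A n)),
    (∀ n, F.mul (chi μ (A n) (hA n)) v = 0) →
    F.mul (chi μ (⋃ n, A n) (MeasurableSet.iUnion hA)) v = 0
  glueing : ∀ v : ℕ → F.Mod, (∀ n, v n ∈ N) →
    ∀ (A : ℕ → Set M) (hA : ∀ n, MeasurableSet (A n)),
    (∀ i j, F.mul (chi μ (A i ∩ A j) ((hA i).inter (hA j))) (v i) =
      F.mul (chi μ (A i ∩ A j) ((hA i).inter (hA j))) (v j)) →
    BddAbove (range fun n => ‖∑ i ∈ Finset.range n, F.mul (chi μ (A i) (hA i)) (v i)‖) →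
    ∃ w ∈ N, (∀ i, F.mul (chi μ (A i) (hA i)) w = F.mul (chi μ (A i) (hA i)) (v i)) ∧
      ‖w‖ ≤ liminf (fun n => ‖∑ i ∈ Finset.range n, F.mul (chi μ (A i) (hA i)) (v i)‖) atTop

/-- The limits `ω` of differentials `d f_n` along sequences `f_n → 0` in `L⁰(μ)`. -/
def zeroSet : Set F.Mod :=
  {ω | ∃ f : ℕ → V, TendstoL0 (fun n => F.toL0 (f n)) 0 ∧
    Tendsto (fun n => F.d (f n)) atTop (𝓝 ω)}

/-- The submodule generated by `zeroSet`: the closed linear span of all `a · ω` with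
`a ∈ L^∞(μ)` and `ω ∈ zeroSet`. -/
def zeroModule : Submodule ℝ F.Mod :=
  (Submodule.span ℝ {v | ∃ a : Lp ℝ ∞ μ, ∃ ω ∈ F.zeroSet, v = F.mul a ω}).topologicalClosure

/-- The operator `d`, from `L⁰(μ)` to the module with domain the functions in `V`, is closable:
the closure of its graph is the graph of a (single-valued) operator. -/
def Closable : Prop :=
  ∀ (f h : ℕ → V) (g : M →ₘ[μ] ℝ) (ω η : F.Mod),
    TendstoL0 (fun n => F.toL0 (f n)) g → Tendsto (fun n => F.d (f n)) atTop (𝓝 ω) →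
    TendstoL0 (fun n => F.toL0 (h n)) g → Tendsto (fun n => F.d (h n)) atTop (𝓝 η) → ω = η

/-- The module is weakly reflexive: every bounded sequence of differentials `d f_n` with `(f_n)`
convergent in `L⁰(μ)` has a weakly convergent subsequence. -/
def WeaklyReflexive : Prop :=
  ∀ (f : ℕ → V) (g : M →ₘ[μ] ℝ), TendstoL0 (fun n => F.toL0 (f n)) g →
    BddAbove (range fun n => ‖F.d (f n)‖) →
    ∃ (φ : ℕ → ℕ) (ω : F.Mod), StrictMono φ ∧ TendstoWeakly (fun n => F.d (f (φ n))) ω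

end LpFunctional

section Lebesgue

variable {μ : Measure M} {p : ℝ≥0} [hp : Fact (1 < p)]

theorem TendstoL0.exists_subseq_ae [SigmaFinite μ] {f : ℕ → M →ₘ[μ] ℝ} {g : M →ₘ[μ] ℝ}
    (h : TendstoL0 f g) :
    ∃ φ : ℕ → ℕ, StrictMono φ ∧ ∀ᵐ x ∂μ, Tendsto (fun n => f (φ n) x) atTop (𝓝 (g x)) := by
  set S := spanningSets μ
  let A : ℕ → ℕ → Set M := fun n k => {x | ((1 / 2 : ℝ) ^ n) ≤ ‖f k x - g x‖}
  have hA : ∀ n, ∀ᶠ k in atTop, μ.restrict (S n) (A n k) < ENNReal.ofReal ((1 / 2 : ℝ) ^ n) := by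
    intro n
    have h1 := tendstoInMeasure_iff_norm.1
      (h (S n) (measurableSet_spanningSets μ n) (measure_spanningSets_lt_top μ n))
      ((1 / 2 : ℝ) ^ n) (by positivity)
    exact h1.eventually (gt_mem_nhds (by simp))
  obtain ⟨φ, hφ, hφ'⟩ := extraction_forall_of_eventually hA
  refine ⟨φ, hφ, ?_⟩
  have hmeas : ∀ n, MeasurableSet (A n (φ n)) := fun n =>
    measurableSet_le measurable_const
      (((f (φ n)).stronglyMeasurable.measurable.sub g.stronglyMeasurable.measurable).norm)
  have hsum : ∑' n, μ (A n (φ n) ∩ S n) ≠ ∞ := by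
    have hle : ∑' n, μ (A n (φ n) ∩ S n) ≤ ∑' n, ENNReal.ofReal ((1 / 2 : ℝ) ^ n) := by
      refine ENNReal.tsum_le_tsum fun n => ?_
      rw [← Measure.restrict_apply (hmeas n)]
      exact (hφ' n).le
    refine ne_top_of_le_ne_top ?_ hle
    rw [← ENNReal.ofReal_tsum_of_nonneg (fun n => by positivity) summable_geometric_two]
    exact ENNReal.ofReal_ne_top
  filter_upwards [ae_eventually_notMem hsum] with x hx
  have hS : ∀ᶠ n in atTop, x ∈ S n := by
    have hm := mem_spanningSetsIndex μ x
    filter_upwards [eventually_ge_atTop (spanningSetsIndex μ x)] with n hn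
    exact monotone_spanningSets μ hn hm
  rw [tendsto_iff_norm_sub_tendsto_zero]
  refine squeeze_zero' (Eventually.of_forall fun n => norm_nonneg _) ?_
    (tendsto_pow_atTop_nhds_zero_of_lt_one (r := (1 / 2 : ℝ)) (by norm_num) (by norm_num))
  filter_upwards [hx, hS] with n h1 h2
  by_contra h3
  exact h1 ⟨(not_le.1 h3).le, h2⟩

theorem TendstoL0.of_ae {f : ℕ → M →ₘ[μ] ℝ} {g : M →ₘ[μ] ℝ}
    (h : ∀ᵐ x ∂μ, Tendsto (fun n => f n x) atTop (𝓝 (g x))) : TendstoL0 f g := by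
  intro E _ hE'
  have : IsFiniteMeasure (μ.restrict E) := ⟨by simpa using hE'⟩
  exact tendstoInMeasure_of_tendsto_ae
    (fun n => (f n).stronglyMeasurable.aestronglyMeasurable) (ae_restrict_of_ae h)

theorem one_lt_coe : 1 < (p : ℝ) := by exact_mod_cast hp.out

theorem integrable_rpow (u : Lp ℝ p μ) : Integrable (fun x => |u x| ^ (p : ℝ)) μ := by
  have h := (Lp.memLp u).integrable_norm_rpow
    (by exact_mod_cast (zero_lt_one.trans hp.out).ne') ENNReal.coe_ne_top
  simpa using h

theorem norm_rpow_eq (u : Lp ℝ p μ) : ‖u‖ ^ (p : ℝ) = ∫ x, |u x| ^ (p : ℝ) ∂μ := by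
  have hp0 : (p : ℝ) ≠ 0 := (zero_lt_one.trans (one_lt_coe (p := p))).ne'
  have h0 : 0 ≤ ∫ x, |u x| ^ (p : ℝ) ∂μ := integral_nonneg fun x => by positivity
  have h := (Lp.memLp u).eLpNorm_eq_integral_rpow_norm
    (by exact_mod_cast (zero_lt_one.trans hp.out).ne') ENNReal.coe_ne_top
  simp only [ENNReal.coe_toReal, Real.norm_eq_abs] at h
  rw [Lp.norm_def, h, ENNReal.toReal_ofReal (by positivity), ← Real.rpow_mul h0,
    inv_mul_cancel₀ hp0, Real.rpow_one]

theorem rpow_uniform_convex {q : ℝ} (hq : 1 < q) {ε : ℝ} (hε : 0 < ε) :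
    ∃ C : ℝ, 0 ≤ C ∧ ∀ a b : ℝ, 0 ≤ a → 0 ≤ b →
      |a - b| ^ q ≤ ε * (a ^ q + b ^ q) + C * ((a ^ q + b ^ q) / 2 - ((a + b) / 2) ^ q) := by
  have hq0 : 0 < q := zero_lt_one.trans hq
  let δ : ℝ → ℝ := fun t => (t ^ q + (1 - t) ^ q) / 2 - (1 / 2 : ℝ) ^ q
  have cont1 : Continuous fun t : ℝ => t ^ q + (1 - t) ^ q :=
    (Real.continuous_rpow_const hq0.le).add
      ((Real.continuous_rpow_const hq0.le).comp (continuous_const.sub continuous_id))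
  have hδc : Continuous δ := (cont1.div_const 2).sub continuous_const
  have cont2 : Continuous fun t : ℝ => |t - (1 - t)| ^ q :=
    (Real.continuous_rpow_const hq0.le).comp (by fun_prop)
  have hconv := strictConvexOn_rpow hq
  have hδ0 : ∀ t ∈ Icc (0 : ℝ) 1, 0 ≤ δ t := by
    intro t ht
    have m1 : t ∈ Ici (0 : ℝ) := ht.1
    have m2 : 1 - t ∈ Ici (0 : ℝ) := sub_nonneg.2 ht.2
    have h := hconv.convexOn.2 m1 m2 (by norm_num : (0 : ℝ) ≤ 1 / 2)
      (by norm_num : (0 : ℝ) ≤ 1 / 2) (by norm_num)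
    simp only [smul_eq_mul] at h
    have e : (1 / 2 : ℝ) * t + 1 / 2 * (1 - t) = 1 / 2 := by ring
    rw [e] at h
    simp only [δ]; linarith
  have hδpos : ∀ t ∈ Icc (0 : ℝ) 1, t ≠ 1 / 2 → 0 < δ t := by
    intro t ht hne
    have m1 : t ∈ Ici (0 : ℝ) := ht.1
    have m2 : 1 - t ∈ Ici (0 : ℝ) := sub_nonneg.2 ht.2
    have h := hconv.2 m1 m2 (fun h => hne (by linarith)) (by norm_num : (0 : ℝ) < 1 / 2)
      (by norm_num : (0 : ℝ) < 1 / 2) (by norm_num)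
    simp only [smul_eq_mul] at h
    have e : (1 / 2 : ℝ) * t + 1 / 2 * (1 - t) = 1 / 2 := by ring
    rw [e] at h
    simp only [δ]; linarith
  have hunit : ∃ C : ℝ, 0 ≤ C ∧ ∀ t ∈ Icc (0 : ℝ) 1,
      |t - (1 - t)| ^ q ≤ ε * (t ^ q + (1 - t) ^ q) + C * δ t := by
    let K : Set ℝ := Icc 0 1 ∩ {t | ε * (t ^ q + (1 - t) ^ q) ≤ |t - (1 - t)| ^ q}
    have hK : IsCompact K :=
      isCompact_Icc.inter_right (isClosed_le (continuous_const.mul cont1) cont2)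
    have hpos : ∀ t ∈ Icc (0 : ℝ) 1, 0 ≤ t ^ q + (1 - t) ^ q := fun t ht =>
      add_nonneg (Real.rpow_nonneg ht.1 _) (Real.rpow_nonneg (sub_nonneg.2 ht.2) _)
    rcases K.eq_empty_or_nonempty with hKe | hKn
    · refine ⟨0, le_rfl, fun t ht => ?_⟩
      by_contra h
      have : t ∈ K := ⟨ht, show ε * (t ^ q + (1 - t) ^ q) ≤ |t - (1 - t)| ^ q by
        linarith [not_le.1 h]⟩
      rw [hKe] at this
      exact this
    · obtain ⟨t₀, ht₀, hmin⟩ := hK.exists_isMinOn hKn hδc.continuousOn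
      have hne : t₀ ≠ 1 / 2 := by
        rintro rfl
        have h : ε * ((1 / 2 : ℝ) ^ q + (1 - 1 / 2) ^ q) ≤ |(1 / 2 : ℝ) - (1 - 1 / 2)| ^ q := ht₀.2
        have e : (1 / 2 : ℝ) - (1 - 1 / 2) = 0 := by norm_num
        rw [e, abs_zero, Real.zero_rpow hq0.ne'] at h
        have : 0 < ε * ((1 / 2 : ℝ) ^ q + (1 - 1 / 2) ^ q) := by
          have : (1 - 1 / 2 : ℝ) = 1 / 2 := by norm_num
          rw [this]; positivity
        linarith
      have hm : 0 < δ t₀ := hδpos t₀ ht₀.1 hne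
      refine ⟨(δ t₀)⁻¹, (inv_pos.2 hm).le, fun t ht => ?_⟩
      have h1 : 0 ≤ ε * (t ^ q + (1 - t) ^ q) := mul_nonneg hε.le (hpos t ht)
      have h2 : 0 ≤ (δ t₀)⁻¹ * δ t := mul_nonneg (inv_pos.2 hm).le (hδ0 t ht)
      by_cases htK : t ∈ K
      · have h3 : δ t₀ ≤ δ t := hmin htK
        have h4 : 1 ≤ (δ t₀)⁻¹ * δ t := by
          rw [inv_mul_eq_div, one_le_div hm]; exact h3
        have h5 : |t - (1 - t)| ^ q ≤ 1 := by
          refine Real.rpow_le_one (abs_nonneg _) ?_ hq0.le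
          rw [abs_le]; constructor <;> linarith [ht.1, ht.2]
        linarith
      · have : ¬ ε * (t ^ q + (1 - t) ^ q) ≤ |t - (1 - t)| ^ q := fun h => htK ⟨ht, h⟩
        linarith [not_le.1 this]
  obtain ⟨C, hC, h⟩ := hunit
  refine ⟨C, hC, fun a b ha hb => ?_⟩
  rcases (add_nonneg ha hb).eq_or_lt with h0 | hs
  · have ha0 : a = 0 := by linarith
    have hb0 : b = 0 := by linarith
    subst ha0; subst hb0
    simp [Real.zero_rpow hq0.ne']
  · set s := a + b with hsdef
    have ht : a / s ∈ Icc (0 : ℝ) 1 :=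
      ⟨div_nonneg ha hs.le, (div_le_one hs).2 (by linarith)⟩
    have hb' : 1 - a / s = b / s := by field_simp; linarith
    have key := h (a / s) ht
    simp only [δ, hb'] at key
    have hsq : 0 < s ^ q := Real.rpow_pos_of_pos hs q
    have e1 : |a / s - b / s| ^ q = |a - b| ^ q / s ^ q := by
      rw [← sub_div, abs_div, abs_of_pos hs, Real.div_rpow (abs_nonneg _) hs.le]
    have e2 : (s / 2) ^ q = s ^ q * (1 / 2 : ℝ) ^ q := by
      rw [div_eq_mul_one_div, Real.mul_rpow hs.le (by norm_num)]
    rw [e1, Real.div_rpow ha hs.le, Real.div_rpow hb hs.le] at key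
    have key2 := mul_le_mul_of_nonneg_right key hsq.le
    rw [e2]
    have e3 : |a - b| ^ q / s ^ q * s ^ q = |a - b| ^ q := by field_simp
    have e4 : (ε * (a ^ q / s ^ q + b ^ q / s ^ q) +
        C * ((a ^ q / s ^ q + b ^ q / s ^ q) / 2 - (1 / 2 : ℝ) ^ q)) * s ^ q =
        ε * (a ^ q + b ^ q) + C * ((a ^ q + b ^ q) / 2 - s ^ q * (1 / 2 : ℝ) ^ q) := by
      field_simp
    rw [e3, e4] at key2
    exact key2

theorem norm_sub_rpow_le {ε : ℝ} (hε : 0 < ε) : ∃ C : ℝ, 0 ≤ C ∧ ∀ u v : Lp ℝ p μ, 0 ≤ u → 0 ≤ v →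
    ‖u - v‖ ^ (p : ℝ) ≤ ε * (‖u‖ ^ (p : ℝ) + ‖v‖ ^ (p : ℝ)) +
      C * ((‖u‖ ^ (p : ℝ) + ‖v‖ ^ (p : ℝ)) / 2 - ‖(1 / 2 : ℝ) • (u + v)‖ ^ (p : ℝ)) := by
  obtain ⟨C, hC, h⟩ := rpow_uniform_convex (one_lt_coe (p := p)) hε
  refine ⟨C, hC, fun u v hu hv => ?_⟩
  have iu := integrable_rpow u
  have iv := integrable_rpow v
  have iw := integrable_rpow ((1 / 2 : ℝ) • (u + v))
  have j1 : Integrable (fun x => |u x| ^ (p : ℝ) + |v x| ^ (p : ℝ)) μ := iu.add iv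
  have j2 : Integrable (fun x => (|u x| ^ (p : ℝ) + |v x| ^ (p : ℝ)) / 2 -
      |((1 / 2 : ℝ) • (u + v) : Lp ℝ p μ) x| ^ (p : ℝ)) μ := (j1.div_const 2).sub iw
  have j3 : Integrable (fun x => ε * (|u x| ^ (p : ℝ) + |v x| ^ (p : ℝ))) μ := j1.const_mul ε
  have e : ε * (‖u‖ ^ (p : ℝ) + ‖v‖ ^ (p : ℝ)) +
      C * ((‖u‖ ^ (p : ℝ) + ‖v‖ ^ (p : ℝ)) / 2 - ‖(1 / 2 : ℝ) • (u + v)‖ ^ (p : ℝ)) =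
      ∫ x, ε * (|u x| ^ (p : ℝ) + |v x| ^ (p : ℝ)) + C * ((|u x| ^ (p : ℝ) + |v x| ^ (p : ℝ)) / 2 -
        |((1 / 2 : ℝ) • (u + v) : Lp ℝ p μ) x| ^ (p : ℝ)) ∂μ := by
    rw [integral_add j3 (j2.const_mul C), integral_const_mul, integral_const_mul,
      integral_sub (j1.div_const 2) iw, integral_div, integral_add iu iv, norm_rpow_eq,
      norm_rpow_eq, norm_rpow_eq]
  rw [e, norm_rpow_eq]
  refine integral_mono_ae (integrable_rpow _)
    (j3.add (j2.const_mul C)) ?_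
  filter_upwards [Lp.coeFn_sub u v, Lp.coeFn_smul (1 / 2 : ℝ) (u + v), Lp.coeFn_add u v,
    (Lp.coeFn_nonneg u).2 hu, (Lp.coeFn_nonneg v).2 hv] with x h1 h2 h3 h4 h5
  simp only [Pi.zero_apply] at h4 h5
  have h6 := h (u x) (v x) h4 h5
  have e2 : |((1 / 2 : ℝ) • (u + v) : Lp ℝ p μ) x| = (u x + v x) / 2 := by
    rw [h2, Pi.smul_apply, h3, Pi.add_apply, smul_eq_mul, abs_of_nonneg (by positivity)]
    ring
  rw [e2, h1, Pi.sub_apply, abs_of_nonneg h4, abs_of_nonneg h5]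
  exact h6

theorem norm_superadd {u v : Lp ℝ p μ} (hu : 0 ≤ u) (h : u ≤ v) :
    ‖u‖ ^ (p : ℝ) + ‖v - u‖ ^ (p : ℝ) ≤ ‖v‖ ^ (p : ℝ) := by
  rw [norm_rpow_eq, norm_rpow_eq, norm_rpow_eq,
    ← integral_add (integrable_rpow u) (integrable_rpow (v - u))]
  refine integral_mono_ae ((integrable_rpow u).add (integrable_rpow (v - u)))
    (integrable_rpow v) ?_
  filter_upwards [Lp.coeFn_sub v u, (Lp.coeFn_nonneg u).2 hu, (Lp.coeFn_le u v).2 h]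
    with x h1 h2 h3
  simp only [Pi.zero_apply] at h2
  rw [h1, Pi.sub_apply, abs_of_nonneg h2, abs_of_nonneg (sub_nonneg.2 h3),
    abs_of_nonneg (h2.trans h3)]
  have := Real.add_rpow_le_rpow_add h2 (sub_nonneg.2 h3) (one_lt_coe (p := p)).le
  simpa using this

theorem rpow_cauchy {u : ℕ → Lp ℝ p μ}
    (h : ∀ η > 0, ∃ N, ∀ n k, N ≤ n → n ≤ k → ‖u n - u k‖ ^ (p : ℝ) < η) : CauchySeq u := by
  have hp0 : 0 < (p : ℝ) := zero_lt_one.trans (one_lt_coe (p := p))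
  rw [Metric.cauchySeq_iff']
  intro η hη
  obtain ⟨N, hN⟩ := h (η ^ (p : ℝ)) (by positivity)
  refine ⟨N, fun n hn => ?_⟩
  rw [dist_comm, dist_eq_norm]
  exact (Real.rpow_lt_rpow_iff (norm_nonneg _) hη.le hp0).1 (hN N n le_rfl hn)

theorem exists_tendsto_of_midpoint {W : Type*} [AddCommGroup W] [Module ℝ W] (N : W → Lp ℝ p μ)
    (hN0 : ∀ w, 0 ≤ N w)
    (hN : ∀ v w, N ((1 / 2 : ℝ) • (v + w)) ≤ (1 / 2 : ℝ) • (N v + N w))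
    (A : ℕ → Set W) (hA : Antitone A) (hconv : ∀ n, Convex ℝ (A n)) (C : ℝ)
    (hC : ∀ n, ∃ w ∈ A n, ‖N w‖ ≤ C) :
    ∃ z : ℕ → W, (∀ n, z n ∈ A n) ∧ ∃ G, Tendsto (fun n => N (z n)) atTop (𝓝 G) := by
  have hp0 : 0 < (p : ℝ) := zero_lt_one.trans (one_lt_coe (p := p))
  let m : ℕ → ℝ := fun n => sInf ((fun w => ‖N w‖) '' A n)
  have hbdd : ∀ n, BddBelow ((fun w => ‖N w‖) '' A n) := fun n =>
    ⟨0, by rintro _ ⟨w, -, rfl⟩; exact norm_nonneg _⟩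
  have hne : ∀ n, ((fun w => ‖N w‖) '' A n).Nonempty := fun n => by
    obtain ⟨w, hw, -⟩ := hC n
    exact ⟨_, w, hw, rfl⟩
  have hm_le : ∀ n, ∀ w ∈ A n, m n ≤ ‖N w‖ := fun n w hw => csInf_le (hbdd n) ⟨w, hw, rfl⟩
  have hm0 : ∀ n, 0 ≤ m n := fun n => le_csInf (hne n) (by
    rintro _ ⟨w, -, rfl⟩; exact norm_nonneg _)
  have hmono : Monotone m := fun a b hab =>
    csInf_le_csInf (hbdd a) (hne b) (image_mono (hA hab))
  have hmC : BddAbove (range m) := ⟨C, by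
    rintro _ ⟨n, rfl⟩
    obtain ⟨w, hw, h⟩ := hC n
    exact (hm_le n w hw).trans h⟩
  have hmL := tendsto_atTop_ciSup hmono hmC
  set L := ⨆ n, m n
  have hex : ∀ n, ∃ w ∈ A n, ‖N w‖ < m n + 1 / ((n : ℝ) + 1) := fun n => by
    obtain ⟨_, ⟨w, hw, rfl⟩, h⟩ := exists_lt_of_csInf_lt (hne n)
      (lt_add_of_pos_right (m n) (by positivity : (0 : ℝ) < 1 / ((n : ℝ) + 1)))
    exact ⟨w, hw, h⟩
  choose z hzA hz using hex
  refine ⟨z, hzA, ?_⟩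
  have hzL : Tendsto (fun n => ‖N (z n)‖) atTop (𝓝 L) := by
    refine tendsto_of_tendsto_of_tendsto_of_le_of_le hmL ?_
      (fun n => hm_le n _ (hzA n)) (fun n => (hz n).le)
    simpa using hmL.add (tendsto_one_div_add_atTop_nhds_zero_nat (𝕜 := ℝ))
  have hcont : ContinuousAt (fun t : ℝ => t ^ (p : ℝ)) L :=
    (Real.continuous_rpow_const hp0.le).continuousAt
  have h1 : Tendsto (fun n => ‖N (z n)‖ ^ (p : ℝ)) atTop (𝓝 (L ^ (p : ℝ))) :=
    hcont.tendsto.comp hzL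
  have h2 : Tendsto (fun n => m n ^ (p : ℝ)) atTop (𝓝 (L ^ (p : ℝ))) := hcont.tendsto.comp hmL
  refine cauchySeq_tendsto_of_complete (rpow_cauchy fun η hη => ?_)
  set B := L ^ (p : ℝ) with hB
  have hL0 : 0 ≤ L := ge_of_tendsto' hmL hm0
  have hB0 : 0 ≤ B := Real.rpow_nonneg hL0 _
  obtain ⟨c, hc, hcε⟩ := norm_sub_rpow_le (μ := μ) (p := p)
    (ε := η / (4 * (B + 1))) (by positivity)
  set δ := min 1 (η / (4 * (c + 1))) with hδ
  have hδ0 : 0 < δ := lt_min one_pos (by positivity)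
  have ev1 := h1.eventually (Metric.ball_mem_nhds B hδ0)
  have ev2 := h2.eventually (Metric.ball_mem_nhds B hδ0)
  obtain ⟨n₀, hn₀⟩ := eventually_atTop.1 (ev1.and ev2)
  refine ⟨n₀, fun n k hn hk => ?_⟩
  have a1 := abs_lt.1 (Real.dist_eq _ _ ▸ Metric.mem_ball.1 (hn₀ n hn).1)
  have a2 := abs_lt.1 (Real.dist_eq _ _ ▸ Metric.mem_ball.1 (hn₀ k (hn.trans hk)).1)
  have a3 := abs_lt.1 (Real.dist_eq _ _ ▸ Metric.mem_ball.1 (hn₀ n hn).2)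
  have hmid : (1 / 2 : ℝ) • (z n + z k) ∈ A n := by
    rw [smul_add]
    exact hconv n (hzA n) (hA hk (hzA k)) (by norm_num) (by norm_num) (by norm_num)
  have a4 : m n ^ (p : ℝ) ≤ ‖(1 / 2 : ℝ) • (N (z n) + N (z k))‖ ^ (p : ℝ) :=
    Real.rpow_le_rpow (hm0 n)
      ((hm_le n _ hmid).trans (LpFunctional.norm_mono (hN0 _) (hN _ _))) hp0.le
  have a5 := hcε (N (z n)) (N (z k)) (hN0 _) (hN0 _)
  have hδ1 : δ ≤ 1 := min_le_left _ _
  have hδ2 : δ * (4 * (c + 1)) ≤ η := by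
    have := min_le_right 1 (η / (4 * (c + 1)))
    rw [← hδ, le_div_iff₀ (by positivity)] at this
    exact this
  have b1 : η / (4 * (B + 1)) * (‖N (z n)‖ ^ (p : ℝ) + ‖N (z k)‖ ^ (p : ℝ)) ≤ η / 2 := by
    have : ‖N (z n)‖ ^ (p : ℝ) + ‖N (z k)‖ ^ (p : ℝ) ≤ 2 * (B + 1) := by linarith [a1.2, a2.2]
    calc _ ≤ η / (4 * (B + 1)) * (2 * (B + 1)) := by gcongr
      _ = η / 2 := by field_simp; norm_num
  have b2 : c * ((‖N (z n)‖ ^ (p : ℝ) + ‖N (z k)‖ ^ (p : ℝ)) / 2 -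
      ‖(1 / 2 : ℝ) • (N (z n) + N (z k))‖ ^ (p : ℝ)) ≤ c * (2 * δ) := by
    refine mul_le_mul_of_nonneg_left ?_ hc
    linarith [a1.2, a2.2, a3.1]
  have b3 : c * (2 * δ) < η / 2 := by nlinarith
  linarith

theorem smul_nonneg' {c : ℝ} (hc : 0 ≤ c) {u : Lp ℝ p μ} (hu : 0 ≤ u) : 0 ≤ c • u := by
  rw [← Lp.coeFn_nonneg] at hu ⊢
  filter_upwards [hu, Lp.coeFn_smul c u] with x h1 h2
  rw [h2]
  exact mul_nonneg hc h1

theorem convex_nonneg : Convex ℝ {u : Lp ℝ p μ | 0 ≤ u} := fun _ hu _ hv _ _ ha hb _ =>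
  add_nonneg (smul_nonneg' ha hu) (smul_nonneg' hb hv)

theorem TendstoWeakly.nonneg {u : ℕ → Lp ℝ p μ} {a : Lp ℝ p μ} (h : TendstoWeakly u a)
    (hu : ∀ n, 0 ≤ u n) : 0 ≤ a := by
  by_contra ha
  obtain ⟨φ, s, h1, h2⟩ := geometric_hahn_banach_point_closed
    (convex_nonneg (μ := μ) (p := p)) isClosed_Ici ha
  have := ge_of_tendsto' (h φ) fun n => (h2 (u n) (hu n)).le
  linarith

theorem TendstoWeakly.bounded {E : Type*} [NormedAddCommGroup E] [NormedSpace ℝ E] {u : ℕ → E}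
    {a : E} (h : TendstoWeakly u a) : ∃ C, ∀ n, ‖u n‖ ≤ C := by
  obtain ⟨C, hC⟩ := banach_steinhaus (g := fun n => NormedSpace.inclusionInDoubleDual ℝ E (u n))
    (fun φ => by
      obtain ⟨C, hC⟩ := (h φ).norm.bddAbove_range
      exact ⟨C, fun n => hC ⟨n, rfl⟩⟩)
  refine ⟨C, fun n => ?_⟩
  have := hC n
  rwa [← (NormedSpace.inclusionInDoubleDualLi ℝ (E := E)).norm_map (u n)]

theorem _root_.Filter.Tendsto.tendstoWeakly {E : Type*} [NormedAddCommGroup E] [NormedSpace ℝ E]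
    {u : ℕ → E} {a : E} (h : Tendsto u atTop (𝓝 a)) : TendstoWeakly u a :=
  fun φ => (φ.continuous.tendsto a).comp h

theorem TendstoWeakly.add {E : Type*} [NormedAddCommGroup E] [NormedSpace ℝ E]
    {u v : ℕ → E} {a b : E} (hu : TendstoWeakly u a) (hv : TendstoWeakly v b) :
    TendstoWeakly (fun n => u n + v n) (a + b) := fun φ => by
  simpa using (hu φ).add (hv φ)

theorem TendstoWeakly.sub {E : Type*} [NormedAddCommGroup E] [NormedSpace ℝ E]
    {u v : ℕ → E} {a b : E} (hu : TendstoWeakly u a) (hv : TendstoWeakly v b) :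
    TendstoWeakly (fun n => u n - v n) (a - b) := fun φ => by
  simpa using (hu φ).sub (hv φ)

theorem TendstoWeakly.const_smul {E : Type*} [NormedAddCommGroup E] [NormedSpace ℝ E]
    {u : ℕ → E} {a : E} (c : ℝ) (hu : TendstoWeakly u a) :
    TendstoWeakly (fun n => c • u n) (c • a) := fun φ => by
  simpa using (hu φ).const_mul c

theorem TendstoWeakly.subseq {E : Type*} [NormedAddCommGroup E] [NormedSpace ℝ E]
    {u : ℕ → E} {a : E} (hu : TendstoWeakly u a) {φ : ℕ → ℕ} (hφ : StrictMono φ) :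
    TendstoWeakly (fun n => u (φ n)) a := fun ψ => (hu ψ).comp hφ.tendsto_atTop

end Lebesgue

namespace LpFunctional

variable {μ : Measure M} {p : ℝ≥0} [Fact (1 < p)] {V : Type*} [AddCommGroup V] [Module ℝ V]
  (F : LpFunctional μ p V)

/-- The lower semicontinuous hull `inf {liminf ∫ g_{f_n}^p dμ : f_n → g in L⁰(μ)}` of the energy
`f ↦ ∫ g_f^p dμ = ‖g_f‖^p`. -/
def relaxedEnergy (g : M →ₘ[μ] ℝ) : ℝ≥0∞ :=
  ⨅ (f : ℕ → V) (_ : TendstoL0 (fun n => F.toL0 (f n)) g),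
    liminf (fun n => ‖F.val (f n)‖ₑ ^ (p : ℝ)) atTop

/-- The set of all `G ∈ L^p(μ)` with `G ≤ G'` whenever `f_n → g` in `L⁰(μ)` and `g_{f_n} ⇀ G'`
weakly in `L^p(μ)`. -/
def lowerSet (g : M →ₘ[μ] ℝ) : Set (Lp ℝ p μ) :=
  {G | ∀ (f : ℕ → V) (G' : Lp ℝ p μ), TendstoL0 (fun n => F.toL0 (f n)) g →
    TendstoWeakly (fun n => F.val (f n)) G' → G ≤ G'}

theorem val_add_smul_le {a b : ℝ} (ha : 0 ≤ a) (hb : 0 ≤ b) (v w : V) :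
    F.val (a • v + b • w) ≤ a • F.val v + b • F.val w := by
  refine (F.add_le' _ _).trans ?_
  rw [F.smul', F.smul', abs_of_nonneg ha, abs_of_nonneg hb]

/-- Almost everywhere convergence of a sequence in `V`. -/
def TendstoAE (f : ℕ → V) (g : M →ₘ[μ] ℝ) : Prop :=
  ∀ᵐ x ∂μ, Tendsto (fun n => F.toL0 (f n) x) atTop (𝓝 (g x))

theorem relaxedEnergy_lt_top_iff [SigmaFinite μ] {g : M →ₘ[μ] ℝ} :
    F.relaxedEnergy g < ∞ ↔ ∃ (f : ℕ → V) (C : ℝ), F.TendstoAE f g ∧ ∀ n, ‖F.val (f n)‖ ≤ C := by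
  have hp0 : 0 < (p : ℝ) := zero_lt_one.trans (one_lt_coe (p := p))
  constructor
  · intro h
    simp only [relaxedEnergy, iInf_lt_iff] at h
    obtain ⟨f, hf, h⟩ := h
    obtain ⟨C, hC, hCtop⟩ := exists_between h
    have hfr : ∃ᶠ n in atTop, ‖F.val (f n)‖ₑ ^ (p : ℝ) < C :=
      frequently_lt_of_liminf_lt (by isBoundedDefault) hC
    obtain ⟨φ, hφ, hφC⟩ := extraction_of_frequently_atTop hfr
    have hf' : TendstoL0 (fun n => F.toL0 (f (φ n))) g := fun E hE hE' ε hε =>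
      (hf E hE hE' ε hε).comp hφ.tendsto_atTop
    obtain ⟨ψ, hψ, hψ'⟩ := hf'.exists_subseq_ae
    refine ⟨fun n => f (φ (ψ n)), (C ^ ((p : ℝ)⁻¹)).toReal, hψ', fun n => ?_⟩
    have h1 := (hφC (ψ n)).le
    rw [← ENNReal.le_rpow_inv_iff hp0] at h1
    rw [← toReal_enorm]
    exact ENNReal.toReal_mono (ENNReal.rpow_ne_top_of_nonneg (inv_nonneg.2 hp0.le) hCtop.ne) h1
  · rintro ⟨f, C, hf, hC⟩
    have h1 : F.relaxedEnergy g ≤ liminf (fun n => ‖F.val (f n)‖ₑ ^ (p : ℝ)) atTop :=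
      iInf₂_le f (TendstoL0.of_ae hf)
    have h2 : liminf (fun n => ‖F.val (f n)‖ₑ ^ (p : ℝ)) atTop ≤
        liminf (fun _ : ℕ => ENNReal.ofReal C ^ (p : ℝ)) atTop := by
      refine liminf_le_liminf (Eventually.of_forall fun n => ?_)
      refine ENNReal.rpow_le_rpow ?_ hp0.le
      rw [← ofReal_norm]
      exact ENNReal.ofReal_le_ofReal (hC n)
    rw [liminf_const] at h2
    exact (h1.trans h2).trans_lt (ENNReal.rpow_lt_top_of_nonneg hp0.le ENNReal.ofReal_ne_top)

theorem TendstoAE.add {f h : ℕ → V} {g k : M →ₘ[μ] ℝ} (hf : F.TendstoAE f g)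
    (hh : F.TendstoAE h k) : F.TendstoAE (fun n => f n + h n) (g + k) := by
  have e : ∀ᵐ x ∂μ, ∀ n, F.toL0 (f n + h n) x = F.toL0 (f n) x + F.toL0 (h n) x :=
    ae_all_iff.2 fun n => by
      rw [map_add]; exact AEEqFun.coeFn_add _ _
  filter_upwards [hf, hh, e, AEEqFun.coeFn_add g k] with x h1 h2 h3 h4
  simp only [h3, h4, Pi.add_apply]
  exact h1.add h2

theorem TendstoAE.const_smul {f : ℕ → V} {g : M →ₘ[μ] ℝ} (hf : F.TendstoAE f g) (c : ℝ) :
    F.TendstoAE (fun n => c • f n) (c • g) := by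
  have e : ∀ᵐ x ∂μ, ∀ n, F.toL0 (c • f n) x = c * F.toL0 (f n) x :=
    ae_all_iff.2 fun n => by
      rw [map_smul]; exact AEEqFun.coeFn_smul _ _
  filter_upwards [hf, e, AEEqFun.coeFn_smul c g] with x h1 h3 h4
  simp only [h3, h4, Pi.smul_apply, smul_eq_mul]
  exact h1.const_mul c

theorem tendstoAE_const (v : V) : F.TendstoAE (fun _ => v) (F.toL0 v) :=
  ae_of_all _ fun _ => tendsto_const_nhds

theorem TendstoAE.convex {w : ℕ → V × Lp ℝ p μ} {g : M →ₘ[μ] ℝ}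
    (hw : F.TendstoAE (fun n => (w n).1) g) {z : ℕ → V × Lp ℝ p μ}
    (hz : ∀ n, z n ∈ convexHull ℝ (w '' Ici n)) : F.TendstoAE (fun n => (z n).1) g := by
  have key : ∀ n, ∀ᵐ x ∂μ, ∀ r : ℝ, (∀ k ∈ Ici n, |F.toL0 (w k).1 x - g x| ≤ r) →
      |F.toL0 (z n).1 x - g x| ≤ r := by
    intro n
    have hsub : convexHull ℝ (w '' Ici n) ⊆ {v : V × Lp ℝ p μ | ∀ᵐ x ∂μ, ∀ r : ℝ,
        (∀ k ∈ Ici n, |F.toL0 (w k).1 x - g x| ≤ r) → |F.toL0 v.1 x - g x| ≤ r} := by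
      refine convexHull_min ?_ ?_
      · rintro _ ⟨k, hk, rfl⟩
        exact ae_of_all _ fun x r h => h k hk
      · intro u hu v hv a b ha hb hab
        have e : ∀ᵐ x ∂μ, F.toL0 (a • u + b • v).1 x = a * F.toL0 u.1 x + b * F.toL0 v.1 x := by
          rw [Prod.fst_add, Prod.smul_fst, Prod.smul_fst, map_add, map_smul, map_smul]
          filter_upwards [AEEqFun.coeFn_add (a • F.toL0 u.1) (b • F.toL0 v.1),
            AEEqFun.coeFn_smul a (F.toL0 u.1), AEEqFun.coeFn_smul b (F.toL0 v.1)] with x h1 h2 h3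
          rw [h1, Pi.add_apply, h2, h3]; rfl
        filter_upwards [hu, hv, e] with x h1 h2 h3 r hr
        have i1 := h1 r hr
        have i2 := h2 r hr
        rw [h3]
        have : a * F.toL0 u.1 x + b * F.toL0 v.1 x - g x =
            a * (F.toL0 u.1 x - g x) + b * (F.toL0 v.1 x - g x) := by
          linear_combination g x * hab
        rw [this]
        calc _ ≤ a * |F.toL0 u.1 x - g x| + b * |F.toL0 v.1 x - g x| := by
              refine (abs_add_le _ _).trans ?_
              rw [abs_mul, abs_mul, abs_of_nonneg ha, abs_of_nonneg hb]
          _ ≤ a * r + b * r := by gcongr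
          _ = r := by rw [← add_mul, hab, one_mul]
    exact hsub (hz n)
  filter_upwards [hw, ae_all_iff.2 key] with x h1 h2
  rw [Metric.tendsto_atTop] at h1 ⊢
  intro ε hε
  obtain ⟨N, hN⟩ := h1 (ε / 2) (half_pos hε)
  refine ⟨N, fun n hn => ?_⟩
  rw [Real.dist_eq]
  refine (h2 n (ε / 2) fun k hk => ?_).trans_lt (half_lt_self hε)
  have := hN k (hn.trans hk)
  rw [Real.dist_eq] at this
  exact this.le

theorem weakly_convex {w : ℕ → V × Lp ℝ p μ} {a : Lp ℝ p μ}
    (hw : TendstoWeakly (fun n => (w n).2) a) {z : ℕ → V × Lp ℝ p μ}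
    (hz : ∀ n, z n ∈ convexHull ℝ (w '' Ici n)) : TendstoWeakly (fun n => (z n).2) a := by
  intro φ
  rw [Metric.tendsto_atTop]
  intro ε hε
  obtain ⟨N, hN⟩ := Metric.tendsto_atTop.1 (hw φ) (ε / 2) (half_pos hε)
  refine ⟨N, fun n hn => ?_⟩
  have hsub : convexHull ℝ (w '' Ici n) ⊆
      {v : V × Lp ℝ p μ | φ v.2 ∈ Metric.closedBall (φ a) (ε / 2)} := by
    refine convexHull_min ?_ ?_
    · rintro _ ⟨k, hk, rfl⟩
      exact (hN k (hn.trans hk)).le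
    · intro u hu v hv b c hb hc hbc
      have := convex_closedBall (φ a) (ε / 2) hu hv hb hc hbc
      simpa using this
  exact (Metric.mem_closedBall.1 (hsub (hz n))).trans_lt (half_lt_self hε)

/-- From a sequence with bounded values one obtains, by convex combinations of the tails,
a sequence with strongly convergent values. -/
theorem exists_strong {f : ℕ → V} {c : ℕ → Lp ℝ p μ} {g : M →ₘ[μ] ℝ} (hf : F.TendstoAE f g)
    (hc : ∀ n, F.val (f n) ≤ c n) {C : ℝ} (hC : ∀ n, ‖c n‖ ≤ C) :
    ∃ (z : ℕ → V) (G : Lp ℝ p μ), F.TendstoAE z g ∧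
      Tendsto (fun n => F.val (z n)) atTop (𝓝 G) ∧ ∀ a, TendstoWeakly c a → G ≤ a := by
  let w : ℕ → V × Lp ℝ p μ := fun n => (f n, c n)
  obtain ⟨z, hz, G, hG⟩ := exists_tendsto_of_midpoint (W := V × Lp ℝ p μ) (fun q => F.val q.1)
    (fun q => F.nonneg' q.1) (fun u v => by
      have := F.val_add_smul_le (a := 1 / 2) (b := 1 / 2) (by norm_num) (by norm_num) u.1 v.1
      simpa only [Prod.smul_fst, Prod.fst_add, smul_add] using this)
    (fun n => convexHull ℝ (w '' Ici n))
    (fun a b hab => convexHull_mono (image_mono (Ici_subset_Ici.2 hab)))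
    (fun n => convex_convexHull ℝ _) C
    (fun n => ⟨w n, subset_convexHull ℝ _ ⟨n, self_mem_Ici, rfl⟩,
      (norm_mono (F.nonneg' _) (hc n)).trans (hC n)⟩)
  refine ⟨fun n => (z n).1, G, TendstoAE.convex F (w := w) hf hz, hG, fun a ha => ?_⟩
  have h1 : TendstoWeakly (fun n => (z n).2) a := weakly_convex (w := w) ha hz
  have h2 : ∀ n, F.val (z n).1 ≤ (z n).2 := fun n => by
    have hsub : convexHull ℝ (w '' Ici n) ⊆ {v : V × Lp ℝ p μ | 0 ≤ v.2 - F.val v.1} := by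
      refine convexHull_min ?_ ?_
      · rintro _ ⟨k, -, rfl⟩
        exact sub_nonneg.2 (hc k)
      · intro u hu v hv a b ha hb hab
        refine (add_nonneg (smul_nonneg' ha hu) (smul_nonneg' hb hv)).trans ?_
        rw [smul_sub, smul_sub, sub_add_sub_comm]
        exact sub_le_sub_left (F.val_add_smul_le ha hb u.1 v.1) _
    exact sub_nonneg.1 (hsub (hz n))
  have h3 := (h1.sub hG.tendstoWeakly).nonneg fun n => sub_nonneg.2 (h2 n)
  exact sub_nonneg.1 h3

theorem mem_lowerSet_iff [SigmaFinite μ] {g : M →ₘ[μ] ℝ} {G : Lp ℝ p μ} :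
    G ∈ F.lowerSet g ↔ ∀ (f : ℕ → V) (G' : Lp ℝ p μ), F.TendstoAE f g →
      TendstoWeakly (fun n => F.val (f n)) G' → G ≤ G' := by
  constructor
  · intro h f G' hf hG'
    exact h f G' (TendstoL0.of_ae hf) hG'
  · intro h f G' hf hG'
    obtain ⟨φ, hφ, hφ'⟩ := hf.exists_subseq_ae
    exact h (fun n => f (φ n)) G' hφ' (hG'.subseq hφ)

/-- The functions of finite relaxed energy. -/
def relaxedDomain [SigmaFinite μ] : Submodule ℝ (M →ₘ[μ] ℝ) where
  carrier := {g | F.relaxedEnergy g < ∞}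
  zero_mem' := F.relaxedEnergy_lt_top_iff.2
    ⟨fun _ => 0, ‖F.val 0‖, by simpa using F.tendstoAE_const 0, fun _ => le_rfl⟩
  add_mem' := by
    intro g k hg hk
    obtain ⟨f, C, hf, hC⟩ := F.relaxedEnergy_lt_top_iff.1 hg
    obtain ⟨h, D, hh, hD⟩ := F.relaxedEnergy_lt_top_iff.1 hk
    refine F.relaxedEnergy_lt_top_iff.2 ⟨_, C + D, hf.add F hh, fun n => ?_⟩
    exact (norm_mono (F.nonneg' _) (F.add_le' _ _)).trans
      ((norm_add_le _ _).trans (add_le_add (hC n) (hD n)))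
  smul_mem' := by
    intro c g hg
    obtain ⟨f, C, hf, hC⟩ := F.relaxedEnergy_lt_top_iff.1 hg
    refine F.relaxedEnergy_lt_top_iff.2 ⟨_, |c| * C, hf.const_smul F c, fun n => ?_⟩
    rw [F.smul', norm_smul, Real.norm_eq_abs, abs_abs]
    exact mul_le_mul_of_nonneg_left (hC n) (abs_nonneg c)

theorem sup_mem_lowerSet {g : M →ₘ[μ] ℝ} {G H : Lp ℝ p μ} (hG : G ∈ F.lowerSet g)
    (hH : H ∈ F.lowerSet g) : G ⊔ H ∈ F.lowerSet g :=
  fun f G' h1 h2 => sup_le (hG f G' h1 h2) (hH f G' h1 h2)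

theorem zero_mem_lowerSet (g : M →ₘ[μ] ℝ) : (0 : Lp ℝ p μ) ∈ F.lowerSet g :=
  fun _ _ _ h => h.nonneg fun _ => F.nonneg' _

theorem exists_isGreatest_lowerSet [SigmaFinite μ] {g : M →ₘ[μ] ℝ} (hg : F.relaxedEnergy g < ∞) :
    ∃ G, IsGreatest (F.lowerSet g) G := by
  have hp0 : 0 < (p : ℝ) := zero_lt_one.trans (one_lt_coe (p := p))
  obtain ⟨f, C, hf, hC⟩ := F.relaxedEnergy_lt_top_iff.1 hg
  obtain ⟨z, T, hz, hT, -⟩ := F.exists_strong hf (fun n => le_rfl) hC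
  have hST : ∀ H ∈ F.lowerSet g, H ≤ T := fun H hH =>
    F.mem_lowerSet_iff.1 hH z T hz hT.tendstoWeakly
  let S : Set ℝ := (fun H => ‖H‖) '' (F.lowerSet g ∩ Ici 0)
  have hSne : S.Nonempty := ⟨_, 0, ⟨F.zero_mem_lowerSet g, self_mem_Ici⟩, rfl⟩
  have hSb : BddAbove S := ⟨‖T‖, by
    rintro _ ⟨H, hH, rfl⟩
    exact norm_mono hH.2 (hST H hH.1)⟩
  set R := sSup S
  have hex : ∀ n : ℕ, ∃ H ∈ F.lowerSet g ∩ Ici 0, R - 1 / ((n : ℝ) + 1) < ‖H‖ := fun n => by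
    obtain ⟨_, ⟨H, hH, rfl⟩, h⟩ := exists_lt_of_lt_csSup hSne
      (sub_lt_self R (by positivity : (0 : ℝ) < 1 / ((n : ℝ) + 1)))
    exact ⟨H, hH, h⟩
  choose H hH hHR using hex
  let K : ℕ → Lp ℝ p μ := fun n => partialSups H n
  have hKmono : Monotone K := (partialSups H).monotone
  have hKS : ∀ n, K n ∈ F.lowerSet g := fun n => by
    induction n with
    | zero => simpa [K] using (hH 0).1
    | succ n ih =>
      simp only [K, partialSups_add_one]
      exact F.sup_mem_lowerSet ih (hH (n + 1)).1
  have hHK : ∀ n, H n ≤ K n := fun n => le_partialSups H n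
  have hK0 : ∀ n, 0 ≤ K n := fun n => (show 0 ≤ H n from (hH n).2).trans (hHK n)
  have hKR : ∀ n, ‖K n‖ ≤ R := fun n => le_csSup hSb ⟨K n, ⟨hKS n, hK0 n⟩, rfl⟩
  have hKlim : Tendsto (fun n => ‖K n‖) atTop (𝓝 R) := by
    refine tendsto_of_tendsto_of_tendsto_of_le_of_le ?_ tendsto_const_nhds
      (fun n => (hHR n).le.trans (norm_mono (hH n).2 (hHK n))) hKR
    simpa using tendsto_const_nhds.sub (tendsto_one_div_add_atTop_nhds_zero_nat (𝕜 := ℝ))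
  have hpow : Tendsto (fun n => ‖K n‖ ^ (p : ℝ)) atTop (𝓝 (R ^ (p : ℝ))) :=
    ((Real.continuous_rpow_const hp0.le).continuousAt).tendsto.comp hKlim
  have hcau : CauchySeq K := rpow_cauchy fun η hη => by
    obtain ⟨N, hN⟩ := eventually_atTop.1 (hpow.eventually (Metric.ball_mem_nhds _ (half_pos hη)))
    refine ⟨N, fun n k hn hk => ?_⟩
    have a1 := abs_lt.1 (Real.dist_eq _ _ ▸ Metric.mem_ball.1 (hN n hn))
    have a2 := abs_lt.1 (Real.dist_eq _ _ ▸ Metric.mem_ball.1 (hN k (hn.trans hk)))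
    have a3 := norm_superadd (hK0 n) (hKmono hk)
    rw [norm_sub_rev]
    linarith [a1.1, a2.2]
  obtain ⟨G, hG⟩ := cauchySeq_tendsto_of_complete hcau
  have hGS : G ∈ F.lowerSet g := fun f G' h1 h2 => le_of_tendsto' hG fun n => hKS n f G' h1 h2
  have hG0 : 0 ≤ G := ge_of_tendsto' hG hK0
  have hGR : ‖G‖ = R := tendsto_nhds_unique hG.norm hKlim
  refine ⟨G, hGS, fun L hL => ?_⟩
  have h1 : ‖G ⊔ L‖ ≤ R := le_csSup hSb ⟨G ⊔ L,
    ⟨F.sup_mem_lowerSet hGS hL, hG0.trans le_sup_left⟩, rfl⟩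
  have h2 := norm_superadd hG0 (le_sup_left : G ≤ G ⊔ L)
  have h3 : ‖G ⊔ L‖ ^ (p : ℝ) ≤ ‖G‖ ^ (p : ℝ) := by
    rw [hGR]; exact Real.rpow_le_rpow (norm_nonneg _) h1 hp0.le
  have h4 : ‖G ⊔ L - G‖ ^ (p : ℝ) ≤ 0 := by linarith
  have h5 : ‖G ⊔ L - G‖ = 0 := by
    by_contra hne
    exact absurd h4 (not_le.2 (Real.rpow_pos_of_pos ((norm_nonneg _).lt_of_ne' hne) _))
  rw [norm_eq_zero, sub_eq_zero] at h5
  exact h5 ▸ le_sup_right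

/-- The lower relaxation at `g`: the greatest element of `lowerSet g`. -/
def lowerRelaxation [SigmaFinite μ] (g : F.relaxedDomain) : Lp ℝ p μ :=
  (F.exists_isGreatest_lowerSet g.2).choose

theorem isGreatest_lowerRelaxation [SigmaFinite μ] (g : F.relaxedDomain) :
    IsGreatest (F.lowerSet (g : M →ₘ[μ] ℝ)) (F.lowerRelaxation g) :=
  (F.exists_isGreatest_lowerSet g.2).choose_spec

theorem lowerRelaxation_add_le [SigmaFinite μ] (g k : F.relaxedDomain) :
    F.lowerRelaxation (g + k) ≤ F.lowerRelaxation g + F.lowerRelaxation k := by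
  have key : ∀ (f h : ℕ → V) (G₁ G₂ : Lp ℝ p μ), F.TendstoAE f (g : M →ₘ[μ] ℝ) →
      TendstoWeakly (fun n => F.val (f n)) G₁ → F.TendstoAE h (k : M →ₘ[μ] ℝ) →
      TendstoWeakly (fun n => F.val (h n)) G₂ → F.lowerRelaxation (g + k) ≤ G₁ + G₂ := by
    intro f h G₁ G₂ hf h1 hh h2
    obtain ⟨C, hC⟩ := (h1.add h2).bounded
    obtain ⟨z, G, hz, hG, hle⟩ := F.exists_strong (hf.add F hh) (fun n => F.add_le' _ _) hC
    refine le_trans ?_ (hle _ (h1.add h2))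
    exact F.mem_lowerSet_iff.1 (F.isGreatest_lowerRelaxation (g + k)).1 z G hz hG.tendstoWeakly
  have step : ∀ (h : ℕ → V) (G₂ : Lp ℝ p μ), F.TendstoAE h (k : M →ₘ[μ] ℝ) →
      TendstoWeakly (fun n => F.val (h n)) G₂ →
      F.lowerRelaxation (g + k) - F.lowerRelaxation g ≤ G₂ := by
    intro h G₂ hh h2
    have : F.lowerRelaxation (g + k) - G₂ ∈ F.lowerSet (g : M →ₘ[μ] ℝ) :=
      F.mem_lowerSet_iff.2 fun f G₁ hf h1 => sub_le_iff_le_add.2 (key f h G₁ G₂ hf h1 hh h2)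
    have := (F.isGreatest_lowerRelaxation g).2 this
    rwa [sub_le_comm] at this
  have : F.lowerRelaxation (g + k) - F.lowerRelaxation g ∈ F.lowerSet (k : M →ₘ[μ] ℝ) :=
    F.mem_lowerSet_iff.2 fun h G₂ hh h2 => step h G₂ hh h2
  have := (F.isGreatest_lowerRelaxation k).2 this
  exact sub_le_iff_le_add'.1 this

theorem lowerRelaxation_nonneg [SigmaFinite μ] (g : F.relaxedDomain) :
    0 ≤ F.lowerRelaxation g :=
  (F.isGreatest_lowerRelaxation g).2 (F.zero_mem_lowerSet _)

theorem lowerRelaxation_smul_le [SigmaFinite μ] {c : ℝ} (hc : c ≠ 0) (g : F.relaxedDomain) :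
    F.lowerRelaxation (c • g) ≤ |c| • F.lowerRelaxation g := by
  have hc' : 0 < |c| := abs_pos.2 hc
  have smul_mono : ∀ {r : ℝ} {u v : Lp ℝ p μ}, 0 ≤ r → u ≤ v → r • u ≤ r • v := by
    intro r u v hr h
    rw [← sub_nonneg, ← smul_sub]
    exact smul_nonneg' hr (sub_nonneg.2 h)
  have : |c|⁻¹ • F.lowerRelaxation (c • g) ∈ F.lowerSet (g : M →ₘ[μ] ℝ) := by
    refine F.mem_lowerSet_iff.2 fun f G hf hG => ?_
    have h1 := F.mem_lowerSet_iff.1 (F.isGreatest_lowerRelaxation (c • g)).1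
      (fun n => c • f n) (|c| • G) (hf.const_smul F c) (by
        simp only [F.smul']
        exact hG.const_smul |c|)
    have h2 := smul_mono (inv_nonneg.2 hc'.le) h1
    rwa [smul_smul, inv_mul_cancel₀ hc'.ne', one_smul] at h2
  have h3 := smul_mono hc'.le ((F.isGreatest_lowerRelaxation g).2 this)
  rwa [smul_smul, mul_inv_cancel₀ hc'.ne', one_smul] at h3

/-- The lower relaxation of the functional `F`, as a functional on the functions of finite
relaxed energy. -/
def relaxed [SigmaFinite μ] : LpFunctional μ p F.relaxedDomain where
  toL0 := F.relaxedDomain.subtype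
  val := F.lowerRelaxation
  nonneg' := F.lowerRelaxation_nonneg
  add_le' := F.lowerRelaxation_add_le
  smul' c g := by
    rcases eq_or_ne c 0 with rfl | hc
    · rw [abs_zero, zero_smul, zero_smul]
      refine le_antisymm ?_ (F.lowerRelaxation_nonneg 0)
      refine F.mem_lowerSet_iff.1 (F.isGreatest_lowerRelaxation 0).1 (fun _ => 0) 0 ?_ ?_
      · have := F.tendstoAE_const 0
        rwa [map_zero] at this
      · rw [F.val_zero]
        exact fun φ => tendsto_const_nhds
    · refine le_antisymm (F.lowerRelaxation_smul_le hc g) ?_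
      have h := F.lowerRelaxation_smul_le (inv_ne_zero hc) (c • g)
      rw [smul_smul, inv_mul_cancel₀ hc, one_smul] at h
      rw [← sub_nonneg] at h ⊢
      have h2 := smul_nonneg' (abs_nonneg c) h
      rwa [smul_sub, smul_smul, ← abs_mul, mul_inv_cancel₀ hc, abs_one, one_smul] at h2

/-- The inclusion of the domain of `F` into the domain of its relaxation. -/
def toRelaxed [SigmaFinite μ] : V →ₗ[ℝ] F.relaxedDomain :=
  F.toL0.codRestrict F.relaxedDomain fun v =>
    F.relaxedEnergy_lt_top_iff.2 ⟨fun _ => v, ‖F.val v‖, F.tendstoAE_const v, fun _ => le_rfl⟩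

end LpFunctional
end General

section Metric

variable {M : Type*} [MetricSpace M]

/-- The local Lipschitz constant `lip f (x) = limsup_{y → x} |f y - f x| / d(y, x)`
(equal to `0` at isolated points). -/
def locLip (f : M → ℝ) (x : M) : ℝ :=
  limsup (fun y => |f y - f x| / dist y x) (𝓝[≠] x)

/-- `f` is Lipschitz (with some constant). -/
def IsLipschitz (f : M → ℝ) : Prop := ∃ K : ℝ≥0, LipschitzWith K f

theorem IsLipschitz.quot_le {f : M → ℝ} {K : ℝ≥0} (hf : LipschitzWith K f) (x y : M) :
    |f y - f x| / dist y x ≤ K := by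
  refine div_le_of_le_mul₀ dist_nonneg K.2 ?_
  rw [← Real.dist_eq]
  exact hf.dist_le_mul y x

theorem locLip_nonneg {f : M → ℝ} (hf : IsLipschitz f) (x : M) : 0 ≤ locLip f x := by
  obtain ⟨K, hK⟩ := hf
  rcases eq_or_neBot (𝓝[≠] x) with h | h
  · simp [locLip, h, limsup_eq]
  · exact le_limsup_of_frequently_le (Frequently.of_forall fun y => by positivity)
      ⟨K, eventually_map.2 (Eventually.of_forall fun y => IsLipschitz.quot_le hK x y)⟩

theorem locLip_le_iff {f : M → ℝ} (hf : IsLipschitz f) (x : M) {c : ℝ} (hc : 0 ≤ c) :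
    locLip f x ≤ c ↔ ∀ ε > 0, ∀ᶠ y in 𝓝[≠] x, |f y - f x| ≤ (c + ε) * dist y x := by
  obtain ⟨K, hK⟩ := hf
  have hiff : ∀ b : ℝ, (∀ᶠ y in 𝓝[≠] x, |f y - f x| / dist y x ≤ b) ↔
      ∀ᶠ y in 𝓝[≠] x, |f y - f x| ≤ b * dist y x := fun b => by
    refine eventually_congr ?_
    filter_upwards [self_mem_nhdsWithin] with y hy
    exact div_le_iff₀ (dist_pos.2 hy)
  constructor
  · intro h ε hε
    rw [← hiff]
    have : limsup (fun y => |f y - f x| / dist y x) (𝓝[≠] x) < c + ε := by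
      have : locLip f x < c + ε := by linarith
      exact this
    filter_upwards [eventually_lt_of_limsup_lt this
      ⟨K, eventually_map.2 (Eventually.of_forall fun y => IsLipschitz.quot_le hK x y)⟩] with y hy
      using hy.le
  · intro h
    rcases eq_or_neBot (𝓝[≠] x) with h0 | h0
    · simpa [locLip, h0, limsup_eq] using hc
    · refine le_of_forall_pos_le_add fun ε hε => ?_
      have := (hiff _).2 (h ε hε)
      exact limsup_le_of_le (IsCoboundedUnder.of_frequently_ge
        (a := 0) (Frequently.of_forall fun y => by positivity)) this

theorem IsLipschitz.add {f h : M → ℝ} (hf : IsLipschitz f) (hh : IsLipschitz h) :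
    IsLipschitz (f + h) := by
  obtain ⟨K, hK⟩ := hf
  obtain ⟨L, hL⟩ := hh
  exact ⟨K + L, hK.add hL⟩

theorem IsLipschitz.const_smul {f : M → ℝ} (hf : IsLipschitz f) (c : ℝ) : IsLipschitz (c • f) := by
  obtain ⟨K, hK⟩ := hf
  refine ⟨‖c‖₊ * K, LipschitzWith.of_dist_le_mul fun x y => ?_⟩
  rw [Pi.smul_apply, Pi.smul_apply, dist_smul₀, NNReal.coe_mul, coe_nnnorm, mul_assoc]
  exact mul_le_mul_of_nonneg_left (hK.dist_le_mul x y) (norm_nonneg c)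

theorem IsLipschitz.zero : IsLipschitz (0 : M → ℝ) := ⟨0, LipschitzWith.const 0⟩

theorem locLip_add_le {f h : M → ℝ} (hf : IsLipschitz f) (hh : IsLipschitz h) (x : M) :
    locLip (f + h) x ≤ locLip f x + locLip h x := by
  rw [locLip_le_iff (hf.add hh) x (add_nonneg (locLip_nonneg hf x) (locLip_nonneg hh x))]
  intro ε hε
  filter_upwards [(locLip_le_iff hf x (locLip_nonneg hf x)).1 le_rfl (ε / 2) (half_pos hε),
    (locLip_le_iff hh x (locLip_nonneg hh x)).1 le_rfl (ε / 2) (half_pos hε)] with y h1 h2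
  calc |(f + h) y - (f + h) x| = |(f y - f x) + (h y - h x)| := by
        simp only [Pi.add_apply]; ring_nf
    _ ≤ _ := (abs_add_le _ _).trans (add_le_add h1 h2)
    _ = _ := by ring

theorem locLip_smul_le {f : M → ℝ} (hf : IsLipschitz f) (c : ℝ) (x : M) :
    locLip (c • f) x ≤ |c| * locLip f x := by
  rw [locLip_le_iff (hf.const_smul c) x (mul_nonneg (abs_nonneg c) (locLip_nonneg hf x))]
  intro ε hε
  have hc : 0 < |c| + 1 := by positivity
  filter_upwards [(locLip_le_iff hf x (locLip_nonneg hf x)).1 le_rfl (ε / (|c| + 1))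
    (by positivity)] with y h1
  have e : (c • f) y - (c • f) x = c * (f y - f x) := by simp [mul_sub]
  rw [e, abs_mul]
  refine (mul_le_mul_of_nonneg_left h1 (abs_nonneg c)).trans ?_
  rw [← mul_assoc]
  refine mul_le_mul_of_nonneg_right ?_ dist_nonneg
  rw [mul_add]
  refine add_le_add_right ?_ _
  rw [mul_div_assoc', div_le_iff₀ hc]
  nlinarith [abs_nonneg c]

theorem locLip_smul {f : M → ℝ} (hf : IsLipschitz f) (c : ℝ) (x : M) :
    locLip (c • f) x = |c| * locLip f x := by
  refine le_antisymm (locLip_smul_le hf c x) ?_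
  rcases eq_or_ne c 0 with rfl | hc
  · rw [abs_zero, zero_mul]
    exact locLip_nonneg (hf.const_smul 0) x
  · have h := locLip_smul_le (hf.const_smul c) c⁻¹ x
    rw [smul_smul, inv_mul_cancel₀ hc, one_smul, abs_inv] at h
    rwa [inv_mul_eq_div, le_div_iff₀ (abs_pos.2 hc), mul_comm] at h

variable [MeasurableSpace M] [BorelSpace M]

theorem measurable_locLip {f : M → ℝ} (hf : IsLipschitz f) : Measurable (locLip f) := by
  have hfc : Continuous f := hf.choose_spec.continuous
  refine measurable_of_Iic fun c => ?_
  rcases lt_or_ge c 0 with hc | hc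
  · have : locLip f ⁻¹' Iic c = ∅ := by
      ext x
      simp only [mem_preimage, mem_Iic, mem_empty_iff_false, iff_false, not_le]
      exact hc.trans_le (locLip_nonneg hf x)
    rw [this]
    exact MeasurableSet.empty
  · let A : ℕ → ℕ → Set M := fun k n =>
      {x | ∀ y, dist y x < 1 / ((n : ℝ) + 1) → |f y - f x| ≤ (c + 1 / ((k : ℝ) + 1)) * dist y x}
    have hA : ∀ k n, IsClosed (A k n) := fun k n => by
      have : A k n = ⋂ y, ({x | 1 / ((n : ℝ) + 1) ≤ dist y x} ∪
          {x | |f y - f x| ≤ (c + 1 / ((k : ℝ) + 1)) * dist y x}) := by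
        ext x
        simp only [A, mem_iInter, mem_union]
        refine forall_congr' fun y => ?_
        change (dist y x < 1 / ((n : ℝ) + 1) → _) ↔ (1 / ((n : ℝ) + 1) ≤ dist y x) ∨ _
        rw [imp_iff_not_or, not_lt]
        rfl
      rw [this]
      exact isClosed_iInter fun y => (isClosed_le (by fun_prop) (by fun_prop)).union
        (isClosed_le (by fun_prop) (by fun_prop))
    have : locLip f ⁻¹' Iic c = ⋂ k, ⋃ n, A k n := by
      ext x
      rw [mem_preimage, mem_Iic, locLip_le_iff hf x hc, mem_iInter]
      constructor
      · intro h k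
        have h1 := h (1 / ((k : ℝ) + 1)) (by positivity)
        rw [eventually_nhdsWithin_iff, Metric.eventually_nhds_iff] at h1
        obtain ⟨r, hr, h1⟩ := h1
        obtain ⟨n, hn⟩ := exists_nat_one_div_lt hr
        refine mem_iUnion.2 ⟨n, fun y hy => ?_⟩
        rcases eq_or_ne y x with rfl | hne
        · simp
        · exact h1 (hy.trans hn) hne
      · intro h ε hε
        obtain ⟨k, hk⟩ := exists_nat_one_div_lt hε
        obtain ⟨n, hn⟩ := mem_iUnion.1 (h k)
        rw [eventually_nhdsWithin_iff, Metric.eventually_nhds_iff]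
        refine ⟨1 / ((n : ℝ) + 1), by positivity, fun y hy _ => (hn y hy).trans ?_⟩
        exact mul_le_mul_of_nonneg_right (by linarith) dist_nonneg
    rw [this]
    exact MeasurableSet.iInter fun k => MeasurableSet.iUnion fun n => (hA k n).measurableSet

variable (μ : Measure M) (p : ℝ≥0) [Fact (1 < p)]

/-- The Lipschitz functions `f` with `lip f ∈ L^p(μ)`. -/
def lipDomain : Submodule ℝ (M → ℝ) where
  carrier := {f | IsLipschitz f ∧ MemLp (locLip f) p μ}
  zero_mem' := by
    refine ⟨IsLipschitz.zero, ?_⟩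
    have : locLip (0 : M → ℝ) = 0 := funext fun x => by
      have := locLip_smul (IsLipschitz.zero (M := M)) 0 x
      simpa using this
    rw [this]
    exact MemLp.zero
  add_mem' := by
    rintro f h ⟨hf, hf'⟩ ⟨hh, hh'⟩
    refine ⟨hf.add hh, (hf'.add hh').mono
      (measurable_locLip (hf.add hh)).aestronglyMeasurable (ae_of_all _ fun x => ?_)⟩
    rw [Real.norm_of_nonneg (locLip_nonneg (hf.add hh) x)]
    exact (locLip_add_le hf hh x).trans (le_abs_self _)
  smul_mem' := by
    rintro c f ⟨hf, hf'⟩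
    refine ⟨hf.const_smul c, ?_⟩
    have : locLip (c • f) = fun x => |c| * locLip f x := funext fun x => locLip_smul hf c x
    rw [this]
    exact hf'.const_mul _

variable {μ p}

theorem isLipschitz_coe (f : lipDomain μ p) : IsLipschitz (f : M → ℝ) := f.2.1

theorem memLp_coe (f : lipDomain μ p) : MemLp (locLip (f : M → ℝ)) p μ := f.2.2

theorem aestronglyMeasurable_coe (f : lipDomain μ p) : AEStronglyMeasurable (f : M → ℝ) μ :=
  (isLipschitz_coe f).choose_spec.continuous.aestronglyMeasurable

/-- `lip f` as an element of `L^p(μ)`. -/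
def lipVal (f : lipDomain μ p) : Lp ℝ p μ := (memLp_coe f).toLp (locLip (f : M → ℝ))

theorem coeFn_lipVal (f : lipDomain μ p) : lipVal f =ᵐ[μ] locLip (f : M → ℝ) :=
  (memLp_coe f).coeFn_toLp

theorem lipVal_nonneg (f : lipDomain μ p) : 0 ≤ lipVal f := by
  rw [← Lp.coeFn_nonneg]
  filter_upwards [coeFn_lipVal f] with x hx
  rw [hx]
  exact locLip_nonneg (isLipschitz_coe f) x

theorem lipVal_add_le (f h : lipDomain μ p) : lipVal (f + h) ≤ lipVal f + lipVal h := by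
  rw [← Lp.coeFn_le]
  filter_upwards [coeFn_lipVal f, coeFn_lipVal h, coeFn_lipVal (f + h),
    Lp.coeFn_add (lipVal f) (lipVal h)] with x h1 h2 h3 h4
  rw [h3, h4, Pi.add_apply, h1, h2]
  exact locLip_add_le (isLipschitz_coe f) (isLipschitz_coe h) x

theorem lipVal_smul (c : ℝ) (f : lipDomain μ p) : lipVal (c • f) = |c| • lipVal f := by
  refine Lp.ext ?_
  filter_upwards [coeFn_lipVal f, coeFn_lipVal (c • f), Lp.coeFn_smul (|c|) (lipVal f)]
    with x h1 h2 h3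
  rw [h2, h3, Pi.smul_apply, h1]
  exact locLip_smul (isLipschitz_coe f) c x

variable (μ p)

/-- The functional `f ↦ lip f` on the Lipschitz functions with `lip f ∈ L^p(μ)`. -/
def lipFunctional : LpFunctional μ p (lipDomain μ p) where
  toL0 :=
    { toFun := fun f => AEEqFun.mk f (aestronglyMeasurable_coe f)
      map_add' := fun _ _ => rfl
      map_smul' := fun _ _ => rfl }
  val := lipVal
  nonneg' := lipVal_nonneg
  add_le' := lipVal_add_le
  smul' := lipVal_smul

/-- The `L^p`-Lipschitz module `L^p_lip(T^*M)`. -/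
abbrev LipschitzModule : Type _ := (lipFunctional μ p).Mod

/-- The functional `f ↦ |Df|_{*,p}` (relaxed slope): the lower relaxation of `f ↦ lip f`. -/
abbrev relaxedSlope [SigmaFinite μ] : LpFunctional μ p (lipFunctional μ p).relaxedDomain :=
  (lipFunctional μ p).relaxed

/-- The `L^p`-cotangent module `L^p(T^*M)`. -/
abbrev CotangentModule [SigmaFinite μ] : Type _ := (relaxedSlope μ p).Mod

/-- The `Lipschitz_0` module `L^p_{lip_0}(T^*M)`. -/
abbrev lipschitzZeroModule : Submodule ℝ (LipschitzModule μ p) := (lipFunctional μ p).zeroModule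

end Metric

end NormedModules

end

open NormedModules

/-!
Weak reflexivity together with Mazur's lemma turns a bounded sequence of differentials with
`f_n → f` in `L⁰` into convex combinations `z_n → f` whose differentials converge strongly. Hence
the infimum in the definition of the relaxed slope is attained by strong limits, and `|Df|_{*,p}` is
the essential infimum of `|d_lip f + w|` over `w` in the `Lipschitz_0` module. The contraction
`d_lip f ↦ d_p f` annihilates the `Lipschitz_0` module, and by working on the pieces of a partition
it realises the pointwise quotient norm on all of the Lipschitz module; since one may switch between
two representatives of a class along a measurable set, the norm of that essential infimum is the
quotient norm.

If `d_lip` is closable and `d_lip h_n` converges strongly with `h_n → f`, where `f` is Lipschitz,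
then `u_n`, the truncation to `[-1, 1]` of `h_n - f` cut off outside a ball, tends to `0` a.e. and
has bounded differentials, so along a subsequence these tend weakly to `0`. But `u_n - h_n + f` is
locally constant on a smaller ball wherever `|h_n - f| < 1`, so there `lim d_lip h_n` is the
differential of a cut-off of `f` and its pointwise norm is `lip f`.
-/

namespace NormedModules

section Lebesgue

variable {M : Type*} [MeasurableSpace M] {μ : Measure M}

theorem ae_abs_le_norm (a : Lp ℝ ∞ μ) : ∀ᵐ x ∂μ, |a x| ≤ ‖a‖ := by
  have h : ∀ᵐ x ∂μ, ‖a x‖ₑ ≤ eLpNorm a ∞ μ := by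
    rw [eLpNorm_exponent_top]
    exact enorm_ae_le_eLpNormEssSup a μ
  filter_upwards [h] with x hx
  rw [← Real.norm_eq_abs, Lp.norm_def, ← toReal_enorm]
  exact ENNReal.toReal_mono (Lp.eLpNorm_ne_top a) hx

variable {p : ℝ≥0} [Fact (1 < p)]

theorem exists_subseq_tendsto_ae {u : ℕ → Lp ℝ p μ} {v : Lp ℝ p μ} (h : Tendsto u atTop (𝓝 v)) :
    ∃ φ : ℕ → ℕ, StrictMono φ ∧ ∀ᵐ x ∂μ, Tendsto (fun n => u (φ n) x) atTop (𝓝 (v x)) :=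
  (tendstoInMeasure_of_tendsto_Lp h).exists_seq_tendsto_ae

end Lebesgue

theorem isPiecewiseConst_indicator_one {M : Type*} [MeasurableSpace M] {A : Set M}
    (hA : MeasurableSet A) : IsPiecewiseConst (A.indicator fun _ => (1 : ℝ)) := by
  refine IsPiecewiseConst.of_countable ?_ (measurable_const.indicator hA)
  refine ((countable_singleton (1 : ℝ)).insert 0).mono ?_
  rintro _ ⟨x, rfl⟩
  by_cases hx : x ∈ A <;> simp [hx]

theorem abs_indicator_one_le {M : Type*} (A : Set M) (x : M) :
    |A.indicator (fun _ => (1 : ℝ)) x| ≤ 1 := by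
  by_cases hx : x ∈ A <;> simp [hx]

namespace LpFunctional

section Chi

variable {M : Type*} [MeasurableSpace M] {μ : Measure M}

theorem coeFn_chi (A : Set M) (hA : MeasurableSet A) :
    chi μ A hA =ᵐ[μ] A.indicator fun _ => (1 : ℝ) :=
  MemLp.coeFn_toLp _

theorem chi_add_chi_compl {A : Set M} (hA : MeasurableSet A) :
    chi μ A hA + chi μ Aᶜ hA.compl = chi μ univ MeasurableSet.univ := by
  refine Lp.ext ?_
  filter_upwards [coeFn_chi (μ := μ) A hA, coeFn_chi (μ := μ) _ hA.compl,
    coeFn_chi (μ := μ) _ MeasurableSet.univ, Lp.coeFn_add (chi μ A hA) (chi μ Aᶜ hA.compl)]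
    with x h1 h2 h3 h4
  rw [h4, Pi.add_apply, h1, h2, h3, ← Pi.add_apply, indicator_self_add_compl, indicator_univ]

theorem chi_smul_chi {A B : Set M} (hA : MeasurableSet A) (hB : MeasurableSet B) :
    (chi μ A hA • chi μ B hB : Lp ℝ ∞ μ) = chi μ (A ∩ B) (hA.inter hB) := by
  refine Lp.ext ?_
  filter_upwards [Lp.coeFn_lpSMul (r := ∞) (chi μ A hA) (chi μ B hB), coeFn_chi (μ := μ) A hA,
    coeFn_chi (μ := μ) B hB, coeFn_chi (μ := μ) _ (hA.inter hB)] with x h1 h2 h3 h4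
  rw [h1, Pi.smul_apply', h2, h3, h4, smul_eq_mul, ← inter_indicator_mul, one_mul]

end Chi

variable {M : Type*} [MeasurableSpace M] {μ : Measure M} {p : ℝ≥0} [Fact (1 < p)]
  {V : Type*} [AddCommGroup V] [Module ℝ V] (F : LpFunctional μ p V)

theorem hom_ext_coe {E : Type*} [NormedAddCommGroup E] [NormedSpace ℝ E] {S T : F.Mod →L[ℝ] E}
    (h : ∀ s : F.Pfm, S (s : F.Mod) = T (s : F.Mod)) : S = T := by
  ext v
  induction v using UniformSpace.Completion.induction_on with
  | hp => exact isClosed_eq S.continuous T.continuous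
  | ih s => exact h s

theorem exists_seq_pfm (v : F.Mod) :
    ∃ s : ℕ → F.Pfm, Tendsto (fun n => (s n : F.Mod)) atTop (𝓝 v) := by
  obtain ⟨u, hu, h⟩ := mem_closure_iff_seq_limit.1
    ((UniformSpace.Completion.denseRange_coe (α := F.Pfm)) v)
  choose s hs using hu
  exact ⟨s, by simpa only [hs] using h⟩

section PointwiseNorm

theorem continuous_pnorm : Continuous F.pnorm := UniformSpace.Completion.continuous_extension

theorem norm_pnorm (v : F.Mod) : ‖F.pnorm v‖ = ‖v‖ := by
  induction v using UniformSpace.Completion.induction_on with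
  | hp => exact isClosed_eq F.continuous_pnorm.norm continuous_norm
  | ih s => rw [pnorm_coe, UniformSpace.Completion.norm_coe, norm_pfm]

theorem pnorm_nonneg (v : F.Mod) : 0 ≤ F.pnorm v := by
  induction v using UniformSpace.Completion.induction_on with
  | hp => exact isClosed_le continuous_const F.continuous_pnorm
  | ih s => rw [pnorm_coe]; exact s.pnorm_nonneg

theorem ae_pnorm_nonneg (v : F.Mod) : ∀ᵐ x ∂μ, 0 ≤ F.pnorm v x :=
  (Lp.coeFn_nonneg _).2 (F.pnorm_nonneg v)

theorem pnorm_add_le (v w : F.Mod) : F.pnorm (v + w) ≤ F.pnorm v + F.pnorm w := by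
  have hc := F.continuous_pnorm
  induction v, w using UniformSpace.Completion.induction_on₂ with
  | hp => exact isClosed_le (by fun_prop) (by fun_prop)
  | ih s t =>
    rw [← UniformSpace.Completion.coe_add, pnorm_coe, pnorm_coe, pnorm_coe]
    exact s.pnorm_add_le t

theorem ae_pnorm_add_le (v w : F.Mod) :
    ∀ᵐ x ∂μ, F.pnorm (v + w) x ≤ F.pnorm v x + F.pnorm w x := by
  filter_upwards [(Lp.coeFn_le _ _).2 (F.pnorm_add_le v w),
    Lp.coeFn_add (F.pnorm v) (F.pnorm w)] with x h1 h2
  rwa [h2] at h1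

theorem pnorm_le_add_sub (v w : F.Mod) : F.pnorm v ≤ F.pnorm w + F.pnorm (v - w) := by
  simpa only [add_sub_cancel] using F.pnorm_add_le w (v - w)

theorem pnorm_smul (c : ℝ) (v : F.Mod) : F.pnorm (c • v) = |c| • F.pnorm v := by
  induction v using UniformSpace.Completion.induction_on with
  | hp =>
    exact isClosed_eq (F.continuous_pnorm.comp (continuous_const_smul c))
      (F.continuous_pnorm.const_smul |c|)
  | ih s => rw [← UniformSpace.Completion.coe_smul, pnorm_coe, pnorm_coe, Pfm.pnorm_smul]

theorem pnorm_zero : F.pnorm 0 = 0 := by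
  simpa only [zero_smul, abs_zero] using F.pnorm_smul 0 0

theorem pnorm_eq_zero {v : F.Mod} : F.pnorm v = 0 ↔ v = 0 := by
  rw [← norm_eq_zero, norm_pnorm, norm_eq_zero]

theorem norm_le_of_pnorm_le {v : F.Mod} {u : Lp ℝ p μ} (h : F.pnorm v ≤ u) : ‖v‖ ≤ ‖u‖ := by
  rw [← norm_pnorm]
  exact norm_mono (F.pnorm_nonneg v) h

theorem norm_d (f : V) : ‖F.d f‖ = ‖F.val f‖ := by rw [← norm_pnorm, pnorm_d]

end PointwiseNorm

section Multiplication

/-- Multiplication of the module by a bounded function with countably many values. The bound `K`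
only serves to make the multiplication continuous. -/
noncomputable def pcMul (c : M → ℝ) (hc : IsPiecewiseConst c) (K : ℝ) (hK : ∀ᵐ x ∂μ, |c x| ≤ K) :
    F.Mod →L[ℝ] F.Mod :=
  (F.mulPfm c hc K hK).completion

theorem pcMul_coe (c : M → ℝ) (hc : IsPiecewiseConst c) (K : ℝ) (hK : ∀ᵐ x ∂μ, |c x| ≤ K)
    (s : F.Pfm) : F.pcMul c hc K hK (s : F.Mod) = (F.mulPfmFun c hc K hK s : F.Pfm) :=
  ContinuousLinearMap.completion_apply_coe _ _

theorem norm_pcMul_sub_le {c c' : M → ℝ} (hc : IsPiecewiseConst c) (hc' : IsPiecewiseConst c')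
    {K K' : ℝ} (hK : ∀ᵐ x ∂μ, |c x| ≤ K) (hK' : ∀ᵐ x ∂μ, |c' x| ≤ K') {ε : ℝ} (hε : 0 ≤ ε)
    (h : ∀ᵐ x ∂μ, |c x - c' x| ≤ ε) :
    ‖F.pcMul c hc K hK - F.pcMul c' hc' K' hK'‖ ≤ ε := by
  refine ContinuousLinearMap.opNorm_le_bound _ hε fun v => ?_
  induction v using UniformSpace.Completion.induction_on with
  | hp => exact isClosed_le (by fun_prop) (by fun_prop)
  | ih s =>
    have hsub : F.mulPfmFun c hc K hK s - F.mulPfmFun c' hc' K' hK' s =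
        F.mulPfmFun _ (hc.map₂ (· - ·) hc') ε h s :=
      Subtype.ext (funext fun x => (sub_smul (c x) (c' x) (s.fn x)).symm)
    rw [sub_apply, pcMul_coe, pcMul_coe, ← UniformSpace.Completion.coe_sub,
      UniformSpace.Completion.norm_coe, UniformSpace.Completion.norm_coe, hsub]
    exact F.norm_mulPfmFun_le _ _ _ _ s

theorem mulApprox_eq_pcMul (a : Lp ℝ ∞ μ) (n : ℕ) : F.mulApprox a n = F.pcMul (quant n a)
    (isPiecewiseConst_quant n (Lp.stronglyMeasurable a).measurable) (‖a‖ + 1)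
    (ae_quant_le n a) := rfl

theorem tendsto_pcMul {c : ℕ → M → ℝ} (hc : ∀ n, IsPiecewiseConst (c n)) {K : ℝ}
    (hK : ∀ n, ∀ᵐ x ∂μ, |c n x| ≤ K) {a : Lp ℝ ∞ μ} {ε : ℕ → ℝ} (hε : Tendsto ε atTop (𝓝 0))
    (h : ∀ n, ∀ᵐ x ∂μ, |c n x - a x| ≤ ε n) :
    Tendsto (fun n => F.pcMul (c n) (hc n) K (hK n)) atTop (𝓝 (F.mul a)) := by
  refine tendsto_of_tendsto_of_dist (F.tendsto_mulApprox a) ?_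
  have hlim : Tendsto (fun n : ℕ => 1 / ((n : ℝ) + 1) + |ε n|) atTop (𝓝 0) := by
    simpa using tendsto_one_div_add_atTop_nhds_zero_nat.add hε.abs
  refine squeeze_zero (fun n => dist_nonneg) (fun n => ?_) hlim
  rw [dist_eq_norm, mulApprox_eq_pcMul]
  refine F.norm_pcMul_sub_le _ _ _ _ (by positivity) ?_
  filter_upwards [h n] with x hx
  refine (abs_sub_le _ (a x) _).trans (add_le_add (abs_quant_sub_le n a x) ?_)
  rw [abs_sub_comm]
  exact hx.trans (le_abs_self _)

theorem mul_eq_pcMul {c : M → ℝ} (hc : IsPiecewiseConst c) {K : ℝ} (hK : ∀ᵐ x ∂μ, |c x| ≤ K)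
    {a : Lp ℝ ∞ μ} (h : a =ᵐ[μ] c) : F.mul a = F.pcMul c hc K hK := by
  refine tendsto_nhds_unique (F.tendsto_pcMul (fun _ => hc) (fun _ => hK)
    (tendsto_const_nhds (x := (0 : ℝ))) fun _ => ?_) tendsto_const_nhds
  filter_upwards [h] with x hx
  rw [hx, sub_self, abs_zero]

theorem mul_smul (a b : Lp ℝ ∞ μ) (v : F.Mod) :
    F.mul (a • b : Lp ℝ ∞ μ) v = F.mul a (F.mul b v) := by
  have hab : ∀ n, IsPiecewiseConst fun x => quant n a x * quant n b x := fun n =>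
    (isPiecewiseConst_quant n (Lp.stronglyMeasurable a).measurable).map₂ (· * ·)
      (isPiecewiseConst_quant n (Lp.stronglyMeasurable b).measurable)
  have hK : ∀ n, ∀ᵐ x ∂μ, |quant n a x * quant n b x| ≤ (‖a‖ + 1) * (‖b‖ + 1) := fun n => by
    filter_upwards [ae_quant_le n a, ae_quant_le n b] with x h1 h2
    rw [abs_mul]
    gcongr
  have hcomp : ∀ n, (F.mulApprox a n).comp (F.mulApprox b n) = F.pcMul _ (hab n) _ (hK n) :=
    fun n => F.hom_ext_coe fun s => by
      rw [ContinuousLinearMap.comp_apply, mulApprox_eq_pcMul, mulApprox_eq_pcMul, pcMul_coe,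
        pcMul_coe, pcMul_coe]
      exact congrArg _ (Subtype.ext (funext fun x => smul_smul _ _ (s.fn x)))
  have herr : ∀ n, ∀ᵐ x ∂μ, |quant n a x * quant n b x - (a • b : Lp ℝ ∞ μ) x| ≤
      (‖a‖ + 1 + ‖b‖) * (1 / ((n : ℝ) + 1)) := fun n => by
    filter_upwards [Lp.coeFn_lpSMul (r := ∞) a b, ae_quant_le n a, ae_abs_le_norm b] with x h1 h2 h3
    have hsplit : quant n a x * quant n b x - a x * b x =
        quant n a x * (quant n b x - b x) + b x * (quant n a x - a x) := by ring
    rw [h1, Pi.smul_apply', smul_eq_mul, hsplit, _root_.add_mul]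
    refine (abs_add_le _ _).trans ?_
    rw [abs_mul, abs_mul]
    gcongr <;> exact abs_quant_sub_le _ _ x
  have hlim := (ContinuousLinearMap.compL ℝ F.Mod F.Mod F.Mod).continuous₂.tendsto
    (F.mul a, F.mul b) |>.comp ((F.tendsto_mulApprox a).prodMk_nhds (F.tendsto_mulApprox b))
  have hmul := F.tendsto_pcMul hab hK
    (by simpa using tendsto_one_div_add_atTop_nhds_zero_nat.const_mul (‖a‖ + 1 + ‖b‖)) herr
  exact DFunLike.congr_fun (tendsto_nhds_unique hmul (hlim.congr hcomp)) v

theorem add_mul (a b : Lp ℝ ∞ μ) (v : F.Mod) : F.mul (a + b) v = F.mul a v + F.mul b v := by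
  have hab : ∀ n, IsPiecewiseConst fun x => quant n a x + quant n b x := fun n =>
    (isPiecewiseConst_quant n (Lp.stronglyMeasurable a).measurable).map₂ (· + ·)
      (isPiecewiseConst_quant n (Lp.stronglyMeasurable b).measurable)
  have hK : ∀ n, ∀ᵐ x ∂μ, |quant n a x + quant n b x| ≤ (‖a‖ + 1) + (‖b‖ + 1) := fun n => by
    filter_upwards [ae_quant_le n a, ae_quant_le n b] with x h1 h2
    exact (abs_add_le _ _).trans (add_le_add h1 h2)
  have hadd : ∀ n, F.mulApprox a n + F.mulApprox b n = F.pcMul _ (hab n) _ (hK n) :=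
    fun n => F.hom_ext_coe fun s => by
      rw [add_apply, mulApprox_eq_pcMul, mulApprox_eq_pcMul, pcMul_coe, pcMul_coe, pcMul_coe,
        ← UniformSpace.Completion.coe_add]
      exact congrArg _ (Subtype.ext (funext fun x => (add_smul _ _ (s.fn x)).symm))
  have herr : ∀ n, ∀ᵐ x ∂μ, |quant n a x + quant n b x - (a + b : Lp ℝ ∞ μ) x| ≤
      2 * (1 / ((n : ℝ) + 1)) := fun n => by
    filter_upwards [Lp.coeFn_add a b] with x hx
    rw [hx, Pi.add_apply, add_sub_add_comm, two_mul]
    exact (abs_add_le _ _).trans (add_le_add (abs_quant_sub_le n a x) (abs_quant_sub_le n b x))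
  have hmul := F.tendsto_pcMul hab hK
    (by simpa using tendsto_one_div_add_atTop_nhds_zero_nat.const_mul (2 : ℝ)) herr
  have hlim := (F.tendsto_mulApprox a).add (F.tendsto_mulApprox b)
  exact DFunLike.congr_fun (tendsto_nhds_unique hmul (hlim.congr hadd)) v

theorem mul_chi_coe {A : Set M} (hA : MeasurableSet A) (s : F.Pfm) :
    F.mul (chi μ A hA) (s : F.Mod) = (F.mulPfmFun _ (isPiecewiseConst_indicator_one hA) 1
      (ae_of_all _ (abs_indicator_one_le A)) s : F.Pfm) := by
  rw [F.mul_eq_pcMul (isPiecewiseConst_indicator_one hA) (ae_of_all _ (abs_indicator_one_le A))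
    (coeFn_chi A hA), pcMul_coe]

theorem mul_chi_univ (v : F.Mod) : F.mul (chi μ univ MeasurableSet.univ) v = v := by
  have hid : F.mul (chi μ univ MeasurableSet.univ) = ContinuousLinearMap.id ℝ F.Mod :=
    F.hom_ext_coe fun s => by
      rw [mul_chi_coe]
      refine congrArg _ (Subtype.ext (funext fun x => ?_))
      change (univ.indicator (fun _ => (1 : ℝ)) x) • s.fn x = s.fn x
      rw [indicator_univ, one_smul]
  rw [hid, ContinuousLinearMap.id_apply]

theorem mul_chi_add_compl {A : Set M} (hA : MeasurableSet A) (v : F.Mod) :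
    F.mul (chi μ A hA) v + F.mul (chi μ Aᶜ hA.compl) v = v := by
  rw [← add_mul, chi_add_chi_compl, mul_chi_univ]

theorem mul_chi_mul_chi {A B : Set M} (hA : MeasurableSet A) (hB : MeasurableSet B) (v : F.Mod) :
    F.mul (chi μ A hA) (F.mul (chi μ B hB) v) = F.mul (chi μ (A ∩ B) (hA.inter hB)) v := by
  rw [← mul_smul, chi_smul_chi]

theorem tendsto_mulApprox_apply (a : Lp ℝ ∞ μ) (v : F.Mod) :
    Tendsto (fun n => F.mulApprox a n v) atTop (𝓝 (F.mul a v)) :=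
  ((ContinuousLinearMap.apply ℝ F.Mod v).continuous.tendsto _).comp (F.tendsto_mulApprox a)

theorem pnorm_mul_coe (a : Lp ℝ ∞ μ) (s : F.Pfm) :
    ∀ᵐ x ∂μ, F.pnorm (F.mul a (s : F.Mod)) x = |a x| * s.pnorm x := by
  obtain ⟨φ, hφ, hlim⟩ := exists_subseq_tendsto_ae
    ((F.continuous_pnorm.tendsto _).comp (F.tendsto_mulApprox_apply a (s : F.Mod)))
  have happrox : ∀ᵐ x ∂μ, ∀ n, F.pnorm (F.mulApprox a n (s : F.Mod)) x =
      |quant n a x| * s.pnorm x := ae_all_iff.2 fun n => by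
    rw [mulApprox_eq_pcMul, pcMul_coe, pnorm_coe]
    exact F.pnorm_mulPfmFun _ _ _ _ _
  filter_upwards [hlim, happrox] with x hx hx'
  have hquant : Tendsto (fun n => quant n a x) atTop (𝓝 (a x)) := by
    rw [tendsto_iff_norm_sub_tendsto_zero]
    exact squeeze_zero (fun n => norm_nonneg _) (fun n => abs_quant_sub_le n a x)
      tendsto_one_div_add_atTop_nhds_zero_nat
  refine tendsto_nhds_unique hx (((hquant.comp hφ.tendsto_atTop).abs.mul_const _).congr fun n => ?_)
  exact (hx' (φ n)).symm

theorem pnorm_mul (a : Lp ℝ ∞ μ) (v : F.Mod) : F.pnorm (F.mul a v) = |a| • F.pnorm v := by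
  induction v using UniformSpace.Completion.induction_on with
  | hp =>
    have hsmul : Continuous fun u : Lp ℝ p μ => (|a| • u : Lp ℝ p μ) :=
      ((ContinuousLinearMap.lsmul ℝ ℝ).holderL μ ∞ p p |a|).continuous
    exact isClosed_eq (F.continuous_pnorm.comp (F.mul a).continuous)
      (hsmul.comp F.continuous_pnorm)
  | ih s =>
    refine Lp.ext ?_
    filter_upwards [F.pnorm_mul_coe a s, Lp.coeFn_lpSMul (r := p) |a| (F.pnorm (s : F.Mod)),
      Lp.coeFn_abs a] with x h1 h2 h3
    rw [h1, h2, Pi.smul_apply', h3, smul_eq_mul, pnorm_coe]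

theorem coeFn_pnorm_mul (a : Lp ℝ ∞ μ) (v : F.Mod) :
    ∀ᵐ x ∂μ, F.pnorm (F.mul a v) x = |a x| * F.pnorm v x := by
  filter_upwards [Lp.coeFn_lpSMul (r := p) |a| (F.pnorm v), Lp.coeFn_abs a] with x h1 h2
  rw [pnorm_mul, h1, Pi.smul_apply', h2, smul_eq_mul]

theorem coeFn_pnorm_mul_chi {A : Set M} (hA : MeasurableSet A) (v : F.Mod) :
    F.pnorm (F.mul (chi μ A hA) v) =ᵐ[μ] A.indicator (F.pnorm v) := by
  filter_upwards [F.coeFn_pnorm_mul (chi μ A hA) v, coeFn_chi (μ := μ) A hA] with x h1 h2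
  rw [h1, h2]
  by_cases h : x ∈ A <;> simp [h]

end Multiplication

section Vanishing

/-- The elements of the module that vanish on `A`; thus `v ≡ w [SMOD F.vanishingOn A]` expresses
that `v = w` on `A`. The set `A` need not be measurable. -/
def vanishingOn (A : Set M) : Submodule ℝ F.Mod where
  carrier := {v | ∀ᵐ x ∂μ, x ∈ A → F.pnorm v x = 0}
  zero_mem' := by
    filter_upwards [Lp.coeFn_zero ℝ p μ] with x hx _
    rw [pnorm_zero, hx, Pi.zero_apply]
  add_mem' := fun {v w} hv hw => by
    filter_upwards [hv, hw, F.ae_pnorm_add_le v w, F.ae_pnorm_nonneg (v + w)] with x h1 h2 h3 h4 hx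
    rw [h1 hx, h2 hx, add_zero] at h3
    exact le_antisymm h3 h4
  smul_mem' := fun c v hv => by
    filter_upwards [hv, Lp.coeFn_smul |c| (F.pnorm v)] with x h1 h2 hx
    rw [pnorm_smul, h2, Pi.smul_apply, h1 hx, smul_zero]

theorem mem_vanishingOn {A : Set M} {v : F.Mod} :
    v ∈ F.vanishingOn A ↔ ∀ᵐ x ∂μ, x ∈ A → F.pnorm v x = 0 := Iff.rfl

theorem vanishingOn_anti {A B : Set M} (h : A ⊆ B) : F.vanishingOn B ≤ F.vanishingOn A :=
  fun _ hv => (F.mem_vanishingOn.1 hv).mono fun _ hx hxA => hx (h hxA)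

theorem vanishingOn_univ : F.vanishingOn univ = ⊥ := by
  refine (Submodule.eq_bot_iff _).2 fun v hv => ?_
  rw [← F.pnorm_eq_zero, Lp.eq_zero_iff_ae_eq_zero]
  exact (F.mem_vanishingOn.1 hv).mono fun x hx => hx (mem_univ x)

theorem vanishingOn_iUnion {ι : Type*} [Countable ι] (A : ι → Set M) :
    F.vanishingOn (⋃ i, A i) = ⨅ i, F.vanishingOn (A i) := by
  refine le_antisymm (le_iInf fun i => F.vanishingOn_anti (subset_iUnion A i)) fun v hv => ?_
  filter_upwards [ae_all_iff.2 ((Submodule.mem_iInf _).1 hv)] with x hx hxA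
  obtain ⟨i, hi⟩ := mem_iUnion.1 hxA
  exact hx i hi

theorem coeFn_pnorm_congr {A : Set M} {v w : F.Mod} (h : v ≡ w [SMOD F.vanishingOn A]) :
    ∀ᵐ x ∂μ, x ∈ A → F.pnorm v x = F.pnorm w x := by
  filter_upwards [F.mem_vanishingOn.1 (SModEq.sub_mem.1 h),
    F.mem_vanishingOn.1 (SModEq.sub_mem.1 h.symm), F.ae_pnorm_add_le (v - w) w,
    F.ae_pnorm_add_le (w - v) v] with x h1 h2 h3 h4 hx
  rw [sub_add_cancel, h1 hx, zero_add] at h3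
  rw [sub_add_cancel, h2 hx, zero_add] at h4
  exact le_antisymm h3 h4

theorem mul_chi_eq_zero_iff {A : Set M} (hA : MeasurableSet A) {v : F.Mod} :
    F.mul (chi μ A hA) v = 0 ↔ v ∈ F.vanishingOn A := by
  rw [← F.pnorm_eq_zero, Lp.eq_zero_iff_ae_eq_zero, mem_vanishingOn]
  refine eventually_congr ?_
  filter_upwards [F.coeFn_pnorm_mul_chi hA v] with x hx
  rw [hx, Pi.zero_apply, indicator_apply_eq_zero]

theorem mul_chi_eq_mul_chi_iff {A : Set M} (hA : MeasurableSet A) {v w : F.Mod} :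
    F.mul (chi μ A hA) v = F.mul (chi μ A hA) w ↔ v ≡ w [SMOD F.vanishingOn A] := by
  rw [← sub_eq_zero, ← map_sub, mul_chi_eq_zero_iff, SModEq.sub_mem]

theorem mul_chi_sModEq {A : Set M} (hA : MeasurableSet A) (v : F.Mod) :
    F.mul (chi μ A hA) v ≡ v [SMOD F.vanishingOn A] := by
  rw [← mul_chi_eq_mul_chi_iff F hA, mul_chi_mul_chi]
  simp only [inter_self]

theorem mul_chi_mem_vanishingOn {A B : Set M} (hA : MeasurableSet A) (h : Disjoint A B)
    (v : F.Mod) : F.mul (chi μ A hA) v ∈ F.vanishingOn B := by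
  filter_upwards [F.coeFn_pnorm_mul_chi hA v] with x hx hxB
  rw [hx, indicator_of_notMem (disjoint_right.1 h hxB)]

theorem coe_sModEq_d (s : F.Pfm) (v : V) :
    (s : F.Mod) ≡ F.d v [SMOD F.vanishingOn (s.fn ⁻¹' {v})] := by
  rw [← mul_chi_eq_mul_chi_iff F (s.isPiecewiseConst.2 v)]
  change _ = F.mul _ ((F.mkPfm (fun _ => v) (IsPiecewiseConst.const v) (Lp.memLp (F.val v)) :
    F.Pfm) : F.Mod)
  rw [mul_chi_coe, mul_chi_coe]
  refine congrArg _ (Subtype.ext (funext fun x => ?_))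
  change (s.fn ⁻¹' {v}).indicator (fun _ => (1 : ℝ)) x • s.fn x =
    (s.fn ⁻¹' {v}).indicator (fun _ => (1 : ℝ)) x • v
  by_cases hx : x ∈ s.fn ⁻¹' {v}
  · rw [show s.fn x = v from hx]
  · rw [indicator_of_notMem hx, zero_smul, zero_smul]

end Vanishing

end LpFunctional

section Lebesgue

variable {M : Type*} [MeasurableSpace M] {μ : Measure M} {p : ℝ≥0} [Fact (1 < p)]

theorem tendsto_zero_of_tendsto_norm_rpow {E : Type*} [NormedAddCommGroup E] {q : ℝ} (hq : 0 < q)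
    {u : ℕ → E} (h : Tendsto (fun n => ‖u n‖ ^ q) atTop (𝓝 0)) : Tendsto u atTop (𝓝 0) := by
  rw [tendsto_zero_iff_norm_tendsto_zero]
  have hroot := h.rpow_const (p := q⁻¹) (Or.inr (inv_nonneg.2 hq.le))
  rw [Real.zero_rpow (inv_ne_zero hq.ne')] at hroot
  exact hroot.congr fun n => Real.rpow_rpow_inv (norm_nonneg _) hq.ne'

theorem tendsto_zero_of_dominated {u : ℕ → Lp ℝ p μ} (w : Lp ℝ p μ)
    (hw : ∀ n, ∀ᵐ x ∂μ, |u n x| ≤ |w x|) (h : ∀ᵐ x ∂μ, Tendsto (fun n => u n x) atTop (𝓝 0)) :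
    Tendsto u atTop (𝓝 0) := by
  have hp0 : 0 < (p : ℝ) := zero_lt_one.trans (one_lt_coe (p := p))
  have hlim : Tendsto (fun n => ∫ x, |u n x| ^ (p : ℝ) ∂μ) atTop (𝓝 (∫ _, (0 : ℝ) ∂μ)) := by
    refine tendsto_integral_of_dominated_convergence (fun x => |w x| ^ (p : ℝ))
      (fun n => (integrable_rpow (u n)).aestronglyMeasurable) (integrable_rpow w) (fun n => ?_) ?_
    · filter_upwards [hw n] with x hx
      rw [Real.norm_of_nonneg (by positivity)]
      exact Real.rpow_le_rpow (abs_nonneg _) hx hp0.le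
    · filter_upwards [h] with x hx
      simpa [Real.zero_rpow hp0.ne'] using hx.abs.rpow_const (p := (p : ℝ)) (Or.inr hp0.le)
  refine tendsto_zero_of_tendsto_norm_rpow hp0 ?_
  simpa only [norm_rpow_eq, integral_zero] using hlim

theorem tendsto_zero_of_le_add {u e : ℕ → Lp ℝ p μ} {w : Lp ℝ p μ} (hu : ∀ n, 0 ≤ u n)
    (he : Tendsto e atTop (𝓝 0)) (hw : 0 ≤ w) (hle : ∀ n, u n ≤ e n + w)
    (h : ∀ᵐ x ∂μ, Tendsto (fun n => u n x) atTop (𝓝 0)) : Tendsto u atTop (𝓝 0) := by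
  have hinf : Tendsto (fun n => u n ⊓ w) atTop (𝓝 0) := by
    rw [← Lp.coeFn_nonneg] at hw
    have hinf (n : ℕ) := Lp.coeFn_inf (u n) w
    have hu (n : ℕ) := (Lp.coeFn_nonneg _).2 (hu n)
    refine tendsto_zero_of_dominated w (fun n => ?_) ?_
    · filter_upwards [hinf n, hu n, hw] with x hx hux hwx
      rw [hx, Pi.inf_apply, abs_of_nonneg (le_inf hux hwx)]
      exact inf_le_right.trans (le_abs_self _)
    · filter_upwards [ae_all_iff.2 hinf, ae_all_iff.2 hu, hw, h] with x hx hux hwx hlim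
      refine squeeze_zero (fun n => ?_) (fun n => ?_) hlim
      · rw [hx, Pi.inf_apply]
        exact le_inf (hux n) hwx
      · rw [hx, Pi.inf_apply]
        exact inf_le_left
  have hle' (n : ℕ) : u n ≤ |e n| + u n ⊓ w := by
    rw [add_inf]
    exact le_inf (le_add_of_nonneg_left (abs_nonneg _))
      ((hle n).trans (add_le_add (le_abs_self _) le_rfl))
  refine squeeze_zero_norm
    (fun n => (LpFunctional.norm_mono (hu n) (hle' n)).trans (norm_add_le _ _)) ?_
  simpa only [norm_abs_eq_norm, norm_zero, add_zero] using he.norm.add hinf.norm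

theorem eq_of_le_of_norm_le {u v : Lp ℝ p μ} (hu : 0 ≤ u) (h : u ≤ v) (hn : ‖v‖ ≤ ‖u‖) : u = v := by
  have hp0 : 0 < (p : ℝ) := zero_lt_one.trans (one_lt_coe (p := p))
  have hpow : ‖v‖ ^ (p : ℝ) ≤ ‖u‖ ^ (p : ℝ) := by gcongr
  have hsub : ‖v - u‖ ^ (p : ℝ) ≤ 0 := by linarith [norm_superadd hu h]
  have hzero := le_antisymm hsub (by positivity)
  rw [Real.rpow_eq_zero (norm_nonneg _) hp0.ne', norm_eq_zero, sub_eq_zero] at hzero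
  exact hzero.symm

theorem cauchySeq_of_monotone_of_bddAbove {u : ℕ → Lp ℝ p μ} (h0 : ∀ n, 0 ≤ u n)
    (hu : Monotone u) (hb : BddAbove (range fun n => ‖u n‖)) : CauchySeq u := by
  have hp0 : 0 < (p : ℝ) := zero_lt_one.trans (one_lt_coe (p := p))
  have hmono : Monotone fun n => ‖u n‖ := fun n m h => LpFunctional.norm_mono (h0 n) (hu h)
  have hpow : CauchySeq fun n => ‖u n‖ ^ (p : ℝ) :=
    ((tendsto_atTop_ciSup hmono hb).rpow_const (Or.inr hp0.le)).cauchySeq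
  refine rpow_cauchy fun η hη => ?_
  obtain ⟨N, hN⟩ := Metric.cauchySeq_iff.1 hpow η hη
  refine ⟨N, fun n k hn hk => ?_⟩
  have hdist := (abs_lt.1 (Real.dist_eq _ _ ▸ hN k (hn.trans hk) n hn)).2
  rw [norm_sub_rev]
  linarith [norm_superadd (h0 n) (hu hk)]

end Lebesgue

namespace LpFunctional

variable {M : Type*} [MeasurableSpace M] {μ : Measure M} {p : ℝ≥0} [Fact (1 < p)]
  {V : Type*} [AddCommGroup V] [Module ℝ V] (F : LpFunctional μ p V)

theorem tendsto_mul_chi {A : ℕ → Set M} (hA : ∀ n, MeasurableSet (A n))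
    (h : ∀ᵐ x ∂μ, ∀ᶠ n in atTop, x ∈ A n) (v : F.Mod) :
    Tendsto (fun n => F.mul (chi μ (A n) (hA n)) v) atTop (𝓝 v) := by
  have hcompl : ∀ n, v - F.mul (chi μ (A n) (hA n)) v = F.mul (chi μ (A n)ᶜ (hA n).compl) v :=
    fun n => sub_eq_iff_eq_add'.2 (F.mul_chi_add_compl (hA n) v).symm
  have hmul := fun n => F.coeFn_pnorm_mul_chi (hA n).compl v
  have hpnorm : Tendsto (fun n => F.pnorm (F.mul (chi μ (A n)ᶜ (hA n).compl) v)) atTop (𝓝 0) := by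
    refine tendsto_zero_of_dominated (F.pnorm v) (fun n => ?_) ?_
    · filter_upwards [hmul n] with x hx
      rw [hx, ← Real.norm_eq_abs, ← Real.norm_eq_abs]
      exact norm_indicator_le_norm_self _ x
    · filter_upwards [ae_all_iff.2 hmul, h] with x hx hxA
      refine tendsto_const_nhds.congr' ?_
      filter_upwards [hxA] with n hn
      rw [hx, indicator_of_notMem (notMem_compl_iff.2 hn)]
  rw [tendsto_iff_norm_sub_tendsto_zero]
  refine (tendsto_zero_iff_norm_tendsto_zero.1 hpnorm).congr fun n => ?_
  rw [norm_pnorm, ← hcompl, norm_sub_rev]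

section Glueing

theorem locality (v : F.Mod) {A : ℕ → Set M} (hA : ∀ n, MeasurableSet (A n))
    (h : ∀ n, F.mul (chi μ (A n) (hA n)) v = 0) :
    F.mul (chi μ (⋃ n, A n) (MeasurableSet.iUnion hA)) v = 0 := by
  simp only [mul_chi_eq_zero_iff, vanishingOn_iUnion, Submodule.mem_iInf] at h ⊢
  exact h

theorem mem_vanishingOn_biUnion {ι : Type*} [Countable ι] (A : ι → Set M) (I : Set ι)
    {v : F.Mod} : v ∈ F.vanishingOn (⋃ i ∈ I, A i) ↔ ∀ i ∈ I, v ∈ F.vanishingOn (A i) := by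
  rw [biUnion_eq_iUnion, vanishingOn_iUnion, Submodule.mem_iInf, Subtype.forall]

theorem mem_vanishingOn_union {A B : Set M} {v : F.Mod} :
    v ∈ F.vanishingOn (A ∪ B) ↔ v ∈ F.vanishingOn A ∧ v ∈ F.vanishingOn B := by
  rw [union_eq_iUnion, vanishingOn_iUnion, Submodule.mem_iInf, Bool.forall_bool, and_comm,
    cond_true, cond_false]

theorem pnorm_le_of_sModEq {A : Set M} {v w : F.Mod} (hA : v ≡ w [SMOD F.vanishingOn A])
    (hv : v ∈ F.vanishingOn Aᶜ) : F.pnorm v ≤ F.pnorm w := by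
  rw [← Lp.coeFn_le]
  filter_upwards [F.coeFn_pnorm_congr hA, F.mem_vanishingOn.1 hv, F.ae_pnorm_nonneg w]
    with x h1 h2 h3
  by_cases hx : x ∈ A
  · exact (h1 hx).le
  · exact (h2 hx).trans_le h3

theorem pnorm_sub_of_sModEq {A : Set M} {v w : F.Mod} (hA : v ≡ w [SMOD F.vanishingOn A])
    (hv : v ∈ F.vanishingOn Aᶜ) : F.pnorm (w - v) = F.pnorm w - F.pnorm v := by
  have hsub : w - v ≡ w [SMOD F.vanishingOn Aᶜ] := by
    rw [SModEq.sub_mem, sub_sub_cancel_left]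
    exact neg_mem hv
  refine Lp.ext ?_
  filter_upwards [F.coeFn_pnorm_congr hA, F.mem_vanishingOn.1 hv, F.coeFn_pnorm_congr hsub,
    F.mem_vanishingOn.1 (SModEq.sub_mem.1 hA.symm), Lp.coeFn_sub (F.pnorm w) (F.pnorm v)]
    with x h1 h2 h3 h4 h5
  rw [h5, Pi.sub_apply]
  by_cases hx : x ∈ A
  · rw [h4 hx, h1 hx, sub_self]
  · rw [h3 hx, h2 hx, sub_zero]

/-- `w` is the element that is `v i` on `A i` for `i ∈ I` and vanishes elsewhere. -/
structure IsGlueing {ι : Type*} (v : ι → F.Mod) (A : ι → Set M) (I : Set ι) (w : F.Mod) :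
    Prop where
  sModEq : ∀ i ∈ I, w ≡ v i [SMOD F.vanishingOn (A i)]
  vanishing : w ∈ F.vanishingOn (⋃ i ∈ I, A i)ᶜ

variable {F} {ι : Type*} {v : ι → F.Mod} {A : ι → Set M} {w w' : F.Mod}

theorem IsGlueing.sModEq_of_subset [Countable ι] {I J : Set ι} (h : F.IsGlueing v A I w)
    (h' : F.IsGlueing v A J w') (hIJ : I ⊆ J) : w ≡ w' [SMOD F.vanishingOn (⋃ i ∈ I, A i)] :=
  SModEq.sub_mem.2 <| (F.mem_vanishingOn_biUnion A I).2 fun i hi =>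
    SModEq.sub_mem.1 ((h.sModEq i hi).trans (h'.sModEq i (hIJ hi)).symm)

theorem IsGlueing.unique [Countable ι] {I : Set ι} (h : F.IsGlueing v A I w)
    (h' : F.IsGlueing v A I w') : w = w' := by
  have huniv : w - w' ∈ F.vanishingOn (⋃ i ∈ I, A i) ⊓ F.vanishingOn (⋃ i ∈ I, A i)ᶜ :=
    ⟨SModEq.sub_mem.1 (h.sModEq_of_subset h' subset_rfl), sub_mem h.vanishing h'.vanishing⟩
  rw [Submodule.mem_inf, ← mem_vanishingOn_union, union_compl_self, vanishingOn_univ,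
    Submodule.mem_bot, sub_eq_zero] at huniv
  exact huniv

theorem isGlueing_mul_chi (hA : ∀ i, MeasurableSet (A i)) (I : Set ι)
    (hI : MeasurableSet (⋃ i ∈ I, A i)) (v : F.Mod) :
    F.IsGlueing (fun i => F.mul (chi μ (A i) (hA i)) v) A I (F.mul (chi μ _ hI) v) where
  sModEq i hi := ((F.mul_chi_sModEq hI v).mono
    (F.vanishingOn_anti (subset_biUnion_of_mem hi))).trans (F.mul_chi_sModEq (hA i) v).symm
  vanishing := F.mul_chi_mem_vanishingOn hI disjoint_compl_right v

variable (F) in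
theorem sModEq_of_inter_of_sdiff {v w : F.Mod} {B U : Set M}
    (hin : v ≡ w [SMOD F.vanishingOn (B ∩ U)]) (hout : v ≡ w [SMOD F.vanishingOn (B \ U)]) :
    v ≡ w [SMOD F.vanishingOn B] := by
  rw [SModEq.sub_mem] at hin hout ⊢
  simpa only [inter_union_sdiff] using F.mem_vanishingOn_union.2 ⟨hin, hout⟩

theorem IsGlueing.sModEq_inter [Countable ι] {I : Set ι} (h : F.IsGlueing v A I w)
    (hv : ∀ i j, v i ≡ v j [SMOD F.vanishingOn (A i ∩ A j)]) (j : ι) :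
    w ≡ v j [SMOD F.vanishingOn (A j ∩ ⋃ i ∈ I, A i)] := by
  rw [inter_iUnion₂]
  refine SModEq.sub_mem.2 <| (F.mem_vanishingOn_biUnion _ I).2 fun i hi => SModEq.sub_mem.1 ?_
  rw [inter_comm]
  exact ((h.sModEq i hi).mono (F.vanishingOn_anti inter_subset_left)).trans (hv i j)

theorem IsGlueing.insert [Countable ι] {I : Set ι} (h : F.IsGlueing v A I w)
    (hA : ∀ i, MeasurableSet (A i))
    (hv : ∀ i j, v i ≡ v j [SMOD F.vanishingOn (A i ∩ A j)]) (j : ι) :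
    ∃ B, ∃ hB : MeasurableSet B,
      F.IsGlueing v A (insert j I) (w + F.mul (chi μ B hB) (v j)) := by
  set U := ⋃ i ∈ I, A i
  have hB : MeasurableSet (A j \ U) :=
    (hA j).diff (MeasurableSet.biUnion I.to_countable fun i _ => hA i)
  have hwU : w + F.mul (chi μ (A j \ U) hB) (v j) ≡ w [SMOD F.vanishingOn U] := by
    rw [SModEq.sub_mem, add_sub_cancel_left]
    exact F.mul_chi_mem_vanishingOn hB disjoint_sdiff_left (v j)
  refine ⟨_, hB, ?_, ?_⟩
  · rintro i (rfl | hi)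
    · refine F.sModEq_of_inter_of_sdiff (U := U) ?_ ?_
      · exact (hwU.mono (F.vanishingOn_anti inter_subset_right)).trans (h.sModEq_inter hv i)
      · have hw : w ≡ 0 [SMOD F.vanishingOn (A i \ U)] :=
          SModEq.zero.2 (F.vanishingOn_anti (fun _ hx => hx.2) h.vanishing)
        simpa only [zero_add] using hw.add (F.mul_chi_sModEq hB (v i))
    · exact (hwU.mono (F.vanishingOn_anti (subset_biUnion_of_mem hi))).trans (h.sModEq i hi)
  · rw [biUnion_insert]
    refine add_mem (F.vanishingOn_anti (compl_subset_compl.2 subset_union_right) h.vanishing)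
      (F.mul_chi_mem_vanishingOn hB ?_ (v j))
    exact disjoint_compl_right.mono_left (sdiff_subset.trans subset_union_left)

theorem exists_isGlueing [Countable ι] {N : Submodule ℝ F.Mod}
    (hmul : ∀ (a : Lp ℝ ∞ μ), ∀ v ∈ N, F.mul a v ∈ N) (hvN : ∀ i, v i ∈ N)
    (hA : ∀ i, MeasurableSet (A i))
    (hv : ∀ i j, v i ≡ v j [SMOD F.vanishingOn (A i ∩ A j)]) (I : Finset ι) :
    ∃ w ∈ N, F.IsGlueing v A I w := by
  classical
  induction I using Finset.induction_on with
  | empty => exact ⟨0, N.zero_mem, by simp, Submodule.zero_mem _⟩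
  | insert j I _ ih =>
    obtain ⟨w, hwN, hw⟩ := ih
    obtain ⟨B, hB, h⟩ := hw.insert hA hv j
    exact ⟨_, N.add_mem hwN (hmul _ _ (hvN j)), by rwa [Finset.coe_insert]⟩

theorem cauchySeq_of_isGlueing [Countable ι] {I : ℕ → Set ι} (hI : Monotone I) {w : ℕ → F.Mod}
    (hw : ∀ n, F.IsGlueing v A (I n) (w n)) (hb : BddAbove (range fun n => ‖w n‖)) :
    CauchySeq w := by
  have heq : ∀ n m, n ≤ m → w n ≡ w m [SMOD F.vanishingOn (⋃ i ∈ I n, A i)] :=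
    fun n m h => (hw n).sModEq_of_subset (hw m) (hI h)
  have hpnorm : CauchySeq fun n => F.pnorm (w n) := by
    refine cauchySeq_of_monotone_of_bddAbove (fun n => F.pnorm_nonneg _)
      (fun n m h => F.pnorm_le_of_sModEq (heq n m h) (hw n).vanishing) ?_
    simpa only [norm_pnorm] using hb
  rw [Metric.cauchySeq_iff'] at hpnorm ⊢
  intro ε hε
  obtain ⟨n, hn⟩ := hpnorm ε hε
  refine ⟨n, fun m hm => ?_⟩
  have := hn m hm
  rwa [dist_eq_norm, ← F.pnorm_sub_of_sModEq (heq n m hm) (hw n).vanishing, norm_pnorm,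
    ← dist_eq_norm] at this

variable (F) in
theorem sum_mul (I : Finset ι) (a : ι → Lp ℝ ∞ μ) (v : F.Mod) :
    ∑ i ∈ I, F.mul (a i) v = F.mul (∑ i ∈ I, a i) v := by
  let mulHom : Lp ℝ ∞ μ →+ F.Mod := AddMonoidHom.mk' (fun a => F.mul a v) fun a b => F.add_mul a b v
  exact (map_sum mulHom a I).symm

theorem chi_nonneg {A : Set M} (hA : MeasurableSet A) : 0 ≤ chi μ A hA := by
  rw [← Lp.coeFn_nonneg]
  filter_upwards [coeFn_chi (μ := μ) A hA] with x hx
  rw [hx]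
  exact indicator_nonneg (fun _ _ => zero_le_one) x

theorem IsGlueing.norm_le_norm_sum [Countable ι] {I : Finset ι} (h : F.IsGlueing v A I w)
    (hA : ∀ i, MeasurableSet (A i)) : ‖w‖ ≤ ‖∑ i ∈ I, F.mul (chi μ (A i) (hA i)) (v i)‖ := by
  set a : Lp ℝ ∞ μ := ∑ i ∈ I, chi μ (A i) (hA i)
  have hsum : ∑ i ∈ I, F.mul (chi μ (A i) (hA i)) (v i) = F.mul a w := by
    rw [← sum_mul]
    exact Finset.sum_congr rfl fun i hi =>
      (F.mul_chi_eq_mul_chi_iff (hA i)).2 (h.sModEq i hi).symm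
  have ha : ∀ᵐ x ∂μ, ∀ i, i ∈ I → x ∈ A i → 1 ≤ a x := by
    refine ae_all_iff.2 fun i => ?_
    by_cases hi : i ∈ I
    · have hle : chi μ (A i) (hA i) ≤ a :=
        Finset.single_le_sum (f := fun i => chi μ (A i) (hA i)) (fun i _ => chi_nonneg (hA i)) hi
      filter_upwards [(Lp.coeFn_le _ _).2 hle, coeFn_chi (μ := μ) (A i) (hA i)] with x h1 h2 _ hx
      rwa [h2, indicator_of_mem hx] at h1
    · exact ae_of_all _ fun x hi' => absurd hi' hi
  rw [hsum, ← F.norm_pnorm (F.mul a w)]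
  refine F.norm_le_of_pnorm_le ((Lp.coeFn_le _ _).1 ?_)
  filter_upwards [ha, F.coeFn_pnorm_mul a w, F.ae_pnorm_nonneg w,
    F.mem_vanishingOn.1 h.vanishing] with x h1 h2 h3 h4
  rw [h2]
  by_cases hx : x ∈ ⋃ i ∈ (I : Set ι), A i
  · obtain ⟨i, hi, hxi⟩ := mem_iUnion₂.1 hx
    exact le_mul_of_one_le_left h3 ((h1 i hi hxi).trans (le_abs_self _))
  · rw [h4 hx, mul_zero]

theorem glueing {N : Submodule ℝ F.Mod} (hN : IsClosed (N : Set F.Mod))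
    (hmul : ∀ (a : Lp ℝ ∞ μ), ∀ v ∈ N, F.mul a v ∈ N) {v : ℕ → F.Mod} (hvN : ∀ n, v n ∈ N)
    {A : ℕ → Set M} (hA : ∀ n, MeasurableSet (A n))
    (hv : ∀ i j, v i ≡ v j [SMOD F.vanishingOn (A i ∩ A j)])
    (hb : BddAbove (range fun n => ‖∑ i ∈ Finset.range n, F.mul (chi μ (A i) (hA i)) (v i)‖)) :
    ∃ w ∈ N, (∀ i, F.mul (chi μ (A i) (hA i)) w = F.mul (chi μ (A i) (hA i)) (v i)) ∧
      ‖w‖ ≤ liminf (fun n => ‖∑ i ∈ Finset.range n, F.mul (chi μ (A i) (hA i)) (v i)‖) atTop := by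
  choose w hwN hw using fun n => exists_isGlueing hmul hvN hA hv (Finset.range n)
  have hwS := fun n => (hw n).norm_le_norm_sum hA
  obtain ⟨C, hC⟩ := hb
  have hmono : Monotone fun n => (Finset.range n : Set ℕ) := fun n m h =>
    Finset.coe_subset.2 (Finset.range_mono h)
  obtain ⟨w₀, hw₀⟩ := cauchySeq_tendsto_of_complete <| cauchySeq_of_isGlueing hmono hw
    ⟨C, forall_mem_range.2 fun n => (hwS n).trans (hC ⟨n, rfl⟩)⟩
  refine ⟨w₀, hN.mem_of_tendsto hw₀ (Eventually.of_forall hwN), fun i => ?_, ?_⟩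
  · refine tendsto_nhds_unique (((F.mul (chi μ (A i) (hA i))).continuous.tendsto w₀).comp hw₀)
      (tendsto_const_nhds.congr' ?_)
    filter_upwards [eventually_gt_atTop i] with n hn
    exact (F.mul_chi_eq_mul_chi_iff (hA i)).2 ((hw n).sModEq i (by simpa using hn)).symm
  · rw [← hw₀.norm.liminf_eq]
    exact liminf_le_liminf (Eventually.of_forall hwS) hw₀.norm.isBoundedUnder_ge
      (IsBoundedUnder.isCoboundedUnder_ge
        ⟨C, eventually_map.2 (Eventually.of_forall fun n => hC ⟨n, rfl⟩)⟩)

theorem isLpNormedSubmodule {N : Submodule ℝ F.Mod} (hN : IsClosed (N : Set F.Mod))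
    (hmul : ∀ (a : Lp ℝ ∞ μ), ∀ v ∈ N, F.mul a v ∈ N) : F.IsLpNormedSubmodule N where
  isClosed := hN
  mul_mem := hmul
  locality v _ _ hA h := F.locality v hA h
  glueing _ hvN _ hA hv hb :=
    glueing hN hmul hvN hA (fun i j => (F.mul_chi_eq_mul_chi_iff _).1 (hv i j)) hb

theorem mem_of_forall_mul_chi_mem {N : Submodule ℝ F.Mod} (hN : IsClosed (N : Set F.Mod))
    (hmul : ∀ (a : Lp ℝ ∞ μ), ∀ v ∈ N, F.mul a v ∈ N) {A : ℕ → Set M}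
    (hA : ∀ n, MeasurableSet (A n)) (hcover : ⋃ n, A n = univ) {v : F.Mod}
    (h : ∀ n, F.mul (chi μ (A n) (hA n)) v ∈ N) : v ∈ N := by
  have hU : ∀ n, MeasurableSet (⋃ i ∈ (Finset.range n : Set ℕ), A i) := fun n =>
    MeasurableSet.biUnion (to_countable _) fun i _ => hA i
  have hmem : ∀ n, F.mul (chi μ _ (hU n)) v ∈ N := fun n => by
    have hcompat := fun i j =>
      ((F.mul_chi_sModEq (hA i) v).mono (F.vanishingOn_anti inter_subset_left)).trans
        ((F.mul_chi_sModEq (hA j) v).mono (F.vanishingOn_anti inter_subset_right)).symm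
    obtain ⟨w, hwN, hw⟩ := exists_isGlueing hmul h hA hcompat (Finset.range n)
    rwa [(isGlueing_mul_chi hA _ (hU n) v).unique hw]
  refine hN.mem_of_tendsto (F.tendsto_mul_chi hU (ae_of_all _ fun x => ?_) v)
    (Eventually.of_forall hmem)
  obtain ⟨i, hi⟩ := mem_iUnion.1 (hcover.symm ▸ mem_univ x)
  filter_upwards [eventually_gt_atTop i] with n hn
  exact mem_biUnion (Finset.mem_coe.2 (Finset.mem_range.2 hn)) hi

theorem eq_top_of_d_mem {N : Submodule ℝ F.Mod} (hN : IsClosed (N : Set F.Mod))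
    (hmul : ∀ (a : Lp ℝ ∞ μ), ∀ v ∈ N, F.mul a v ∈ N) (h : ∀ f, F.d f ∈ N) : N = ⊤ := by
  refine eq_top_iff.2 fun v _ => ?_
  obtain ⟨s, hs⟩ := F.exists_seq_pfm v
  refine hN.mem_of_tendsto hs (Eventually.of_forall fun n => ?_)
  obtain ⟨f, hf⟩ := ((s n).isPiecewiseConst.1.insert 0).exists_eq_range (insert_nonempty _ _)
  refine mem_of_forall_mul_chi_mem hN hmul (A := fun i => (s n).fn ⁻¹' {f i})
    (fun i => (s n).isPiecewiseConst.2 (f i)) (eq_univ_of_forall fun x => ?_) fun i => ?_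
  · obtain ⟨i, hi⟩ : (s n).fn x ∈ range f := hf ▸ mem_insert_of_mem _ (mem_range_self x)
    exact mem_iUnion.2 ⟨i, hi.symm⟩
  · rw [(F.mul_chi_eq_mul_chi_iff _).2 (F.coe_sModEq_d (s n) (f i))]
    exact hmul _ _ (h (f i))

end Glueing

section ZeroModule

theorem mul_mem_zeroModule (a : Lp ℝ ∞ μ) {v : F.Mod} (hv : v ∈ F.zeroModule) :
    F.mul a v ∈ F.zeroModule := by
  refine map_mem_closure (F.mul a).continuous hv fun u hu => ?_
  induction hu using Submodule.span_induction with
  | mem x hx =>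
    obtain ⟨b, ω, hω, rfl⟩ := hx
    exact Submodule.subset_span ⟨a • b, ω, hω, (F.mul_smul a b ω).symm⟩
  | zero => rw [map_zero]; exact Submodule.zero_mem _
  | add x y _ _ hx hy => rw [map_add]; exact Submodule.add_mem _ hx hy
  | smul r x _ hx => rw [map_smul]; exact Submodule.smul_mem _ r hx

theorem zeroSet_subset_zeroModule : F.zeroSet ⊆ F.zeroModule := fun ω hω =>
  Submodule.le_topologicalClosure _ (Submodule.subset_span ⟨_, ω, hω, (F.mul_chi_univ ω).symm⟩)

theorem isClosed_zeroModule : IsClosed (F.zeroModule : Set F.Mod) :=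
  Submodule.isClosed_topologicalClosure _

theorem zeroModule_le {N : Submodule ℝ F.Mod} (hN : IsClosed (N : Set F.Mod))
    (hmul : ∀ (a : Lp ℝ ∞ μ), ∀ v ∈ N, F.mul a v ∈ N) (h : F.zeroSet ⊆ N) : F.zeroModule ≤ N := by
  refine Submodule.topologicalClosure_minimal _ (Submodule.span_le.2 ?_) hN
  rintro _ ⟨a, ω, hω, rfl⟩
  exact hmul a ω (h hω)

end ZeroModule

end LpFunctional

section Weak

variable {E : Type*} [NormedAddCommGroup E] [NormedSpace ℝ E]

theorem TendstoWeakly.map {E' : Type*} [NormedAddCommGroup E'] [NormedSpace ℝ E'] {u : ℕ → E}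
    {a : E} (h : TendstoWeakly u a) (T : E →L[ℝ] E') : TendstoWeakly (fun n => T (u n)) (T a) :=
  fun φ => h (φ.comp T)

theorem TendstoWeakly.prodMk {E' : Type*} [NormedAddCommGroup E'] [NormedSpace ℝ E'] {u : ℕ → E}
    {a : E} {v : ℕ → E'} {b : E'} (hu : TendstoWeakly u a) (hv : TendstoWeakly v b) :
    TendstoWeakly (fun n => (u n, v n)) (a, b) := by
  have := (hu.map (ContinuousLinearMap.inl ℝ E E')).add (hv.map (ContinuousLinearMap.inr ℝ E E'))
  simpa using this

theorem TendstoWeakly.mem_of_convex {u : ℕ → E} {a : E} (h : TendstoWeakly u a) {K : Set E}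
    (hK : Convex ℝ K) (hK' : IsClosed K) (hu : ∀ᶠ n in atTop, u n ∈ K) : a ∈ K := by
  by_contra ha
  obtain ⟨φ, r, hKr, har⟩ := geometric_hahn_banach_closed_point hK hK' ha
  exact absurd (le_of_tendsto (h φ) (hu.mono fun n hn => (hKr _ hn).le)) (not_le.2 har)

end Weak

theorem smul_mono_of_nonneg {M : Type*} [MeasurableSpace M] {μ : Measure M} {p : ℝ≥0}
    [Fact (1 < p)] {r : ℝ} (hr : 0 ≤ r) {u v : Lp ℝ p μ} (h : u ≤ v) : r • u ≤ r • v := by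
  rw [← sub_nonneg, ← smul_sub]
  exact smul_nonneg' hr (sub_nonneg.2 h)

namespace LpFunctional

section Relaxation

variable {M : Type*} [MeasurableSpace M] {μ : Measure M} {p : ℝ≥0} [Fact (1 < p)]
  {V : Type*} [AddCommGroup V] [Module ℝ V] (F : LpFunctional μ p V)

theorem pnorm_le_of_tendstoWeakly {v : ℕ → F.Mod} {ω : F.Mod} {c : ℕ → Lp ℝ p μ} {a : Lp ℝ p μ}
    (hv : TendstoWeakly v ω) (hc : TendstoWeakly c a) (h : ∀ n, F.pnorm (v n) ≤ c n) :
    F.pnorm ω ≤ a := by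
  refine (hv.prodMk hc).mem_of_convex (K := {q : F.Mod × Lp ℝ p μ | F.pnorm q.1 ≤ q.2}) ?_ ?_
    (Eventually.of_forall h)
  · intro x hx y hy s t hs ht _
    refine (F.pnorm_add_le _ _).trans (add_le_add ?_ ?_)
    · rw [Prod.smul_fst, pnorm_smul, abs_of_nonneg hs]
      exact smul_mono_of_nonneg hs hx
    · rw [Prod.smul_fst, pnorm_smul, abs_of_nonneg ht]
      exact smul_mono_of_nonneg ht hy
  · exact isClosed_le (F.continuous_pnorm.comp continuous_fst) continuous_snd

theorem exists_tendsto_d {f : ℕ → V} {g : M →ₘ[μ] ℝ} {ω : F.Mod} (hf : F.TendstoAE f g)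
    (hω : TendstoWeakly (fun n => F.d (f n)) ω) :
    ∃ z : ℕ → V, F.TendstoAE z g ∧ Tendsto (fun n => F.d (z n)) atTop (𝓝 ω) := by
  have happrox : ∀ n : ℕ, ∃ z ∈ convexHull ℝ (f '' Ici n),
      ‖F.d z - ω‖ < 1 / ((n : ℝ) + 1) := fun n => by
    have hmem : ω ∈ closure (convexHull ℝ (F.d '' (f '' Ici n))) := by
      refine hω.mem_of_convex (convex_convexHull ℝ _).closure isClosed_closure ?_
      filter_upwards [eventually_ge_atTop n] with k hk
      exact subset_closure (subset_convexHull ℝ _ ⟨f k, ⟨k, hk, rfl⟩, rfl⟩)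
    rw [← LinearMap.image_convexHull] at hmem
    obtain ⟨_, ⟨z, hz, rfl⟩, h⟩ :=
      Metric.mem_closure_iff.1 hmem (1 / ((n : ℝ) + 1)) (by positivity)
    exact ⟨z, hz, by rwa [dist_comm, dist_eq_norm] at h⟩
  choose z hz hz' using happrox
  refine ⟨z, TendstoAE.convex F (w := fun n => (f n, 0)) hf (z := fun n => (z n, 0))
    fun n => ?_, ?_⟩
  · have hpair := mem_image_of_mem (LinearMap.inl ℝ V (Lp ℝ p μ)) (hz n)
    rw [LinearMap.image_convexHull, image_image] at hpair
    exact hpair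
  · rw [tendsto_iff_norm_sub_tendsto_zero]
    exact squeeze_zero (fun n => norm_nonneg _) (fun n => (hz' n).le)
      tendsto_one_div_add_atTop_nhds_zero_nat

theorem TendstoAE.sub {f h : ℕ → V} {g k : M →ₘ[μ] ℝ} (hf : F.TendstoAE f g)
    (hh : F.TendstoAE h k) : F.TendstoAE (fun n => f n - h n) (g - k) := by
  simpa only [sub_eq_add_neg, neg_one_smul] using hf.add F (hh.const_smul F (-1))

theorem TendstoAE.subseq {f : ℕ → V} {g : M →ₘ[μ] ℝ} (h : F.TendstoAE f g) {φ : ℕ → ℕ}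
    (hφ : StrictMono φ) : F.TendstoAE (fun n => f (φ n)) g := by
  filter_upwards [h] with x hx using hx.comp hφ.tendsto_atTop

theorem sub_mem_zeroSet {f h : ℕ → V} {g : M →ₘ[μ] ℝ} {ω η : F.Mod} (hf : F.TendstoAE f g)
    (hω : Tendsto (fun n => F.d (f n)) atTop (𝓝 ω)) (hh : F.TendstoAE h g)
    (hη : Tendsto (fun n => F.d (h n)) atTop (𝓝 η)) : ω - η ∈ F.zeroSet :=
  ⟨fun n => f n - h n, TendstoL0.of_ae (sub_self g ▸ hf.sub F hh), by
    simpa only [map_sub] using hω.sub hη⟩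

theorem WeaklyReflexive.exists_tendstoWeakly (hF : F.WeaklyReflexive) {f : ℕ → V} {g : M →ₘ[μ] ℝ}
    (hf : F.TendstoAE f g) {C : ℝ} (hC : ∀ n, ‖F.val (f n)‖ ≤ C) :
    ∃ (φ : ℕ → ℕ) (ω : F.Mod), StrictMono φ ∧ TendstoWeakly (fun n => F.d (f (φ n))) ω :=
  hF f g (TendstoL0.of_ae hf) ⟨C, by
    rintro _ ⟨n, rfl⟩
    exact (F.norm_d _).trans_le (hC n)⟩

variable [SigmaFinite μ]

theorem relaxed_val_le {f : ℕ → V} {g : F.relaxedDomain} {G : Lp ℝ p μ} (hf : F.TendstoAE f g)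
    (hG : TendstoWeakly (fun n => F.val (f n)) G) : F.relaxed.val g ≤ G :=
  F.mem_lowerSet_iff.1 (F.isGreatest_lowerRelaxation g).1 f G hf hG

theorem relaxed_val_toRelaxed_le (f : V) : F.relaxed.val (F.toRelaxed f) ≤ F.val f :=
  F.relaxed_val_le (f := fun _ => f) (F.tendstoAE_const f) tendsto_const_nhds.tendstoWeakly

theorem ae_eval_toRelaxed_le {s : M → V} (hs : IsPiecewiseConst s) :
    ∀ᵐ x ∂μ, F.relaxed.eval (fun x => F.toRelaxed (s x)) x ≤ F.eval s x :=
  ae_eval hs (P := fun v x => F.relaxed.val (F.toRelaxed v) x ≤ F.val v x) fun v =>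
    (Lp.coeFn_le _ _).2 (F.relaxed_val_toRelaxed_le v)

theorem isPiecewiseConst_toRelaxed {s : M → V} (hs : IsPiecewiseConst s) :
    IsPiecewiseConst fun x => F.toRelaxed (s x) :=
  hs.map₂ (fun v _ => F.toRelaxed v) hs

/-- The family `(f_i, A_i)` read as a pre-form of the relaxed functional. -/
noncomputable def relaxPfmFun (s : F.Pfm) : F.relaxed.Pfm :=
  F.relaxed.mkPfm (fun x => F.toRelaxed (s.fn x)) (F.isPiecewiseConst_toRelaxed s.isPiecewiseConst)
    (s.memLp.mono (F.relaxed.measurable_eval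
      (F.isPiecewiseConst_toRelaxed s.isPiecewiseConst)).aestronglyMeasurable (by
      filter_upwards [F.ae_eval_toRelaxed_le s.isPiecewiseConst,
        F.relaxed.ae_eval_nonneg (F.isPiecewiseConst_toRelaxed s.isPiecewiseConst)] with x h1 h2
      rw [Real.norm_of_nonneg h2]
      exact h1.trans (le_abs_self _)))

theorem pnorm_relaxPfmFun_le (s : F.Pfm) : (F.relaxPfmFun s).pnorm ≤ s.pnorm := by
  rw [← Lp.coeFn_le]
  filter_upwards [(F.relaxPfmFun s).coeFn_pnorm, s.coeFn_pnorm,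
    F.ae_eval_toRelaxed_le s.isPiecewiseConst] with x h1 h2 h3
  rw [h1, h2]
  exact h3

/-- `relaxPfmFun` as a continuous linear map, ready to be extended to the completions. -/
noncomputable def relaxPfm : F.Pfm →L[ℝ] F.relaxed.Pfm :=
  LinearMap.mkContinuous
    { toFun := F.relaxPfmFun
      map_add' := fun s t => Subtype.ext (funext fun x => map_add F.toRelaxed (s.fn x) (t.fn x))
      map_smul' := fun r s => Subtype.ext (funext fun x => map_smul F.toRelaxed r (s.fn x)) }
    1 (fun s => by
      rw [one_mul]
      exact norm_mono (Pfm.pnorm_nonneg _) (F.pnorm_relaxPfmFun_le s))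

/-- The canonical map, from the module generated by `F` to the module generated by its
relaxation, that sends `d f` to `d f`. -/
noncomputable def relaxMap : F.Mod →L[ℝ] F.relaxed.Mod := F.relaxPfm.completion

theorem relaxMap_coe (s : F.Pfm) : F.relaxMap (s : F.Mod) = (F.relaxPfmFun s : F.relaxed.Pfm) :=
  ContinuousLinearMap.completion_apply_coe _ _

theorem relaxMap_d (f : V) : F.relaxMap (F.d f) = F.relaxed.d (F.toRelaxed f) :=
  F.relaxMap_coe _

theorem relaxMap_mul (a : Lp ℝ ∞ μ) (v : F.Mod) :
    F.relaxMap (F.mul a v) = F.relaxed.mul a (F.relaxMap v) := by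
  have hcomm : ∀ n, F.relaxMap.comp (F.mulApprox a n) = (F.relaxed.mulApprox a n).comp F.relaxMap :=
    fun n => by
      refine F.hom_ext_coe fun s => ?_
      rw [ContinuousLinearMap.comp_apply, ContinuousLinearMap.comp_apply, mulApprox_eq_pcMul,
        mulApprox_eq_pcMul, pcMul_coe, relaxMap_coe, relaxMap_coe, pcMul_coe]
      congr 1
      exact Subtype.ext (funext fun x => map_smul F.toRelaxed (quant n a x) (s.fn x))
  refine tendsto_nhds_unique
    ((F.relaxMap.continuous.tendsto _).comp (F.tendsto_mulApprox_apply a v))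
    ((F.relaxed.tendsto_mulApprox_apply a (F.relaxMap v)).congr fun n => ?_)
  exact (DFunLike.congr_fun (hcomm n) v).symm

theorem pnorm_relaxMap_le (v : F.Mod) : F.relaxed.pnorm (F.relaxMap v) ≤ F.pnorm v := by
  induction v using UniformSpace.Completion.induction_on with
  | hp =>
    exact isClosed_le (F.relaxed.continuous_pnorm.comp F.relaxMap.continuous) F.continuous_pnorm
  | ih s =>
    rw [relaxMap_coe, pnorm_coe, pnorm_coe]
    exact F.pnorm_relaxPfmFun_le s

theorem relaxMap_eq_of_tendsto {f : ℕ → V} {g : F.relaxedDomain} {ω : F.Mod}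
    (hf : F.TendstoAE f g) (hω : Tendsto (fun n => F.d (f n)) atTop (𝓝 ω)) :
    F.relaxMap ω = F.relaxed.d g := by
  refine tendsto_nhds_unique ((F.relaxMap.continuous.tendsto ω).comp hω) ?_
  have hval : ∀ n, F.relaxed.val (F.toRelaxed (f n) - g) ≤ F.pnorm (F.d (f n) - ω) := fun n => by
    refine F.relaxed_val_le (f := fun m => f n - f m) ?_ ?_
    · exact (F.tendstoAE_const (f n)).sub F hf
    · have h := (F.continuous_pnorm.tendsto _).comp ((tendsto_const_nhds (x := F.d (f n))).sub hω)
      refine (h.congr fun m => ?_).tendstoWeakly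
      rw [Function.comp_apply, ← map_sub, pnorm_d]
  rw [tendsto_iff_norm_sub_tendsto_zero] at hω ⊢
  refine squeeze_zero (fun n => norm_nonneg _) (fun n => ?_) hω
  rw [Function.comp_apply, relaxMap_d, ← map_sub, norm_d, ← F.norm_pnorm (F.d (f n) - ω)]
  exact norm_mono (F.relaxed.nonneg' _) (hval n)

theorem zeroModule_le_ker_relaxMap : F.zeroModule ≤ LinearMap.ker F.relaxMap.toLinearMap := by
  refine F.zeroModule_le F.relaxMap.isClosed_ker (fun a v hv => ?_) ?_
  · change F.relaxMap v = 0 at hv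
    change F.relaxMap (F.mul a v) = 0
    rw [relaxMap_mul, hv, map_zero]
  · rintro ω ⟨f, hf, hω⟩
    obtain ⟨φ, hφ, h⟩ := hf.exists_subseq_ae
    have := F.relaxMap_eq_of_tendsto (f := fun n => f (φ n)) (g := 0) h
      (hω.comp hφ.tendsto_atTop)
    rw [map_zero] at this
    exact this

theorem relaxMap_add_zeroModule (v : F.Mod) {w : F.Mod} (hw : w ∈ F.zeroModule) :
    F.relaxMap (v + w) = F.relaxMap v := by
  have : F.relaxMap w = 0 := F.zeroModule_le_ker_relaxMap hw
  rw [map_add, this, add_zero]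

theorem le_relaxed_val (hF : F.WeaklyReflexive) (f : V) {H : Lp ℝ p μ}
    (hH : ∀ w ∈ F.zeroModule, H ≤ F.pnorm (F.d f + w)) : H ≤ F.relaxed.val (F.toRelaxed f) := by
  refine (F.isGreatest_lowerRelaxation (F.toRelaxed f)).2 (F.mem_lowerSet_iff.2 fun h G hh hG => ?_)
  obtain ⟨C, hC⟩ := hG.bounded
  obtain ⟨φ, ω, hφ, hω⟩ := hF.exists_tendstoWeakly F hh hC
  obtain ⟨z, hz, hzω⟩ := F.exists_tendsto_d (hh.subseq F hφ) hω
  have hHω : H ≤ F.pnorm ω := by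
    simpa only [add_sub_cancel] using hH _ (F.zeroSet_subset_zeroModule
      (F.sub_mem_zeroSet hz hzω (F.tendstoAE_const f) tendsto_const_nhds))
  exact hHω.trans (F.pnorm_le_of_tendstoWeakly hω (hG.subseq hφ) fun n => (F.pnorm_d _).le)

/-- The two sides only have to be compared on the pieces of the partition, and there `s` is a
single differential; a lower bound is localised by cutting it off outside the piece. -/
theorem le_pnorm_relaxMap_coe (hF : F.WeaklyReflexive) (s : F.Pfm) {H : Lp ℝ p μ}
    (hH : ∀ w ∈ F.zeroModule, H ≤ F.pnorm ((s : F.Mod) + w)) :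
    H ≤ F.relaxed.pnorm (F.relaxMap (s : F.Mod)) := by
  have le_on_piece (v : V) : ∀ᵐ x ∂μ, s.fn x = v → H x ≤ F.relaxed.val (F.toRelaxed v) x := by
    let H' : Lp ℝ p μ := ((Lp.memLp H).indicator (s.isPiecewiseConst.2 v)).toLp _
    have hH' : H' =ᵐ[μ] (s.fn ⁻¹' {v}).indicator H := MemLp.coeFn_toLp _
    have hle : H' ≤ F.relaxed.val (F.toRelaxed v) := by
      refine F.le_relaxed_val hF v fun w hw => ?_
      rw [← Lp.coeFn_le]
      filter_upwards [hH', F.coeFn_pnorm_congr ((F.coe_sModEq_d s v).add (SModEq.refl w)),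
        (Lp.coeFn_le _ _).2 (hH w hw), F.ae_pnorm_nonneg (F.d v + w)] with x hx hcongr hle hnonneg
      rw [hx]
      exact indicator_apply_le' (fun hxv => hle.trans_eq (hcongr hxv)) fun _ => hnonneg
    filter_upwards [hH', (Lp.coeFn_le _ _).2 hle] with x hx hle' hxv
    rwa [hx, indicator_of_mem (show x ∈ s.fn ⁻¹' {v} from hxv)] at hle'
  rw [relaxMap_coe, pnorm_coe, ← Lp.coeFn_le]
  filter_upwards [ae_eval s.isPiecewiseConst le_on_piece, (F.relaxPfmFun s).coeFn_pnorm]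
    with x hle hx
  rw [hx]
  exact hle rfl

theorem isGLB_pnorm_relaxMap (hF : F.WeaklyReflexive) (v : F.Mod) :
    IsGLB (range fun w : F.zeroModule => F.pnorm (v + w)) (F.relaxed.pnorm (F.relaxMap v)) := by
  constructor
  · rintro _ ⟨w, rfl⟩
    change _ ≤ F.pnorm (v + w)
    rw [← F.relaxMap_add_zeroModule v w.2]
    exact F.pnorm_relaxMap_le _
  · intro H hH
    obtain ⟨s, hs⟩ := F.exists_seq_pfm v
    have hle : ∀ n,
        H ≤ F.relaxed.pnorm (F.relaxMap (s n : F.Mod)) + F.pnorm (v - s n) := fun n => by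
      rw [← sub_le_iff_le_add]
      refine F.le_pnorm_relaxMap_coe hF (s n) fun w hw => ?_
      rw [sub_le_iff_le_add]
      refine (hH ⟨⟨w, hw⟩, rfl⟩).trans ?_
      have := F.pnorm_le_add_sub (v + w) (s n + w)
      rwa [add_sub_add_right_eq_sub] at this
    have hlim : Tendsto (fun n => F.relaxed.pnorm (F.relaxMap (s n : F.Mod)) + F.pnorm (v - s n))
        atTop (𝓝 (F.relaxed.pnorm (F.relaxMap v) + F.pnorm (v - v))) :=
      (((F.relaxed.continuous_pnorm.comp F.relaxMap.continuous).tendsto v).comp hs).add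
        ((F.continuous_pnorm.tendsto _).comp (tendsto_const_nhds.sub hs))
    rw [sub_self, pnorm_zero, add_zero] at hlim
    exact ge_of_tendsto' hlim hle

end Relaxation

section Quotient

variable {M : Type*} [MeasurableSpace M] {μ : Measure M} {p : ℝ≥0} [Fact (1 < p)]
  {V : Type*} [AddCommGroup V] [Module ℝ V] (F : LpFunctional μ p V)

section Coset

variable {N : Submodule ℝ F.Mod} (hN : ∀ (a : Lp ℝ ∞ μ), ∀ v ∈ N, F.mul a v ∈ N)
include hN

/-- Switch from `w` to `v` on the set where `|v| < |w|`. -/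
theorem exists_sModEq_pnorm_eq_inf {v w : F.Mod} (h : v ≡ w [SMOD N]) :
    ∃ z, z ≡ w [SMOD N] ∧ F.pnorm z = F.pnorm v ⊓ F.pnorm w := by
  let A : Set M := {x | F.pnorm v x < F.pnorm w x}
  have hA : MeasurableSet A :=
    measurableSet_lt (Lp.stronglyMeasurable _).measurable (Lp.stronglyMeasurable _).measurable
  let z := F.mul (chi μ A hA) (v - w) + w
  have z_eq_v : z ≡ v [SMOD F.vanishingOn A] := by
    simpa only [sub_add_cancel] using (F.mul_chi_sModEq hA (v - w)).add (SModEq.refl w)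
  have z_eq_w : z ≡ w [SMOD F.vanishingOn Aᶜ] := SModEq.sub_mem.2 <| by
    simpa only [z, add_sub_cancel_right] using
      F.mul_chi_mem_vanishingOn hA disjoint_compl_right (v - w)
  refine ⟨z, SModEq.sub_mem.2 ?_, Lp.ext ?_⟩
  · simpa only [z, add_sub_cancel_right] using hN _ _ (SModEq.sub_mem.1 h)
  · filter_upwards [F.coeFn_pnorm_congr z_eq_v, F.coeFn_pnorm_congr z_eq_w,
      Lp.coeFn_inf (F.pnorm v) (F.pnorm w)] with x hv hw hinf
    rw [hinf, Pi.inf_apply]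
    rcases lt_or_ge (F.pnorm v x) (F.pnorm w x) with hx | hx
    · rw [hv hx, inf_eq_left.2 hx.le]
    · rw [hw hx.not_gt, inf_eq_right.2 hx]

omit hN in
theorem exists_tendsto_pnorm_norm_eq_norm_mk (N : Submodule ℝ F.Mod) (v : F.Mod) :
    ∃ (z : ℕ → F.Mod) (U : Lp ℝ p μ), (∀ n, z n ≡ v [SMOD N]) ∧
      Tendsto (fun n => F.pnorm (z n)) atTop (𝓝 U) ∧
      ‖U‖ = ‖(Submodule.Quotient.mk v : F.Mod ⧸ N)‖ := by
  set m := ‖(Submodule.Quotient.mk v : F.Mod ⧸ N)‖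
  let A (n : ℕ) : Set F.Mod :=
    Metric.closedBall 0 (m + 1 / ((n : ℝ) + 1)) ∩ N.mkQ ⁻¹' {Submodule.Quotient.mk v}
  have antitone_A : Antitone A := fun a b hab =>
    inter_subset_inter_left _ (Metric.closedBall_subset_closedBall (by gcongr))
  have convex_A (n : ℕ) : Convex ℝ (A n) :=
    (convex_closedBall _ _).inter ((convex_singleton _).linear_preimage N.mkQ)
  have exists_mem_A (n : ℕ) : ∃ z ∈ A n, ‖F.pnorm z‖ ≤ m + 1 := by
    have hpos : (0 : ℝ) < 1 / ((n : ℝ) + 1) := by positivity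
    obtain ⟨z, hz, hlt⟩ := Submodule.Quotient.norm_mk_lt (Submodule.Quotient.mk v : F.Mod ⧸ N) hpos
    refine ⟨z, ⟨mem_closedBall_zero_iff.2 hlt.le, hz⟩, ?_⟩
    rw [norm_pnorm]
    have : 1 / ((n : ℝ) + 1) ≤ 1 := by
      rw [div_le_one (by positivity)]
      linarith [Nat.cast_nonneg (α := ℝ) n]
    linarith
  obtain ⟨z, hz, U, hU⟩ := exists_tendsto_of_midpoint F.pnorm F.pnorm_nonneg (fun v w => by
    rw [pnorm_smul, abs_of_pos one_half_pos]
    exact smul_mono_of_nonneg one_half_pos.le (F.pnorm_add_le v w))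
    A antitone_A convex_A (m + 1) exists_mem_A
  refine ⟨z, U, fun n => (hz n).2, hU, tendsto_nhds_unique hU.norm ?_⟩
  refine tendsto_of_tendsto_of_tendsto_of_le_of_le tendsto_const_nhds
    ?_ (fun n => ?_) fun n => (F.norm_pnorm _).trans_le (mem_closedBall_zero_iff.1 (hz n).1)
  · simpa only [add_zero] using
      tendsto_const_nhds.add (tendsto_one_div_add_atTop_nhds_zero_nat (𝕜 := ℝ))
  · change ‖(Submodule.Quotient.mk v : F.Mod ⧸ N)‖ ≤ ‖F.pnorm (z n)‖
    rw [norm_pnorm, ← (show Submodule.Quotient.mk (z n) = _ from (hz n).2)]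
    exact Submodule.Quotient.norm_mk_le N (z n)

theorem exists_le_pnorm_norm_eq_norm_mk (v : F.Mod) :
    ∃ U : Lp ℝ p μ, 0 ≤ U ∧ ‖U‖ = ‖(Submodule.Quotient.mk v : F.Mod ⧸ N)‖ ∧
      ∀ w ∈ N, U ≤ F.pnorm (v + w) := by
  obtain ⟨z, U, hz, hU, hnorm⟩ := F.exists_tendsto_pnorm_norm_eq_norm_mk N v
  have hU0 : 0 ≤ U := ge_of_tendsto' hU fun n => F.pnorm_nonneg _
  refine ⟨U, hU0, hnorm, fun w hw => ?_⟩
  have hvw : v ≡ v + w [SMOD N] := SModEq.sub_mem.2 (by simpa using N.neg_mem hw)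
  have norm_le (n : ℕ) : ‖U‖ ≤ ‖F.pnorm (z n) ⊓ F.pnorm (v + w)‖ := by
    obtain ⟨y, hy, hinf⟩ := F.exists_sModEq_pnorm_eq_inf hN ((hz n).trans hvw)
    rw [← hinf, norm_pnorm, hnorm, ← show Submodule.Quotient.mk y = _ from hy.trans hvw.symm]
    exact Submodule.Quotient.norm_mk_le N y
  have inf_eq : U ⊓ F.pnorm (v + w) = U :=
    eq_of_le_of_norm_le (le_inf hU0 (F.pnorm_nonneg _)) inf_le_left
      (ge_of_tendsto' (hU.inf_nhds tendsto_const_nhds).norm norm_le)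
  exact inf_eq_left.1 inf_eq

theorem norm_eq_norm_mk_of_isGLB {v : F.Mod} {G : Lp ℝ p μ}
    (hG : IsGLB (range fun w : N => F.pnorm (v + w)) G) :
    ‖G‖ = ‖(Submodule.Quotient.mk v : F.Mod ⧸ N)‖ := by
  have hG0 : 0 ≤ G := hG.2 (by rintro _ ⟨w, rfl⟩; exact F.pnorm_nonneg _)
  refine le_antisymm (le_of_forall_pos_le_add fun ε hε => ?_) ?_
  · obtain ⟨z, hz, hlt⟩ :=
      Submodule.Quotient.norm_mk_lt (Submodule.Quotient.mk v : F.Mod ⧸ N) hε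
    have hle : G ≤ F.pnorm z :=
      hG.1 ⟨⟨z - v, (Submodule.Quotient.eq N).1 hz⟩, congrArg F.pnorm (add_sub_cancel v z)⟩
    exact (norm_mono hG0 hle).trans ((F.norm_pnorm z).trans_le hlt.le)
  · obtain ⟨U, hU0, hU, hle⟩ := F.exists_le_pnorm_norm_eq_norm_mk hN v
    rw [← hU]
    exact norm_mono hU0 (hG.2 (by rintro _ ⟨w, rfl⟩; exact hle w w.2))

end Coset

variable [SigmaFinite μ]

/-- The isometry from the quotient by `zeroModule` into the module generated by the relaxation that
is induced by `relaxMap`. -/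
noncomputable def quotientRelaxMap (hF : F.WeaklyReflexive) :
    (F.Mod ⧸ F.zeroModule) →ₗᵢ[ℝ] F.relaxed.Mod where
  toLinearMap := F.zeroModule.liftQ F.relaxMap.toLinearMap F.zeroModule_le_ker_relaxMap
  norm_map' x := by
    obtain ⟨v, rfl⟩ := Submodule.Quotient.mk_surjective _ x
    change ‖F.relaxMap v‖ = _
    rw [← norm_pnorm]
    exact F.norm_eq_norm_mk_of_isGLB (fun a _ hv => F.mul_mem_zeroModule a hv)
      (F.isGLB_pnorm_relaxMap hF v)

theorem exists_tendsto_d_of_mem_relaxedDomain (hF : F.WeaklyReflexive) (g : F.relaxedDomain) :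
    ∃ (ω : F.Mod) (f : ℕ → V), F.TendstoAE f g ∧ Tendsto (fun n => F.d (f n)) atTop (𝓝 ω) := by
  obtain ⟨f, C, hf, hC⟩ := F.relaxedEnergy_lt_top_iff.1 g.2
  obtain ⟨φ, ω, hφ, hω⟩ := hF.exists_tendstoWeakly F hf hC
  exact ⟨ω, F.exists_tendsto_d (hf.subseq F hφ) hω⟩

theorem relaxMap_surjective (hF : F.WeaklyReflexive) : Function.Surjective F.relaxMap := by
  have range_eq : LinearMap.range (F.quotientRelaxMap hF).toLinearMap =
      LinearMap.range F.relaxMap.toLinearMap := Submodule.range_liftQ _ _ _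
  have isClosed_range : IsClosed (LinearMap.range F.relaxMap.toLinearMap : Set F.relaxed.Mod) := by
    rw [← range_eq]
    exact (F.quotientRelaxMap hF).isometry.isUniformInducing.isComplete_range.isClosed
  refine LinearMap.range_eq_top.1 (eq_top_of_d_mem isClosed_range ?_ fun g => ?_)
  · rintro a _ ⟨v, rfl⟩
    exact ⟨F.mul a v, F.relaxMap_mul a v⟩
  · obtain ⟨ω, f, hf, hω⟩ := F.exists_tendsto_d_of_mem_relaxedDomain hF g
    exact ⟨ω, F.relaxMap_eq_of_tendsto hf hω⟩

/-- The isometric isomorphism of the quotient by `zeroModule` with the module generated by the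
relaxation that is induced by `relaxMap`. -/
noncomputable def quotientRelaxEquiv (hF : F.WeaklyReflexive) :
    (F.Mod ⧸ F.zeroModule) ≃ₗᵢ[ℝ] F.relaxed.Mod :=
  haveI := F.isClosed_zeroModule
  LinearIsometryEquiv.ofSurjective (F.quotientRelaxMap hF) fun y =>
    let ⟨v, hv⟩ := F.relaxMap_surjective hF y
    ⟨Submodule.Quotient.mk v, hv⟩

theorem exists_subseq_tendstoAE {f h : ℕ → V} {g : M →ₘ[μ] ℝ}
    (hf : TendstoL0 (fun n => F.toL0 (f n)) g) (hh : TendstoL0 (fun n => F.toL0 (h n)) g) :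
    ∃ φ : ℕ → ℕ, StrictMono φ ∧ F.TendstoAE (fun n => f (φ n)) g ∧
      F.TendstoAE (fun n => h (φ n)) g := by
  obtain ⟨φ, hφ, hfφ⟩ := hf.exists_subseq_ae
  have hhφ : TendstoL0 (fun n => F.toL0 (h (φ n))) g := fun E hE hE' ε hε =>
    (hh E hE hE' ε hε).comp hφ.tendsto_atTop
  obtain ⟨ψ, hψ, hhψ⟩ := hhφ.exists_subseq_ae
  exact ⟨φ ∘ ψ, hφ.comp hψ, TendstoAE.subseq F (f := fun n => f (φ n)) hfφ hψ, hhψ⟩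

theorem closable_iff : F.Closable ↔ F.zeroModule = ⊥ := by
  constructor
  · intro h
    refine eq_bot_iff.2 (F.zeroModule_le isClosed_singleton (fun a v hv => ?_) ?_)
    · rw [Submodule.mem_bot] at hv ⊢
      rw [hv, map_zero]
    · rintro ω ⟨f, hf, hω⟩
      refine h f (fun _ => 0) 0 ω 0 hf hω
        (TendstoL0.of_ae (map_zero F.toL0 ▸ F.tendstoAE_const 0)) ?_
      simpa only [map_zero] using tendsto_const_nhds
  · intro h f k g ω η hf hω hk hη
    obtain ⟨φ, hφ, hfφ, hkφ⟩ := F.exists_subseq_tendstoAE hf hk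
    have hmem := F.zeroSet_subset_zeroModule
      (F.sub_mem_zeroSet hfφ (hω.comp hφ.tendsto_atTop) hkφ (hη.comp hφ.tendsto_atTop))
    rwa [h, SetLike.mem_coe, Submodule.mem_bot, sub_eq_zero] at hmem

theorem pnorm_relaxMap_of_closable (hF : F.WeaklyReflexive) (hcl : F.Closable) (v : F.Mod) :
    F.relaxed.pnorm (F.relaxMap v) = F.pnorm v := by
  refine le_antisymm (F.pnorm_relaxMap_le v) ((F.isGLB_pnorm_relaxMap hF v).2 ?_)
  rintro _ ⟨⟨w, hw⟩, rfl⟩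
  rw [F.closable_iff.1 hcl, Submodule.mem_bot] at hw
  simp only [hw, add_zero, le_refl]

/-- The isometric isomorphism `relaxMap` for a closable differential. -/
noncomputable def relaxEquiv (hF : F.WeaklyReflexive) (hcl : F.Closable) :
    F.Mod ≃ₗᵢ[ℝ] F.relaxed.Mod :=
  LinearIsometryEquiv.ofSurjective
    ⟨F.relaxMap.toLinearMap, fun v => by
      change ‖F.relaxMap v‖ = ‖v‖
      rw [← norm_pnorm, F.pnorm_relaxMap_of_closable hF hcl, norm_pnorm]⟩
    (F.relaxMap_surjective hF)

theorem WeaklyReflexive.exists_tendstoWeakly_zero (hF : F.WeaklyReflexive) (hcl : F.Closable)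
    {u : ℕ → V} (hu : F.TendstoAE u 0) {C : ℝ} (hC : ∀ n, ‖F.val (u n)‖ ≤ C) :
    ∃ φ : ℕ → ℕ, StrictMono φ ∧ TendstoWeakly (fun n => F.d (u (φ n))) 0 := by
  obtain ⟨φ, ω, hφ, hω⟩ := hF.exists_tendstoWeakly F hu hC
  obtain ⟨z, hz, hzω⟩ := F.exists_tendsto_d (hu.subseq F hφ) hω
  have hω0 := F.zeroSet_subset_zeroModule ⟨z, TendstoL0.of_ae hz, hzω⟩
  rw [F.closable_iff.1 hcl, SetLike.mem_coe, Submodule.mem_bot] at hω0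
  exact ⟨φ, hφ, hω0 ▸ hω⟩

/-- The correction `u n` has differentials that vanish in the weak limit, so it does not change the
limit of `d (h n)`, but it can make `u n - h n + k` almost constant on `A`. -/
theorem sModEq_d_of_tendsto_mul_chi (hF : F.WeaklyReflexive) (hcl : F.Closable) {u h : ℕ → V}
    {k : V} {ω : F.Mod} (hu : F.TendstoAE u 0) {C : ℝ} (hC : ∀ n, ‖F.val (u n)‖ ≤ C)
    (hω : Tendsto (fun n => F.d (h n)) atTop (𝓝 ω)) {A : Set M} (hA : MeasurableSet A)
    (hlim : Tendsto (fun n => F.mul (chi μ A hA) (F.d (u n - h n + k))) atTop (𝓝 0)) :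
    ω ≡ F.d k [SMOD F.vanishingOn A] := by
  obtain ⟨φ, hφ, hu⟩ := hF.exists_tendstoWeakly_zero F hcl hu hC
  have hweak : TendstoWeakly (fun n => F.mul (chi μ A hA) (F.d (u (φ n) - h (φ n) + k)))
      (F.mul (chi μ A hA) (0 - ω + F.d k)) := by
    refine TendstoWeakly.map ?_ _
    simp only [map_add, map_sub]
    exact (hu.sub (hω.comp hφ.tendsto_atTop).tendstoWeakly).add
      (tendsto_const_nhds (x := F.d k)).tendstoWeakly
  have hnorm := ((F.continuous_pnorm.tendsto 0).comp (hlim.comp hφ.tendsto_atTop)).tendstoWeakly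
  have hle := F.pnorm_le_of_tendstoWeakly hweak hnorm fun n => le_rfl
  rw [pnorm_zero] at hle
  have hzero := F.pnorm_eq_zero.1 (le_antisymm hle (F.pnorm_nonneg _))
  rwa [zero_sub, map_add, map_neg, neg_add_eq_zero, mul_chi_eq_mul_chi_iff] at hzero

end Quotient

end LpFunctional

section Metric

variable {M : Type*} [MetricSpace M]

theorem IsLipschitz.sub {f h : M → ℝ} (hf : IsLipschitz f) (hh : IsLipschitz h) :
    IsLipschitz (fun x => f x - h x) := by
  obtain ⟨K, hK⟩ := hf
  obtain ⟨L, hL⟩ := hh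
  exact ⟨K + L, hK.sub hL⟩

theorem locLip_le_add_of_eventually {f g : M → ℝ} (hf : IsLipschitz f) (hg : IsLipschitz g) {x : M}
    {C : ℝ} (hC : 0 ≤ C) (h : ∀ᶠ y in 𝓝 x, |f y - f x| ≤ C * dist y x + |g y - g x|) :
    locLip f x ≤ C + locLip g x := by
  rw [locLip_le_iff hf x (add_nonneg hC (locLip_nonneg hg x))]
  intro ε hε
  filter_upwards [(locLip_le_iff hg x (locLip_nonneg hg x)).1 le_rfl ε hε,
    mem_nhdsWithin_of_mem_nhds h] with y hgy hfy
  calc |f y - f x| ≤ C * dist y x + (locLip g x + ε) * dist y x := hfy.trans (by gcongr)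
    _ = (C + locLip g x + ε) * dist y x := by ring

theorem locLip_le_of_lipschitzWith {f : M → ℝ} {K : ℝ≥0} (hf : LipschitzWith K f) (x : M) :
    locLip f x ≤ K := by
  refine (locLip_le_iff ⟨K, hf⟩ x K.2).2 fun ε hε => Eventually.of_forall fun y => ?_
  rw [← Real.dist_eq]
  refine (hf.dist_le_mul y x).trans (mul_le_mul_of_nonneg_right ?_ dist_nonneg)
  exact le_add_of_nonneg_right hε.le

theorem locLip_congr {f g : M → ℝ} {x : M} (h : ∀ᶠ y in 𝓝 x, f y - f x = g y - g x) :
    locLip f x = locLip g x := by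
  refine limsup_congr (mem_nhdsWithin_of_mem_nhds ?_)
  filter_upwards [h] with y hy
  rw [hy]

theorem locLip_eq_zero_of_eventually {f : M → ℝ} {x : M} (h : ∀ᶠ y in 𝓝 x, f y = f x) :
    locLip f x = 0 := by
  have hcongr : locLip f x = locLip (0 : M → ℝ) x := locLip_congr (by
    filter_upwards [h] with y hy
    simp only [hy, sub_self, Pi.zero_apply])
  rw [hcongr]
  simpa using locLip_smul (IsLipschitz.zero (M := M)) 0 x

theorem locLip_sub_le_of_lipschitzWith {f h : M → ℝ} {L : ℝ≥0} (hh : IsLipschitz h)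
    (hf : LipschitzWith L f) (x : M) : locLip (fun y => h y - f y) x ≤ L + locLip h x := by
  refine locLip_le_add_of_eventually (hh.sub ⟨L, hf⟩) hh L.2 (Eventually.of_forall fun y => ?_)
  calc |h y - f y - (h x - f x)| = |-(f y - f x) + (h y - h x)| := by ring_nf
    _ ≤ |f y - f x| + |h y - h x| := (abs_add_le _ _).trans_eq (by rw [abs_neg])
    _ ≤ L * dist y x + |h y - h x| := by
      gcongr
      exact hf.dist_le_mul y x

theorem IsLipschitz.sub_const {f : M → ℝ} (hf : IsLipschitz f) (c : ℝ) :
    IsLipschitz fun x => f x - c :=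
  hf.sub ⟨0, LipschitzWith.const c⟩

theorem locLip_sub_const (f : M → ℝ) (c : ℝ) (x : M) : locLip (fun y => f y - c) x = locLip f x :=
  locLip_congr (Eventually.of_forall fun _ => sub_sub_sub_cancel_right _ _ _)

/-- The truncation of a real number to `[-1, 1]`. -/
def clamp (t : ℝ) : ℝ := max (-1) (min 1 t)

theorem abs_clamp_le_one (t : ℝ) : |clamp t| ≤ 1 :=
  abs_le.2 ⟨le_max_left _ _, max_le (by norm_num) (min_le_left _ _)⟩

theorem clamp_of_abs_le {t : ℝ} (h : |t| ≤ 1) : clamp t = t := by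
  rw [clamp, min_eq_right (abs_le.1 h).2, max_eq_right (abs_le.1 h).1]

theorem abs_clamp_sub_le (s t : ℝ) : |clamp s - clamp t| ≤ |s - t| := by
  unfold clamp
  refine (abs_max_sub_max_le_max _ _ _ _).trans ?_
  rw [sub_self, abs_zero]
  refine max_le (abs_nonneg _) ((abs_min_sub_min_le_max _ _ _ _).trans ?_)
  rw [sub_self, abs_zero]
  exact max_le (abs_nonneg _) le_rfl

theorem abs_clamp_le (t : ℝ) : |clamp t| ≤ |t| := by
  have := abs_clamp_sub_le t 0
  rwa [clamp_of_abs_le (t := 0) (by simp), sub_zero, sub_zero] at this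

/-- A cut-off function, equal to `1` on the ball of radius `r` and to `0` off the ball of
radius `2 r`. -/
noncomputable def cutoff (x₀ : M) (r : ℝ) (y : M) : ℝ := max 0 (min 1 (2 - r⁻¹ * dist y x₀))

theorem abs_cutoff_le (x₀ : M) (r : ℝ) (y : M) : |cutoff x₀ r y| ≤ 1 :=
  abs_le.2 ⟨le_trans (by norm_num) (le_max_left _ _), max_le (by norm_num) (min_le_left _ _)⟩

theorem cutoff_eq_one {x₀ y : M} {r : ℝ} (hr : 0 < r) (h : dist y x₀ ≤ r) : cutoff x₀ r y = 1 := by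
  have : r⁻¹ * dist y x₀ ≤ 1 := by rwa [inv_mul_le_iff₀ hr, mul_one]
  rw [cutoff, min_eq_left (by linarith), max_eq_right zero_le_one]

theorem cutoff_eq_zero {x₀ y : M} {r : ℝ} (hr : 0 < r) (h : 2 * r ≤ dist y x₀) :
    cutoff x₀ r y = 0 := by
  have : 2 ≤ r⁻¹ * dist y x₀ := by rwa [le_inv_mul_iff₀ hr, mul_comm]
  exact max_eq_left ((min_le_right _ _).trans (by linarith))

theorem abs_cutoff_sub_le (x₀ : M) {r : ℝ} (hr : 0 < r) (y x : M) :
    |cutoff x₀ r y - cutoff x₀ r x| ≤ r⁻¹ * dist y x := by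
  unfold cutoff
  refine (abs_max_sub_max_le_max _ _ _ _).trans ?_
  rw [sub_self, abs_zero]
  refine max_le (by positivity) ((abs_min_sub_min_le_max _ _ _ _).trans ?_)
  rw [sub_self, abs_zero]
  refine max_le (by positivity) ?_
  have : 2 - r⁻¹ * dist y x₀ - (2 - r⁻¹ * dist x x₀) = r⁻¹ * (dist x x₀ - dist y x₀) := by ring
  rw [this, abs_mul, abs_of_pos (inv_pos.2 hr), dist_comm y x]
  exact mul_le_mul_of_nonneg_left (abs_dist_sub_le x y x₀) (inv_pos.2 hr).le

/-- The function `k`, truncated to `[-1, 1]` and cut off outside the ball of radius `2 r`; this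
makes a Lipschitz function an element of `lipDomain` without changing it on the ball of radius `r`,
as long as it is small there. -/
noncomputable def bump (x₀ : M) (r : ℝ) (k : M → ℝ) (y : M) : ℝ := cutoff x₀ r y * clamp (k y)

theorem abs_bump_le (x₀ : M) (r : ℝ) (k : M → ℝ) (y : M) : |bump x₀ r k y| ≤ |k y| := by
  rw [bump, abs_mul]
  exact (mul_le_of_le_one_left (abs_nonneg _) (abs_cutoff_le x₀ r y)).trans (abs_clamp_le _)

theorem bump_eq {x₀ y : M} {r : ℝ} (hr : 0 < r) {k : M → ℝ} (h : dist y x₀ ≤ r) (hk : |k y| ≤ 1) :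
    bump x₀ r k y = k y := by
  rw [bump, cutoff_eq_one hr h, one_mul, clamp_of_abs_le hk]

theorem abs_bump_sub_le (x₀ : M) {r : ℝ} (hr : 0 < r) (k : M → ℝ) (y x : M) :
    |bump x₀ r k y - bump x₀ r k x| ≤ r⁻¹ * dist y x + |k y - k x| := by
  have : bump x₀ r k y - bump x₀ r k x = (cutoff x₀ r y - cutoff x₀ r x) * clamp (k y) +
      cutoff x₀ r x * (clamp (k y) - clamp (k x)) := by unfold bump; ring
  rw [this]
  refine (abs_add_le _ _).trans (add_le_add ?_ ?_)
  · rw [abs_mul]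
    exact (mul_le_of_le_one_right (abs_nonneg _) (abs_clamp_le_one _)).trans
      (abs_cutoff_sub_le x₀ hr y x)
  · rw [abs_mul]
    exact (mul_le_of_le_one_left (abs_nonneg _) (abs_cutoff_le x₀ r x)).trans
      (abs_clamp_sub_le _ _)

theorem isLipschitz_bump (x₀ : M) {r : ℝ} (hr : 0 < r) {k : M → ℝ} (hk : IsLipschitz k) :
    IsLipschitz (bump x₀ r k) := by
  obtain ⟨K, hK⟩ := hk
  refine ⟨r⁻¹.toNNReal + K, LipschitzWith.of_dist_le_mul fun y x => ?_⟩
  rw [Real.dist_eq, NNReal.coe_add, Real.coe_toNNReal _ (inv_pos.2 hr).le, _root_.add_mul]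
  refine (abs_bump_sub_le x₀ hr k y x).trans (add_le_add le_rfl ?_)
  rw [← Real.dist_eq]
  exact hK.dist_le_mul y x

theorem locLip_bump_le (x₀ : M) {r : ℝ} (hr : 0 < r) {k : M → ℝ} (hk : IsLipschitz k) (x : M) :
    locLip (bump x₀ r k) x ≤ r⁻¹ + locLip k x :=
  locLip_le_add_of_eventually (isLipschitz_bump x₀ hr hk) hk (inv_pos.2 hr).le
    (Eventually.of_forall fun y => abs_bump_sub_le x₀ hr k y x)

theorem locLip_bump_eq_zero {x₀ x : M} {r : ℝ} (hr : 0 < r) {k : M → ℝ}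
    (hx : x ∉ Metric.ball x₀ (3 * r)) : locLip (bump x₀ r k) x = 0 := by
  rw [Metric.mem_ball, not_lt] at hx
  have bump_eq_zero (y : M) (hy : 2 * r ≤ dist y x₀) : bump x₀ r k y = 0 := by
    rw [bump, cutoff_eq_zero hr hy, zero_mul]
  refine locLip_eq_zero_of_eventually ?_
  filter_upwards [Metric.ball_mem_nhds x hr] with y hy
  rw [bump_eq_zero x (by linarith), bump_eq_zero y]
  have := dist_triangle x y x₀
  rw [Metric.mem_ball, dist_comm] at hy
  linarith

theorem bump_sub_const_eq {f : M → ℝ} {L : ℝ≥0} (hf : LipschitzWith L f) {x₀ y : M} {r : ℝ}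
    (hLr : L * r < 1) (hy : y ∈ Metric.ball x₀ r) :
    bump x₀ r (fun x => f x - f x₀) y = f y - f x₀ := by
  rw [Metric.mem_ball] at hy
  refine bump_eq (dist_nonneg.trans_lt hy) hy.le ?_
  calc |f y - f x₀| ≤ L * dist y x₀ := hf.dist_le_mul y x₀
    _ ≤ L * r := by gcongr
    _ ≤ 1 := hLr.le

variable [MeasurableSpace M] [BorelSpace M] {μ : Measure M} {p : ℝ≥0}

theorem bump_mem_lipDomain (x₀ : M) {r : ℝ} (hr : 0 < r) (hfin : μ (Metric.ball x₀ (3 * r)) ≠ ∞)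
    {k : M → ℝ} (hk : IsLipschitz k) : bump x₀ r k ∈ lipDomain μ p := by
  have hb := isLipschitz_bump x₀ hr hk
  refine ⟨hb, ?_⟩
  obtain ⟨K, hK⟩ := id hb
  refine (memLp_indicator_const (p : ℝ≥0∞) (measurableSet_ball (x := x₀) (ε := 3 * r)) (K : ℝ)
    (Or.inr hfin)).mono (measurable_locLip hb).aestronglyMeasurable (ae_of_all _ fun x => ?_)
  rw [Real.norm_of_nonneg (locLip_nonneg hb x)]
  by_cases hx : x ∈ Metric.ball x₀ (3 * r)
  · rw [indicator_of_mem hx]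
    exact (locLip_le_of_lipschitzWith hK x).trans (le_abs_self _)
  · rw [locLip_bump_eq_zero hr hx]
    exact norm_nonneg _

/-- `bump x₀ r k` as an element of the domain of `d_lip`. -/
noncomputable def lipBump (x₀ : M) {r : ℝ} (hr : 0 < r) (hfin : μ (Metric.ball x₀ (3 * r)) ≠ ∞)
    {k : M → ℝ} (hk : IsLipschitz k) : lipDomain μ p :=
  ⟨bump x₀ r k, bump_mem_lipDomain x₀ hr hfin hk⟩

/-- The part of the bound for the slope of `lipBump` that comes from the cut-off (slope at most
`r⁻¹`) and from an `L`-Lipschitz summand of the function that is cut off. -/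
noncomputable def bumpBound (x₀ : M) {r : ℝ} (hfin : μ (Metric.ball x₀ (3 * r)) ≠ ∞) (L : ℝ≥0) :
    Lp ℝ p μ :=
  indicatorConstLp (p : ℝ≥0∞) (measurableSet_ball (x := x₀) (ε := 3 * r)) hfin (r⁻¹ + L)

theorem bumpBound_nonneg (x₀ : M) {r : ℝ} (hr : 0 < r) (hfin : μ (Metric.ball x₀ (3 * r)) ≠ ∞)
    (L : ℝ≥0) : 0 ≤ bumpBound (p := p) x₀ hfin L := by
  rw [← Lp.coeFn_nonneg]
  filter_upwards [indicatorConstLp_coeFn (p := (p : ℝ≥0∞)) (c := r⁻¹ + L)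
    (hs := measurableSet_ball (x := x₀) (ε := 3 * r)) (hμs := hfin)] with x hx
  rw [bumpBound, hx]
  exact indicator_nonneg (fun _ _ => by positivity) x

variable [Fact (1 < p)]

theorem lipVal_lipBump_le (x₀ : M) {r : ℝ} (hr : 0 < r) (hfin : μ (Metric.ball x₀ (3 * r)) ≠ ∞)
    {k : M → ℝ} (hk : IsLipschitz k) {L : ℝ≥0} {v : Lp ℝ p μ} (hv : 0 ≤ v)
    (h : ∀ᵐ x ∂μ, locLip k x ≤ L + v x) :
    lipVal (lipBump x₀ hr hfin hk) ≤ v + bumpBound x₀ hfin L := by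
  rw [← Lp.coeFn_le]
  rw [← Lp.coeFn_nonneg] at hv
  filter_upwards [coeFn_lipVal (lipBump (p := p) x₀ hr hfin hk),
    Lp.coeFn_add v (bumpBound x₀ hfin L), hv, h, indicatorConstLp_coeFn (p := (p : ℝ≥0∞))
      (c := r⁻¹ + L) (hs := measurableSet_ball (x := x₀) (ε := 3 * r)) (hμs := hfin)]
    with x hval hadd hv h hind
  rw [hval, hadd, Pi.add_apply, bumpBound, hind]
  by_cases hx : x ∈ Metric.ball x₀ (3 * r)
  · rw [indicator_of_mem hx]
    have : locLip (bump x₀ r k) x ≤ r⁻¹ + locLip k x := locLip_bump_le x₀ hr hk x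
    exact this.trans (by linarith)
  · rw [indicator_of_notMem hx, add_zero]
    exact (locLip_bump_eq_zero hr hx).trans_le hv

section LocalDefect

variable {f : M → ℝ} {L : ℝ≥0} (hf : LipschitzWith L f) (x₀ : M) {r : ℝ} (hr : 0 < r)
  (hfin : μ (Metric.ball x₀ (3 * r)) ≠ ∞) (h : lipDomain μ p)

theorem lipVal_lipBump_sub_le :
    lipVal (lipBump x₀ hr hfin ((isLipschitz_coe h).sub ⟨L, hf⟩)) ≤
      lipVal h + bumpBound x₀ hfin L := by
  refine lipVal_lipBump_le x₀ hr hfin _ (lipVal_nonneg h) ?_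
  filter_upwards [coeFn_lipVal h] with x hx
  rw [hx]
  exact locLip_sub_le_of_lipschitzWith (isLipschitz_coe h) hf x

theorem lipVal_lipBump_sub_const_le (c : ℝ) :
    lipVal (lipBump (p := p) x₀ hr hfin (IsLipschitz.sub_const ⟨L, hf⟩ c)) ≤
      bumpBound x₀ hfin L := by
  refine (lipVal_lipBump_le x₀ hr hfin _ le_rfl (L := L) ?_).trans_eq (zero_add _)
  filter_upwards [Lp.coeFn_zero ℝ p μ] with x hx
  rw [hx, Pi.zero_apply, add_zero, locLip_sub_const]
  exact locLip_le_of_lipschitzWith hf x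

/-- A localized version of `(h - f) - h + (f - f x₀) = - f x₀`: close to the points of the ball of
radius `r` where `|h - f| < 1` it is this constant. -/
noncomputable def localDefect : lipDomain μ p :=
  lipBump x₀ hr hfin ((isLipschitz_coe h).sub ⟨L, hf⟩) - h +
    lipBump x₀ hr hfin (IsLipschitz.sub_const ⟨L, hf⟩ (f x₀))

theorem lipVal_localDefect_le :
    lipVal (localDefect hf x₀ hr hfin h) ≤
      (2 : ℝ) • lipVal h + (2 : ℝ) • bumpBound x₀ hfin L := by
  have lipVal_neg : lipVal (-h) = lipVal h := by
    rw [← neg_one_smul ℝ h, lipVal_smul, abs_neg, abs_one, one_smul]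
  rw [localDefect, sub_eq_add_neg]
  calc _ ≤ lipVal (lipBump x₀ hr hfin ((isLipschitz_coe h).sub ⟨L, hf⟩)) + lipVal (-h) +
        lipVal (lipBump x₀ hr hfin (IsLipschitz.sub_const ⟨L, hf⟩ (f x₀))) :=
        (lipVal_add_le _ _).trans (add_le_add (lipVal_add_le _ _) le_rfl)
    _ ≤ lipVal h + bumpBound x₀ hfin L + lipVal h + bumpBound x₀ hfin L := by
        rw [lipVal_neg]
        exact add_le_add (add_le_add (lipVal_lipBump_sub_le hf x₀ hr hfin h) le_rfl)
          (lipVal_lipBump_sub_const_le hf x₀ hr hfin (f x₀))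
    _ = (2 : ℝ) • lipVal h + (2 : ℝ) • bumpBound x₀ hfin L := by
        rw [two_smul, two_smul]
        abel

variable (hLr : L * r < 1)
include hLr

theorem localDefect_eq {y : M} (hy : y ∈ Metric.ball x₀ r) (hlt : |(h : M → ℝ) y - f y| < 1) :
    (localDefect hf x₀ hr hfin h : M → ℝ) y = -f x₀ := by
  change bump x₀ r (fun x => (h : M → ℝ) x - f x) y - (h : M → ℝ) y +
    bump x₀ r (fun x => f x - f x₀) y = _
  rw [bump_eq hr (Metric.mem_ball.1 hy).le hlt.le, bump_sub_const_eq hf hLr hy]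
  ring

theorem locLip_localDefect_eq_zero {x : M} (hx : x ∈ Metric.ball x₀ r)
    (hlt : |(h : M → ℝ) x - f x| < 1) :
    locLip (localDefect hf x₀ hr hfin h : M → ℝ) x = 0 := by
  have hcont : Continuous fun y => |(h : M → ℝ) y - f y| :=
    ((isLipschitz_coe h).sub ⟨L, hf⟩).choose_spec.continuous.abs
  refine locLip_eq_zero_of_eventually ?_
  filter_upwards [Metric.isOpen_ball.mem_nhds hx, hcont.continuousAt.eventually_lt_const hlt]
    with y hy hylt
  rw [localDefect_eq hf x₀ hr hfin h hLr hy hylt, localDefect_eq hf x₀ hr hfin h hLr hx hlt]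

theorem coeFn_lipVal_lipBump_sub_const :
    ∀ᵐ x ∂μ, x ∈ Metric.ball x₀ r →
      lipVal (lipBump (p := p) x₀ hr hfin (IsLipschitz.sub_const ⟨L, hf⟩ (f x₀))) x =
        locLip f x := by
  filter_upwards [coeFn_lipVal (lipBump (p := p) x₀ hr hfin (IsLipschitz.sub_const ⟨L, hf⟩ (f x₀)))]
    with x hval hx
  rw [hval, ← locLip_sub_const f (f x₀)]
  refine locLip_congr ?_
  filter_upwards [Metric.isOpen_ball.mem_nhds hx] with y hy
  change bump x₀ r (fun x => f x - f x₀) y - bump x₀ r (fun x => f x - f x₀) x = _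
  rw [bump_sub_const_eq hf hLr hy, bump_sub_const_eq hf hLr hx]

end LocalDefect

section Closable

theorem coeFn_lipFunctional_toL0 (f : lipDomain μ p) :
    (lipFunctional μ p).toL0 f =ᵐ[μ] (f : M → ℝ) :=
  AEEqFun.coeFn_mk _ _

theorem tendstoAE_lipFunctional_iff {f : ℕ → lipDomain μ p} {g : M →ₘ[μ] ℝ} :
    (lipFunctional μ p).TendstoAE f g ↔
      ∀ᵐ x ∂μ, Tendsto (fun n => (f n : M → ℝ) x) atTop (𝓝 (g x)) := by
  refine eventually_congr ?_
  filter_upwards [ae_all_iff.2 fun n => coeFn_lipFunctional_toL0 (f n)] with x hx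
  simp only [hx]

section Limit

variable {f : M → ℝ} {L : ℝ≥0} (hf : LipschitzWith L f) {h : ℕ → lipDomain μ p}
  {ω : LipschitzModule μ p}
  (hh : ∀ᵐ x ∂μ, Tendsto (fun n => (h n : M → ℝ) x) atTop (𝓝 (f x)))
  (hω : Tendsto (fun n => (lipFunctional μ p).d (h n)) atTop (𝓝 ω))
  (x₀ : M) {r : ℝ} (hr : 0 < r) (hfin : μ (Metric.ball x₀ (3 * r)) ≠ ∞)

include hh in
theorem tendstoAE_lipBump_sub :
    (lipFunctional μ p).TendstoAE
      (fun n => lipBump x₀ hr hfin ((isLipschitz_coe (h n)).sub ⟨L, hf⟩)) 0 := by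
  rw [tendstoAE_lipFunctional_iff]
  filter_upwards [hh, AEEqFun.coeFn_zero (μ := μ) (β := ℝ)] with x hx hzero
  rw [hzero, Pi.zero_apply]
  refine squeeze_zero_norm (fun n => abs_bump_le x₀ r (fun x => (h n : M → ℝ) x - f x) x) ?_
  simpa using (hx.sub_const (f x)).abs

include hω in
theorem exists_norm_lipVal_lipBump_sub_le :
    ∃ C : ℝ, ∀ n,
      ‖lipVal (lipBump (p := p) x₀ hr hfin ((isLipschitz_coe (h n)).sub ⟨L, hf⟩))‖ ≤ C := by
  obtain ⟨C, hC⟩ := hω.norm.bddAbove_range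
  refine ⟨C + ‖bumpBound (p := p) x₀ hfin L‖, fun n => ?_⟩
  calc _ ≤ ‖lipVal (h n) + bumpBound x₀ hfin L‖ :=
        LpFunctional.norm_mono (lipVal_nonneg _) (lipVal_lipBump_sub_le hf x₀ hr hfin (h n))
    _ ≤ ‖lipVal (h n)‖ + ‖bumpBound x₀ hfin L‖ := norm_add_le _ _
    _ ≤ C + ‖bumpBound (p := p) x₀ hfin L‖ := by
        gcongr
        exact ((lipFunctional μ p).norm_d _).ge.trans (hC ⟨n, rfl⟩)

theorem lipVal_localDefect_le_pnorm_sub (n : ℕ) (ω : LipschitzModule μ p) :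
    lipVal (localDefect hf x₀ hr hfin (h n)) ≤
      (2 : ℝ) • (lipFunctional μ p).pnorm ((lipFunctional μ p).d (h n) - ω) +
        ((2 : ℝ) • (lipFunctional μ p).pnorm ω + (2 : ℝ) • bumpBound x₀ hfin L) := by
  have val_le : lipVal (h n) ≤ (lipFunctional μ p).pnorm ω +
      (lipFunctional μ p).pnorm ((lipFunctional μ p).d (h n) - ω) :=
    ((lipFunctional μ p).pnorm_d (h n)).ge.trans ((lipFunctional μ p).pnorm_le_add_sub _ _)
  refine (lipVal_localDefect_le hf x₀ hr hfin (h n)).trans ?_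
  refine (add_le_add (smul_mono_of_nonneg zero_le_two val_le) le_rfl).trans_eq ?_
  rw [smul_add]
  abel

include hh hω in
theorem tendsto_mul_chi_d_localDefect (hLr : L * r < 1) :
    Tendsto (fun n => (lipFunctional μ p).mul
      (LpFunctional.chi μ (Metric.ball x₀ r) measurableSet_ball)
      ((lipFunctional μ p).d (localDefect hf x₀ hr hfin (h n)))) atTop (𝓝 0) := by
  set F := lipFunctional μ p
  have hpnorm (n : ℕ) := F.coeFn_pnorm_mul_chi (measurableSet_ball (x := x₀) (ε := r))
    (F.d (localDefect hf x₀ hr hfin (h n)))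
  simp only [LpFunctional.pnorm_d] at hpnorm
  have herror : Tendsto (fun n => (2 : ℝ) • F.pnorm (F.d (h n) - ω)) atTop (𝓝 0) := by
    have := ((F.continuous_pnorm.tendsto _).comp (hω.sub_const ω)).const_smul (2 : ℝ)
    rwa [sub_self, F.pnorm_zero, smul_zero] at this
  refine tendsto_zero_iff_norm_tendsto_zero.2 ?_
  simp only [← LpFunctional.norm_pnorm]
  refine tendsto_zero_iff_norm_tendsto_zero.1
    (tendsto_zero_of_le_add (fun n => F.pnorm_nonneg _) herror
      (w := (2 : ℝ) • F.pnorm ω + (2 : ℝ) • bumpBound x₀ hfin L) ?_ (fun n => ?_) ?_)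
  · exact add_nonneg (by simpa using smul_mono_of_nonneg zero_le_two (F.pnorm_nonneg ω))
      (by simpa using smul_mono_of_nonneg zero_le_two (bumpBound_nonneg (p := p) x₀ hr hfin L))
  · refine le_trans ?_ (lipVal_localDefect_le_pnorm_sub hf x₀ hr hfin n ω)
    rw [← Lp.coeFn_le]
    filter_upwards [hpnorm n, Lp.coeFn_nonneg _ |>.2 (lipVal_nonneg
      (localDefect hf x₀ hr hfin (h n)))] with x hx hnonneg
    rw [hx]
    exact indicator_apply_le' (fun _ => le_rfl) fun _ => hnonneg
  · filter_upwards [ae_all_iff.2 hpnorm, ae_all_iff.2 fun n => coeFn_lipVal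
      (localDefect hf x₀ hr hfin (h n)), hh] with x hx hval hlim
    have hdist : Tendsto (fun n => |(h n : M → ℝ) x - f x|) atTop (𝓝 0) := by
      simpa using (hlim.sub_const (f x)).abs
    refine tendsto_const_nhds.congr' ?_
    filter_upwards [hdist.eventually_lt_const one_pos] with n hn
    rw [hx, eq_comm, indicator_apply_eq_zero]
    exact fun hxU => (hval n).trans (locLip_localDefect_eq_zero hf x₀ hr hfin (h n) hLr hxU hn)

include hf hh hω hr hfin in
theorem pnorm_eq_locLip_on_ball [SigmaFinite μ] (hF : (lipFunctional μ p).WeaklyReflexive)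
    (hcl : (lipFunctional μ p).Closable) (hLr : L * r < 1) :
    ∀ᵐ x ∂μ, x ∈ Metric.ball x₀ r → (lipFunctional μ p).pnorm ω x = locLip f x := by
  obtain ⟨C, hC⟩ := exists_norm_lipVal_lipBump_sub_le hf hω x₀ hr hfin
  have hmod := (lipFunctional μ p).sModEq_d_of_tendsto_mul_chi hF hcl
    (tendstoAE_lipBump_sub hf hh x₀ hr hfin) hC hω measurableSet_ball
    (tendsto_mul_chi_d_localDefect hf hh hω x₀ hr hfin hLr)
  have hpnorm := (lipFunctional μ p).coeFn_pnorm_congr hmod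
  rw [LpFunctional.pnorm_d] at hpnorm
  filter_upwards [hpnorm, coeFn_lipVal_lipBump_sub_const (p := p) hf x₀ hr hfin hLr]
    with x hx hval hxU
  exact (hx hxU).trans (hval hxU)

end Limit

omit [BorelSpace M] in
theorem exists_pos_mul_lt_one_measure_ball_ne_top [IsLocallyFiniteMeasure μ] (x₀ : M) (L : ℝ≥0) :
    ∃ r > (0 : ℝ), L * r < 1 ∧ μ (Metric.ball x₀ (3 * r)) ≠ ∞ := by
  obtain ⟨s, hs, hsfin⟩ := μ.finiteAt_nhds x₀
  obtain ⟨R, hR, hRs⟩ := Metric.mem_nhds_iff.1 hs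
  have hmul : Tendsto (fun r : ℝ => L * r) (𝓝[>] 0) (𝓝 (L * 0)) :=
    (continuous_const_mul (L : ℝ)).continuousWithinAt
  rw [mul_zero] at hmul
  obtain ⟨r, hLr, hr0, hrR⟩ := ((hmul.eventually_lt_const one_pos).and
    (Ioo_mem_nhdsGT (div_pos hR three_pos))).exists
  refine ⟨r, hr0, hLr, ne_top_of_le_ne_top hsfin.ne (measure_mono ?_)⟩
  exact (Metric.ball_subset_ball (by linarith)).trans hRs

omit [BorelSpace M] in
theorem measure_eq_zero_of_forall_exists_nhds [μ.InnerRegular] {E : Set M}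
    (hE : MeasurableSet E) (h : ∀ x, ∃ U ∈ 𝓝 x, μ (U ∩ E) = 0) : μ E = 0 := by
  by_contra hne
  obtain ⟨K, hKE, hK, hpos⟩ := hE.exists_lt_isCompact (pos_iff_ne_zero.2 hne)
  refine hpos.ne' (hK.measure_zero_of_nhdsWithin fun x _ => ?_)
  obtain ⟨U, hU, hnull⟩ := h x
  exact ⟨U ∩ K, inter_mem (mem_nhdsWithin_of_mem_nhds hU) self_mem_nhdsWithin,
    measure_mono_null (inter_subset_inter_right U hKE) hnull⟩

variable [SigmaFinite μ]

theorem relaxedSlope_val_eq_pnorm (hF : (lipFunctional μ p).WeaklyReflexive)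
    (hcl : (lipFunctional μ p).Closable) {g : (lipFunctional μ p).relaxedDomain}
    {h : ℕ → lipDomain μ p} {ω : LipschitzModule μ p} (hh : (lipFunctional μ p).TendstoAE h g)
    (hω : Tendsto (fun n => (lipFunctional μ p).d (h n)) atTop (𝓝 ω)) :
    (relaxedSlope μ p).val g = (lipFunctional μ p).pnorm ω := by
  rw [← LpFunctional.pnorm_d, ← (lipFunctional μ p).relaxMap_eq_of_tendsto hh hω]
  exact (lipFunctional μ p).pnorm_relaxMap_of_closable hF hcl ω

theorem relaxedSlope_eq_locLip [IsLocallyFiniteMeasure μ] [μ.InnerRegular]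
    (hF : (lipFunctional μ p).WeaklyReflexive) (hcl : (lipFunctional μ p).Closable) {f : M → ℝ}
    (g : (lipFunctional μ p).relaxedDomain) (hf : IsLipschitz f) (hg : (g : M →ₘ[μ] ℝ) =ᵐ[μ] f) :
    (relaxedSlope μ p).val g =ᵐ[μ] locLip f := by
  obtain ⟨L, hL⟩ := id hf
  obtain ⟨ω, h, hh, hω⟩ := (lipFunctional μ p).exists_tendsto_d_of_mem_relaxedDomain hF g
  rw [relaxedSlope_val_eq_pnorm hF hcl hh hω]
  have hhf : ∀ᵐ x ∂μ, Tendsto (fun n => (h n : M → ℝ) x) atTop (𝓝 (f x)) := by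
    filter_upwards [tendstoAE_lipFunctional_iff.1 hh, hg] with x hx hgx
    rwa [hgx] at hx
  refine measure_eq_zero_of_forall_exists_nhds (measurableSet_eq_fun
    (Lp.stronglyMeasurable _).measurable (measurable_locLip hf)).compl fun x₀ => ?_
  obtain ⟨r, hr, hLr, hfin⟩ := exists_pos_mul_lt_one_measure_ball_ne_top (μ := μ) x₀ L
  refine ⟨Metric.ball x₀ r, Metric.ball_mem_nhds x₀ hr,
    measure_mono_null ?_ (pnorm_eq_locLip_on_ball hL hhf hω x₀ hr hfin hF hcl hLr)⟩
  exact fun x ⟨hx, hne⟩ heq => hne (heq hx)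

end Closable

end Metric

end NormedModules

theorem mainTheorem3_general {M : Type*} [MetricSpace M] [MeasurableSpace M] [BorelSpace M]
    (μ : Measure M) [IsLocallyFiniteMeasure μ] [μ.InnerRegular] [SigmaFinite μ]
    (p : ℝ≥0) [Fact (1 < p)] (hrefl : (lipFunctional μ p).WeaklyReflexive) :
    (lipFunctional μ p).IsLpNormedSubmodule (lipschitzZeroModule μ p) ∧
    (∃ Φ : (LipschitzModule μ p ⧸ lipschitzZeroModule μ p) ≃ₗᵢ[ℝ] CotangentModule μ p,
      (∀ f : lipDomain μ p,
        Φ (Submodule.Quotient.mk ((lipFunctional μ p).d f)) =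
          (relaxedSlope μ p).d ((lipFunctional μ p).toRelaxed f)) ∧
      (∀ (a : Lp ℝ ∞ μ) (v : LipschitzModule μ p),
        Φ (Submodule.Quotient.mk ((lipFunctional μ p).mul a v)) =
          (relaxedSlope μ p).mul a (Φ (Submodule.Quotient.mk v))) ∧
      (∀ v : LipschitzModule μ p,
        IsGLB (Set.range fun w : lipschitzZeroModule μ p => (lipFunctional μ p).pnorm (v + w))
          ((relaxedSlope μ p).pnorm (Φ (Submodule.Quotient.mk v))))) ∧
    ((lipFunctional μ p).Closable ↔ lipschitzZeroModule μ p = ⊥) ∧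
    ((lipFunctional μ p).Closable →
      (∃ Ψ : LipschitzModule μ p ≃ₗᵢ[ℝ] CotangentModule μ p,
        (∀ f : lipDomain μ p,
          Ψ ((lipFunctional μ p).d f) =
            (relaxedSlope μ p).d ((lipFunctional μ p).toRelaxed f)) ∧
        (∀ (a : Lp ℝ ∞ μ) (v : LipschitzModule μ p),
          Ψ ((lipFunctional μ p).mul a v) = (relaxedSlope μ p).mul a (Ψ v)) ∧
        (∀ v : LipschitzModule μ p,
          (relaxedSlope μ p).pnorm (Ψ v) = (lipFunctional μ p).pnorm v)) ∧
      (∀ (f : M → ℝ) (g : (lipFunctional μ p).relaxedDomain), IsLipschitz f →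
        (g : M →ₘ[μ] ℝ) =ᵐ[μ] f → (relaxedSlope μ p).val g =ᵐ[μ] locLip f)) := by
  let F := lipFunctional μ p
  refine ⟨?_, ?_, F.closable_iff, fun hcl => ⟨?_, fun f g hf hg => ?_⟩⟩
  · exact LpFunctional.isLpNormedSubmodule F.isClosed_zeroModule
      fun a _ hv => F.mul_mem_zeroModule a hv
  · exact ⟨F.quotientRelaxEquiv hrefl, F.relaxMap_d, F.relaxMap_mul, F.isGLB_pnorm_relaxMap hrefl⟩
  · exact ⟨F.relaxEquiv hrefl hcl, F.relaxMap_d, F.relaxMap_mul,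
      F.pnorm_relaxMap_of_closable hrefl hcl⟩
  · exact relaxedSlope_eq_locLip hrefl hcl g hf hg

theorem mainTheorem3 {M : Type*} [MetricSpace M] [CompleteSpace M] [MeasurableSpace M]
    [BorelSpace M] (μ : Measure M) [IsLocallyFiniteMeasure μ] [μ.InnerRegular] [SigmaFinite μ]
    (p : ℝ≥0) [Fact (1 < p)] (hrefl : (lipFunctional μ p).WeaklyReflexive) :
    -- the Lipschitz_0 module is a submodule of the Lipschitz module
    (lipFunctional μ p).IsLpNormedSubmodule (lipschitzZeroModule μ p) ∧
    -- the quotient is isometric to the cotangent module, as an `L^p`-normed module,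
    -- by the map that sends the class of `d_lip f` to `d_p f`
    (∃ Φ : (LipschitzModule μ p ⧸ lipschitzZeroModule μ p) ≃ₗᵢ[ℝ] CotangentModule μ p,
      (∀ f : lipDomain μ p,
        Φ (Submodule.Quotient.mk ((lipFunctional μ p).d f)) =
          (relaxedSlope μ p).d ((lipFunctional μ p).toRelaxed f)) ∧
      (∀ (a : Lp ℝ ∞ μ) (v : LipschitzModule μ p),
        Φ (Submodule.Quotient.mk ((lipFunctional μ p).mul a v)) =
          (relaxedSlope μ p).mul a (Φ (Submodule.Quotient.mk v))) ∧
      (∀ v : LipschitzModule μ p,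
        IsGLB (Set.range fun w : lipschitzZeroModule μ p => (lipFunctional μ p).pnorm (v + w))
          ((relaxedSlope μ p).pnorm (Φ (Submodule.Quotient.mk v))))) ∧
    -- closability of `d_lip`
    ((lipFunctional μ p).Closable ↔ lipschitzZeroModule μ p = ⊥) ∧
    ((lipFunctional μ p).Closable →
      (∃ Ψ : LipschitzModule μ p ≃ₗᵢ[ℝ] CotangentModule μ p,
        (∀ f : lipDomain μ p,
          Ψ ((lipFunctional μ p).d f) =
            (relaxedSlope μ p).d ((lipFunctional μ p).toRelaxed f)) ∧
        (∀ (a : Lp ℝ ∞ μ) (v : LipschitzModule μ p),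
          Ψ ((lipFunctional μ p).mul a v) = (relaxedSlope μ p).mul a (Ψ v)) ∧
        (∀ v : LipschitzModule μ p,
          (relaxedSlope μ p).pnorm (Ψ v) = (lipFunctional μ p).pnorm v)) ∧
      -- every Lipschitz function `f` with a relaxed slope satisfies `|Df|_{*,p} = lip f` a.e.
      (∀ (f : M → ℝ) (g : (lipFunctional μ p).relaxedDomain), IsLipschitz f →
        (g : M →ₘ[μ] ℝ) =ᵐ[μ] f → (relaxedSlope μ p).val g =ᵐ[μ] locLip f)) :=
  mainTheorem3_general μ p hrefl
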